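/- Let $\varphi:[0,\infty)\to\mathbb R$ be locally Lipschitz with $\varphi(\rho)\ge\nu_0>0$ for all $\rho\ge 0$. Consider on $\mathbb R^n$, $n\ge 1$, the Cauchy problem $$\partial_t^2u-\varphi\big(\|\nabla u(t)\|_{L^2}^2\big)\Delta u=0,\qquad u(0)=u_0,\quad \partial_tu(0)=u_1. \tag{K}$$ For $s>1$, $\eta>0$, $\sigma\ge 0$ let $(-\Delta)^{-\sigma/2}\gamma^s_{\eta,L^2}$ be the space of tempered distributions $f$ whose Fourier transform $\hat f$ is a locally integrable function with $$\int_{\mathbb R^n}|\xi|^{2\sigma}e^{\eta|\xi|^{1/s}}|\hat f(\xi)|^2\,d\xi<\infty ,$$ with the square root of this integral as norm, and let $\|f\|_{\dot H^\sigma}^2=\int|\xi|^{2\sigma}|\hat f(\xi)|^2d\xi$. (Here $\hat f$ is the unitary Fourier transform in the angular frequency $\xi$.) Put $$\mathcal H(u;t)=\|\partial_tu(t)\|_{L^2}^2+\int_0^{\|\nabla u(t)\|_{L^2}^2}\varphi(\rho)\,d\rho,\qquad \mathcal E_{3/2}(u;t)=\varphi\big(\|\nabla u(t)\|^2_{L^2}\big)\|u(t)\|_{\dot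 H^{3/2}}^2+\|\partial_tu(t)\|_{\dot H^{1/2}}^2 .$$ **Proposition.** There is a function $\tau:\mathbb R^2\to(0,\infty)$, depending only on $\varphi$ and $\nu_0$, and for each $n\ge1$ a life span $T_m=T_m(u_0,u_1)\in(0,\infty]$, a function of the data alone, such that the following holds for all $s>1$, $\eta>0$ and all nontrivial data $$(u_0,u_1)\in(-\Delta)^{-3/4}\gamma^s_{\eta,L^2}\times(-\Delta)^{-1/4}\gamma^s_{\eta,L^2}\quad\text{with}\quad \nabla u_0\in L^2,\ u_1\in L^2$$ (that is, with $\mathcal H(u;0)<\infty$). First, $T_m\ge\tau\big(\mathcal H(u;0),\mathcal E_{3/2}(u;0)\big)$. Secondly, (K) has a solution $u$ on $[0,T_m)$ in the class $$C\big([0,T_m);(-\Delta)^{-3/4}\gamma^s_{\eta,L^2}\big)\cap C^1\big([0,T_m);(-\Delta)^{-1/4}\gamma^s_{\eta,L^2}\big), \tag{C}$$ and for every $T\in(0,T_m]$ any solution on $[0,T)$ in the corresponding class coincides with $u$ on $[0,T)$. Moreover one of the following is true: (i) $T_m=+\infty$; (ii) $T_m<+\infty$ and $\limsup_{t\to T_m^-}\mathcal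 E_{3/2}(u;t)=+\infty$. Here membership in the second space of (C) means that $u-u_0\in C^1([0,T_m);(-\Delta)^{-1/4}\gamma^s_{\eta,L^2})$ (which is the same as $u\in C^1([0,T_m);(-\Delta)^{-1/4}\gamma^s_{\eta,L^2})$ if $u_0$ belongs to $(-\Delta)^{-1/4}\gamma^s_{\eta,L^2}$, for instance if $u_0\in L^2$). A solution has $\nabla u(t)\in L^2$ for all $t$ and satisfies, for every Schwartz function $\psi$ and every $t\in(0,T)$, $\frac{d}{dt}\langle\partial_tu(t),\psi\rangle=\varphi(\|\nabla u(t)\|_{L^2}^2)\langle\Delta u(t),\psi\rangle$. -/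

import Mathlib

open MeasureTheory Filter Topology Set
open scoped SchwartzMap FourierTransform Laplacian LineDeriv ENNReal

noncomputable section

namespace Kirchhoff

/-- The space `ℝⁿ` with its Euclidean norm. -/
abbrev Rn (n : ℕ) : Type := EuclideanSpace ℝ (Fin n)

/-- The Fourier transform of the tempered distribution `f` is the locally integrable function `g`
(equality in the sense of distributions, i.e. against compactly supported test functions). The
transform is Mathlib's, with kernel `exp (-2πi x·ξ)`; so the usual frequency variable is `2πξ`. -/
def HasFourierFunction {n : ℕ} (f : 𝓢'(Rn n, ℂ)) (g : Rn n → ℂ) : Prop :=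
  LocallyIntegrable g volume ∧
    ∀ ψ : 𝓢(Rn n, ℂ), HasCompactSupport (ψ : Rn n → ℂ) → (𝓕 f) ψ = ∫ ξ, ψ ξ * g ξ

/-- The weighted square norm `∫ w(ξ) |(𝓕 f)(ξ)|² dξ`. It is `∞` if `𝓕 f` is not a locally integrable
function (the infimum runs over the representatives of `𝓕 f`, which agree almost everywhere). -/
def fourierNormSq {n : ℕ} (w : Rn n → ℝ) (f : 𝓢'(Rn n, ℂ)) : ℝ≥0∞ :=
  ⨅ (g : Rn n → ℂ) (_ : HasFourierFunction f g), ∫⁻ ξ, ENNReal.ofReal (w ξ) * ‖g ξ‖ₑ ^ 2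

/-- The square of the norm of the homogeneous Sobolev space `Ḣ^σ = (-Δ)^(-σ/2) L²`. The symbol of
`-Δ` is `(2π|ξ|)²`. -/
def homSobolevNormSq {n : ℕ} (σ : ℝ) (f : 𝓢'(Rn n, ℂ)) : ℝ≥0∞ :=
  fourierNormSq (fun ξ => (2 * Real.pi * ‖ξ‖) ^ (2 * σ)) f

/-- The square of the norm of `(-Δ)^(-σ/2) γ^s_{η,L²}`, that is `‖(-Δ)^(σ/2) f‖²` in the Gevrey space
with the norm `‖h‖² = ∫ exp(η|ξ|^(1/s)) |ĥ(ξ)|² dξ` (the latter in the variable `2πξ`). -/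
def homGevreyNormSq {n : ℕ} (σ s η : ℝ) (f : 𝓢'(Rn n, ℂ)) : ℝ≥0∞ :=
  fourierNormSq (fun ξ => (2 * Real.pi * ‖ξ‖) ^ (2 * σ) *
    Real.exp (η * (2 * Real.pi * ‖ξ‖) ^ (1 / s))) f

/-- The square of the `L²(ℝⁿ)` norm of a tempered distribution, `∞` if it is not in `L²`. -/
def l2NormSq {n : ℕ} (f : 𝓢'(Rn n, ℂ)) : ℝ≥0∞ :=
  ⨅ (g : Lp ℂ 2 (volume : Measure (Rn n))) (_ : (g : 𝓢'(Rn n, ℂ)) = f), ‖g‖ₑ ^ 2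

/-- `‖∇f‖²` in `L²(ℝⁿ)`, with the distributional gradient. -/
def gradNormSq {n : ℕ} (f : 𝓢'(Rn n, ℂ)) : ℝ≥0∞ :=
  ∑ i : Fin n, l2NormSq (∂_{EuclideanSpace.single i (1 : ℝ)} f)

/-- The Hamiltonian `‖u_t‖² + ∫_0^{‖∇u‖²} φ(ρ) dρ` at a time at which `u = f` and `u_t = g`. -/
def hamiltonian {n : ℕ} (φ : ℝ → ℝ) (f g : 𝓢'(Rn n, ℂ)) : ℝ :=
  (l2NormSq g).toReal + ∫ ρ in (0 : ℝ)..(gradNormSq f).toReal, φ ρ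

/-- The energy of order `3/2`, `φ(‖∇u‖²) ‖u‖²_{Ḣ^{3/2}} + ‖u_t‖²_{Ḣ^{1/2}}`, at a time at which `u = f`
and `u_t = g`. -/
def energy32 {n : ℕ} (φ : ℝ → ℝ) (f g : 𝓢'(Rn n, ℂ)) : ℝ :=
  φ (gradNormSq f).toReal * (homSobolevNormSq (3 / 2) f).toReal
    + (homSobolevNormSq (1 / 2) g).toReal

/-- The time interval `[0, T)`, where `T` may be infinite. -/
def timeInterval (T : EReal) : Set ℝ := {t : ℝ | 0 ≤ t ∧ (t : EReal) < T}

/-- `u ∈ C([0,T); X)`, where `X` is the space with square norm `N`. -/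
structure IsC0Curve {n : ℕ} (N : 𝓢'(Rn n, ℂ) → ℝ≥0∞) (T : EReal) (u : ℝ → 𝓢'(Rn n, ℂ)) :
    Prop where
  mem : ∀ t ∈ timeInterval T, N (u t) < ∞
  continuous : ∀ t ∈ timeInterval T,
    Tendsto (fun r => N (u r - u t)) (𝓝[timeInterval T] t) (𝓝 0)

/-- `u ∈ C¹([0,T); X)` with derivative `v`, where `X` is the space with square norm `N`. -/
structure IsC1Curve {n : ℕ} (N : 𝓢'(Rn n, ℂ) → ℝ≥0∞) (T : EReal) (u v : ℝ → 𝓢'(Rn n, ℂ)) :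
    Prop where
  mem : ∀ t ∈ timeInterval T, N (u t) < ∞
  hasDeriv : ∀ t ∈ timeInterval T,
    Tendsto (fun r => N ((((r - t : ℝ) : ℂ)⁻¹) • (u r - u t) - v t))
      (𝓝[timeInterval T \ {t}] t) (𝓝 0)
  deriv_isC0 : IsC0Curve N T v

/-- `u`, with time derivative `v`, solves on `[0,T)` the Cauchy problem
`u_tt - φ(‖∇u‖²) Δu = 0`, `u(0) = u₀`, `u_t(0) = u₁`, in the class
`C([0,T); (-Δ)^(-3/4) γ^s_{η,L²}) ∩ C¹([0,T); (-Δ)^(-1/4) γ^s_{η,L²})`.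
As `(-Δ)^(-3/4) γ^s_{η,L²}` is not contained in `(-Δ)^(-1/4) γ^s_{η,L²}` (low frequencies), the second
membership is required of `u - u(0)`; it is the same as that of `u` if `u(0)` belongs to the
latter space. -/
structure IsSolution {n : ℕ} (φ : ℝ → ℝ) (s η : ℝ) (u₀ u₁ : 𝓢'(Rn n, ℂ)) (T : EReal)
    (u v : ℝ → 𝓢'(Rn n, ℂ)) : Prop where
  init : u 0 = u₀
  init_deriv : v 0 = u₁
  isC0 : IsC0Curve (homGevreyNormSq (3 / 2) s η) T u
  isC1 : IsC1Curve (homGevreyNormSq (1 / 2) s η) T (fun t => u t - u 0) v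
  grad_finite : ∀ t ∈ timeInterval T, gradNormSq (u t) < ∞
  /-- The equation `∂_t (u_t) = φ(‖∇u‖²) Δu` in `𝓢'(ℝⁿ)`, at every time `t ∈ (0,T)`. -/
  equation : ∀ t ∈ timeInterval T, 0 < t → ∀ ψ : 𝓢(Rn n, ℂ),
    HasDerivAt (fun r => v r ψ) ((φ (gradNormSq (u t)).toReal : ℂ) * (Δ (u t)) ψ) t

end Kirchhoff

end

/-! On the Fourier side the equation decouples. Once the wave speed `c(t) = φ(‖∇u(t)‖²)` is regarded
as given, every frequency carries its own oscillator `y'' = -c m² y` with `m = |ξ|`, whose solution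
is a convergent series (`waveY`, `waveZ`). The only coupling is through the scalar function `r(t) =
‖∇u(t)‖²`, so the Cauchy problem amounts to the fixed point equation `r(t) = ∫ m² |y(t)|²` with `c =
φ ∘ r` (`IsFix`).

Two estimates carry the argument. Let `E = c m² |y|² + |y'|²`. If `c ≥ ν` and the increments of `c`
are at most `L` times those of time, then `E` grows at most like `exp (L t / ν)`, uniformly in the
frequency (`waveE_le_mul_exp`). Hence every weight in the frequency is propagated without loss, the
Gevrey weight with its exponent `η` included. Differentiating `m² |y|²` leaves one factor `m` beside
`E`; so the Lipschitz constant of `r` is governed by `∫ m E`, the energy of order 3/2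
(`abs_waveGrad_sub_le`). Secondly, two speeds that agree up to time `a` and differ by at most `δ`
afterwards give values of `r` whose distance is at most `δ`, times a factor small with the length of
the interval, times the same energy at time `a` (`abs_waveGrad_sub_waveGrad_le`).

The fixed point map is therefore a contraction in the sup norm, on functions with a suitable
Lipschitz constant, over an interval whose length depends only on `φ`, `ν` and bounds for `r` and `∫
m E` at its left end (`exists_extension_time`). Extending from the degenerate interval `[0, 0]`
gives the lower bound for the life span, as `ν r(0)` is at most the Hamiltonian. The second estimate
also gives uniqueness of the fixed point. If `∫ m E` stayed bounded near a finite end of the life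
span, then `r` would grow at most linearly, the extension time would stay away from zero, and the
solution would reach past the end (`exists_lt_waveEnergy`). No Gevrey weight enters `IsFix`, so the
life span does not depend on `s` and `η`.

To compare with an arbitrary solution `w` of the class, `‖∇w‖²` is first shown to be locally
Lipschitz, by pairing increments in `Ḣ^{1/2}` with values in `Ḣ^{3/2}`. Its speed is then
admissible, and uniqueness for the linear equation (`IsC1Curve.eq_zero_of_wave`) identifies `w` with
the flow of that speed; so `‖∇w‖²` is a fixed point (`IsSolution.isFix`). Linear uniqueness comes
from testing with `Δ^k ψ`, where `ψ` has bounded frequencies: this is a hierarchy of scalar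
equations with geometric bounds, and iterated integration forces it to vanish (`hierarchy_eq_zero`).
-/

noncomputable section

namespace Kirchhoff

/-! ### Density of compactly supported test functions in the Schwartz space. -/

section Cutoff

variable {E : Type*} [NormedAddCommGroup E] [InnerProductSpace ℝ E] [FiniteDimensional ℝ E]

/-- Derivatives of the complement of a dilated cutoff are small, up to linear growth. -/
theorem norm_iteratedFDeriv_one_sub_bump_le (χ : ContDiffBump (0 : E)) (hχ : χ.rIn = 1) (i : ℕ) :
    ∃ C : ℝ, 0 ≤ C ∧ ∀ ε : ℝ, 0 < ε → ε ≤ 1 → ∀ x : E,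
      ‖iteratedFDeriv ℝ i (fun y : E => 1 - χ (ε • y)) x‖ ≤ C * ε * (1 + ‖x‖) := by
  rcases Nat.eq_zero_or_pos i with rfl | hi
  · refine ⟨1, zero_le_one, fun ε h0 h1 x => ?_⟩
    rw [norm_iteratedFDeriv_zero, Real.norm_eq_abs, abs_of_nonneg (by linarith [χ.le_one (x := ε • x)])]
    -- Where the dilated variable lies in the unit ball the difference vanishes; elsewhere `1 < ε *
    -- ‖x‖` absorbs the trivial bound by `1`.
    by_cases hx : ‖ε • x‖ ≤ 1
    · rw [χ.one_of_mem_closedBall (by simpa [hχ] using hx)]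
      have : 0 ≤ ε * (1 + ‖x‖) := by positivity
      linarith
    · rw [norm_smul, Real.norm_eq_abs, abs_of_pos h0] at hx
      have := χ.nonneg (x := ε • x)
      nlinarith
  · have hs : ContDiff ℝ (i : ℕ∞) (fun y : E => 1 - χ y) := contDiff_const.sub χ.contDiff
    obtain ⟨C, hC⟩ := (χ.hasCompactSupport.toSchwartzMap χ.contDiff).decay 0 i
    refine ⟨C, hC.1.le, fun ε h0 h1 x => ?_⟩
    have h2 : ∀ z, ‖iteratedFDeriv ℝ i (fun y : E => 1 - χ y) z‖ ≤ C := by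
      intro z
      have h3 : (fun y : E => 1 - χ y) = (fun _ => (1 : ℝ)) - (χ : E → ℝ) := rfl
      rw [h3, iteratedFDeriv_sub_apply (contDiff_const.contDiffAt) (χ.contDiff.contDiffAt),
        iteratedFDeriv_const_of_ne (by omega)]
      have h5 := hC.2 z
      rw [pow_zero, one_mul] at h5
      simp only [Pi.zero_apply, zero_sub, norm_neg]
      exact h5
    have h4 := congrFun (iteratedFDeriv_comp_const_smul (𝕜 := ℝ) (i := i) ε hs) x
    rw [h4, norm_smul, norm_pow, Real.norm_eq_abs, abs_of_pos h0]
    have h5 : ε ^ i ≤ ε := pow_le_of_le_one h0.le h1 (by omega)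
    calc ε ^ i * _ ≤ ε * C := by gcongr; exact h2 _
      _ ≤ C * ε * (1 + ‖x‖) := by
        have := mul_nonneg (mul_nonneg hC.1.le h0.le) (norm_nonneg x); nlinarith

/-- Compactly supported functions are sequentially dense in the Schwartz space. -/
theorem exists_hasCompactSupport_tendsto (ψ : 𝓢(E, ℂ)) :
    ∃ ψN : ℕ → 𝓢(E, ℂ), (∀ N, HasCompactSupport (ψN N : E → ℂ)) ∧
      Tendsto ψN atTop (𝓝 ψ) := by
  let χ : ContDiffBump (0 : E) := ⟨1, 2, one_pos, one_lt_two⟩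
  let ε : ℕ → ℝ := fun N => 1 / ((N : ℝ) + 1)
  have hε : ∀ N, 0 < ε N := fun N => by positivity
  have hε1 : ∀ N, ε N ≤ 1 := fun N => by
    rw [div_le_one (by positivity)]; linarith [(Nat.cast_nonneg N : (0 : ℝ) ≤ N)]
  have hcs : ∀ N, HasCompactSupport (fun x : E => (χ (ε N • x)) • ψ x) := fun N =>
    (χ.hasCompactSupport.comp_smul (hε N).ne').smul_right
  have hsm : ∀ N, ContDiff ℝ (⊤ : ℕ∞) (fun x : E => (χ (ε N • x)) • ψ x) := fun N =>
    (χ.contDiff.comp (contDiff_const_smul _)).smul (ψ.smooth ⊤)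
  refine ⟨fun N => (hcs N).toSchwartzMap (hsm N), hcs, ?_⟩
  rw [(schwartz_withSeminorms ℝ E ℂ).tendsto_nhds]
  rintro ⟨k, n⟩ δ hδ
  choose C hC0 hC using fun i => norm_iteratedFDeriv_one_sub_bump_le χ rfl i
  -- The factor `1 + ‖x‖` that the cutoff costs is paid for by the seminorm with one more power of
  -- `‖x‖`.
  let S : ℝ := ∑ i ∈ Finset.range (n + 1), (n.choose i : ℝ) * C i *
    (SchwartzMap.seminorm ℝ k (n - i) ψ + SchwartzMap.seminorm ℝ (k + 1) (n - i) ψ)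
  have hS : 0 ≤ S := Finset.sum_nonneg fun i _ => by have := hC0 i; positivity
  have key : ∀ N, SchwartzMap.seminorm ℝ k n ((hcs N).toSchwartzMap (hsm N) - ψ) ≤ S * ε N := by
    intro N
    refine SchwartzMap.seminorm_le_bound ℝ k n _ (mul_nonneg hS (hε N).le) fun x => ?_
    have h1 : (((hcs N).toSchwartzMap (hsm N) - ψ : 𝓢(E, ℂ)) : E → ℂ) =
        -(fun y => (1 - χ (ε N • y)) • ψ y) := by
      ext y; simp [sub_smul]
    rw [h1, iteratedFDeriv_neg_apply, norm_neg]
    have h2 := norm_iteratedFDeriv_smul_le (𝕜 := ℝ) (N := (⊤ : ℕ∞)) (n := n)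
      (f := fun y : E => 1 - χ (ε N • y)) (g := ψ)
      (contDiff_const.sub (χ.contDiff.comp (contDiff_const_smul _))) (ψ.smooth ⊤) x
      (by exact_mod_cast le_top)
    calc ‖x‖ ^ k * _ ≤ ‖x‖ ^ k * _ := mul_le_mul_of_nonneg_left h2 (by positivity)
      _ ≤ S * ε N := by
        rw [Finset.mul_sum, Finset.sum_mul]
        refine Finset.sum_le_sum fun i _ => ?_
        have h3 := hC i (ε N) (hε N) (hε1 N) x
        have h4 := SchwartzMap.le_seminorm ℝ k (n - i) ψ x
        have h5 := SchwartzMap.le_seminorm ℝ (k + 1) (n - i) ψ x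
        calc ‖x‖ ^ k * ((n.choose i : ℝ) * ‖iteratedFDeriv ℝ i (fun y : E => 1 - χ (ε N • y)) x‖ *
              ‖iteratedFDeriv ℝ (n - i) ψ x‖)
            ≤ ‖x‖ ^ k * ((n.choose i : ℝ) * (C i * ε N * (1 + ‖x‖)) *
              ‖iteratedFDeriv ℝ (n - i) ψ x‖) := by gcongr
          _ = (n.choose i : ℝ) * C i * (‖x‖ ^ k * ‖iteratedFDeriv ℝ (n - i) ψ x‖ +
              ‖x‖ ^ (k + 1) * ‖iteratedFDeriv ℝ (n - i) ψ x‖) * ε N := by ring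
          _ ≤ _ := by
            have := hC0 i; have := hε N
            gcongr
  have hlim : Tendsto (fun N => S * ε N) atTop (𝓝 0) := by
    simpa only [mul_zero] using (tendsto_one_div_add_atTop_nhds_zero_nat (𝕜 := ℝ)).const_mul S
  filter_upwards [hlim.eventually (gt_mem_nhds hδ)] with N hN
  exact (key N).trans_lt hN

end Cutoff

/-! ### Tempered distributions whose Fourier transform is a function. -/

variable {n : ℕ}

/-- A tempered distribution is determined by its values on compactly supported test functions. -/
theorem temperedDistribution_ext_of_hasCompactSupport {f g : 𝓢'(Rn n, ℂ)}
    (h : ∀ ψ : 𝓢(Rn n, ℂ), HasCompactSupport (ψ : Rn n → ℂ) → f ψ = g ψ) : f = g := by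
  ext ψ
  obtain ⟨ψN, hc, ht⟩ := exists_hasCompactSupport_tendsto ψ
  have h1 := (map_continuous f).continuousAt.tendsto.comp ht
  have h2 := (map_continuous g).continuousAt.tendsto.comp ht
  refine tendsto_nhds_unique h1 (h2.congr fun N => (h _ (hc N)).symm)

/-- Real smooth test functions of compact support already separate locally integrable functions.
Thus the infimum defining `fourierNormSq` runs over a single class and is an honest integral. -/
theorem HasFourierFunction.ae_eq {f : 𝓢'(Rn n, ℂ)} {g g' : Rn n → ℂ}
    (hg : HasFourierFunction f g) (hg' : HasFourierFunction f g') : g =ᵐ[volume] g' := by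
  refine ae_eq_of_integral_contDiff_smul_eq hg.1 hg'.1 fun θ hs hc => ?_
  have hg₁ : HasCompactSupport (Complex.ofRealCLM ∘ θ) := hc.comp_left rfl
  have hg₂ : ContDiff ℝ (⊤ : ℕ∞) (Complex.ofRealCLM ∘ θ) := by fun_prop
  have h1 := hg.2 (hg₁.toSchwartzMap hg₂) hg₁
  have h2 := hg'.2 (hg₁.toSchwartzMap hg₂) hg₁
  simpa using h1.symm.trans h2

theorem HasFourierFunction.congr {f : 𝓢'(Rn n, ℂ)} {g g' : Rn n → ℂ}
    (hg : HasFourierFunction f g) (h : g =ᵐ[volume] g') : HasFourierFunction f g' :=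
  ⟨hg.1.congr h, fun ψ hψ => (hg.2 ψ hψ).trans
    (integral_congr_ae (by filter_upwards [h] with x hx; rw [hx]))⟩

theorem HasFourierFunction.fourierNormSq_eq {f : 𝓢'(Rn n, ℂ)} {g : Rn n → ℂ}
    (hg : HasFourierFunction f g) (w : Rn n → ℝ) :
    fourierNormSq w f = ∫⁻ ξ, ENNReal.ofReal (w ξ) * ‖g ξ‖ₑ ^ 2 := by
  refine le_antisymm (iInf₂_le g hg) (le_iInf₂ fun g' hg' => le_of_eq ?_)
  exact lintegral_congr_ae (by filter_upwards [hg.ae_eq hg'] with x hx; rw [hx])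

theorem exists_hasFourierFunction_of_fourierNormSq_lt_top {f : 𝓢'(Rn n, ℂ)} {w : Rn n → ℝ}
    (h : fourierNormSq w f < ∞) : ∃ g, HasFourierFunction f g := by
  simp only [fourierNormSq, iInf_lt_iff] at h
  exact ⟨h.choose, h.choose_spec.choose⟩

theorem integrable_mul_of_hasCompactSupport {g : Rn n → ℂ} (hg : LocallyIntegrable g volume)
    (ψ : 𝓢(Rn n, ℂ)) (hψ : HasCompactSupport (ψ : Rn n → ℂ)) :
    Integrable (fun ξ => ψ ξ * g ξ) volume := by
  simpa using hg.integrable_smul_left_of_hasCompactSupport ψ.continuous hψ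

theorem HasFourierFunction.sub {f f' : 𝓢'(Rn n, ℂ)} {g g' : Rn n → ℂ}
    (hg : HasFourierFunction f g) (hg' : HasFourierFunction f' g') :
    HasFourierFunction (f - f') (fun ξ => g ξ - g' ξ) := by
  refine ⟨hg.1.sub hg'.1, fun ψ hψ => ?_⟩
  have h1 : 𝓕 (f - f') ψ = 𝓕 f ψ - 𝓕 f' ψ := by
    simp [TemperedDistribution.fourier_apply]
  rw [h1, hg.2 ψ hψ, hg'.2 ψ hψ, ← integral_sub
    (integrable_mul_of_hasCompactSupport hg.1 ψ hψ) (integrable_mul_of_hasCompactSupport hg'.1 ψ hψ)]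
  simp_rw [mul_sub]

theorem HasFourierFunction.const_smul {f : 𝓢'(Rn n, ℂ)} {g : Rn n → ℂ}
    (hg : HasFourierFunction f g) (a : ℂ) : HasFourierFunction (a • f) (fun ξ => a * g ξ) := by
  refine ⟨hg.1.smul a, fun ψ hψ => ?_⟩
  have h1 : 𝓕 (a • f) ψ = a * 𝓕 f ψ := by
    simp [TemperedDistribution.fourier_apply]
  rw [h1, hg.2 ψ hψ, ← integral_const_mul]
  congr 1; ext ξ; ring

theorem memLp_two_of_lintegral_sq_lt_top {α : Type*} {_ : MeasurableSpace α} {μ : Measure α} {g : α → ℂ}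
    (hm : AEStronglyMeasurable g μ) (h : ∫⁻ x, ‖g x‖ₑ ^ 2 ∂μ < ∞) : MemLp g 2 μ := by
  refine ⟨hm, ?_⟩
  rw [eLpNorm_lt_top_iff_lintegral_rpow_enorm_lt_top two_ne_zero ENNReal.ofNat_ne_top]
  simpa using h

theorem enorm_toLp_sq {α : Type*} {_ : MeasurableSpace α} {μ : Measure α} {g : α → ℂ}
    (hg : MemLp g 2 μ) : ‖hg.toLp g‖ₑ ^ 2 = ∫⁻ x, ‖g x‖ₑ ^ 2 ∂μ := by
  rw [Lp.enorm_toLp, eLpNorm_eq_lintegral_rpow_enorm_toReal two_ne_zero ENNReal.ofNat_ne_top]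
  simp only [ENNReal.toReal_ofNat, ENNReal.rpow_ofNat]
  rw [← ENNReal.rpow_natCast, ← ENNReal.rpow_mul]
  norm_num

/-- Functions that are locally integrable, and square integrable away from the origin. They define
tempered distributions. -/
def IsTemperedFn (g : Rn n → ℂ) : Prop :=
  LocallyIntegrable g volume ∧ ∫⁻ ξ in {ξ : Rn n | 1 < ‖ξ‖}, ‖g ξ‖ₑ ^ 2 < ∞

theorem measurableSet_one_lt_norm : MeasurableSet {ξ : Rn n | 1 < ‖ξ‖} :=
  measurableSet_lt measurable_const measurable_norm

/-- Cut at the unit sphere: the inner part is in `L¹`, the outer part in `L²`, and each of these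
pairs with Schwartz functions. -/
theorem IsTemperedFn.exists_temperedDistribution {g : Rn n → ℂ} (hg : IsTemperedFn g) :
    ∃ D : 𝓢'(Rn n, ℂ), ∀ ψ : 𝓢(Rn n, ℂ), Integrable (fun ξ => ψ ξ * g ξ) volume ∧
      D ψ = ∫ ξ, ψ ξ * g ξ := by
  set s := {ξ : Rn n | 1 < ‖ξ‖} with hs_def
  have hs : MeasurableSet s := measurableSet_one_lt_norm
  have h2 : MemLp (s.indicator g) 2 volume := by
    rw [memLp_indicator_iff_restrict hs]
    exact memLp_two_of_lintegral_sq_lt_top hg.1.aestronglyMeasurable.restrict hg.2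
  have h1 : MemLp (sᶜ.indicator g) 1 volume := by
    rw [memLp_one_iff_integrable, integrable_indicator_iff hs.compl]
    refine (hg.1.integrableOn_isCompact (isCompact_closedBall (0 : Rn n) 1)).mono_set ?_
    intro ξ hξ
    simpa [hs_def] using hξ
  refine ⟨(h1.toLp _ : 𝓢'(Rn n, ℂ)) + (h2.toLp _ : 𝓢'(Rn n, ℂ)), fun ψ => ?_⟩
  have i1 : Integrable (fun ξ => ψ ξ * sᶜ.indicator g ξ) volume :=
    (memLp_one_iff_integrable.1 h1).bdd_mul (c := SchwartzMap.seminorm ℝ 0 0 ψ)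
      ψ.continuous.aestronglyMeasurable
      (Eventually.of_forall fun x => SchwartzMap.norm_le_seminorm ℝ ψ x)
  have i2 : Integrable (fun ξ => ψ ξ * s.indicator g ξ) volume :=
    (ψ.memLp 2 volume).integrable_mul h2
  have he : (fun ξ => ψ ξ * g ξ) =
      fun ξ => ψ ξ * sᶜ.indicator g ξ + ψ ξ * s.indicator g ξ := by
    ext ξ
    rw [← mul_add, ← Pi.add_apply, indicator_compl_add_self]
  refine ⟨he ▸ i1.add i2, ?_⟩
  rw [he, integral_add i1 i2]
  change (h1.toLp _ : 𝓢'(Rn n, ℂ)) ψ + (h2.toLp _ : 𝓢'(Rn n, ℂ)) ψ = _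
  rw [Lp.toTemperedDistribution_apply, Lp.toTemperedDistribution_apply]
  congr 1
  · exact integral_congr_ae (by filter_upwards [h1.coeFn_toLp] with x hx; simp only [hx, smul_eq_mul])
  · exact integral_congr_ae (by filter_upwards [h2.coeFn_toLp] with x hx; simp only [hx, smul_eq_mul])

/-- Removes the restriction to compactly supported test functions: both sides are tempered
distributions that agree on a dense set. -/
theorem HasFourierFunction.fourier_apply {f : 𝓢'(Rn n, ℂ)} {g : Rn n → ℂ}
    (hf : HasFourierFunction f g) (hg : IsTemperedFn g) (ψ : 𝓢(Rn n, ℂ)) :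
    Integrable (fun ξ => ψ ξ * g ξ) volume ∧ 𝓕 f ψ = ∫ ξ, ψ ξ * g ξ := by
  obtain ⟨D, hD⟩ := hg.exists_temperedDistribution
  have : 𝓕 f = D := temperedDistribution_ext_of_hasCompactSupport fun ψ hψ => by
    rw [hf.2 ψ hψ, (hD ψ).2]
  rw [this]
  exact hD ψ

theorem HasFourierFunction.ext {f f' : 𝓢'(Rn n, ℂ)} {g : Rn n → ℂ}
    (hf : HasFourierFunction f g) (hf' : HasFourierFunction f' g) : f = f' := by
  have : 𝓕 f = 𝓕 f' := temperedDistribution_ext_of_hasCompactSupport fun ψ hψ => by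
    rw [hf.2 ψ hψ, hf'.2 ψ hψ]
  have h2 : 𝓕⁻ (𝓕 f) = 𝓕⁻ (𝓕 f') := by rw [this]
  simpa using h2

theorem IsTemperedFn.exists_hasFourierFunction {g : Rn n → ℂ} (hg : IsTemperedFn g) :
    ∃ f : 𝓢'(Rn n, ℂ), HasFourierFunction f g := by
  obtain ⟨D, hD⟩ := hg.exists_temperedDistribution
  refine ⟨𝓕⁻ D, hg.1, fun ψ _ => ?_⟩
  rw [FourierTransform.fourier_fourierInv_eq]
  exact (hD ψ).2

theorem HasFourierFunction.apply_eq {f : 𝓢'(Rn n, ℂ)} {g : Rn n → ℂ}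
    (hf : HasFourierFunction f g) (hg : IsTemperedFn g) (ψ : 𝓢(Rn n, ℂ)) :
    f ψ = ∫ ξ, (𝓕⁻ ψ) ξ * g ξ := by
  rw [← (hf.fourier_apply hg _).2, TemperedDistribution.fourier_apply,
    FourierTransform.fourier_fourierInv_eq]

/-- The inverse Fourier transform turns the Laplacian into multiplication by `-(2π|ξ|)²`. -/
theorem fourierInv_laplacian_apply (ψ : 𝓢(Rn n, ℂ)) (ξ : Rn n) :
    (𝓕⁻ (Δ ψ)) ξ = -(((2 * Real.pi * ‖ξ‖) ^ 2 : ℝ) : ℂ) * (𝓕⁻ ψ) ξ := by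
  let b := EuclideanSpace.basisFun (Fin n) ℝ
  have hs : ∀ i, (𝓕⁻ (∂_{b i} (∂_{b i} ψ))) ξ =
      -(((2 * Real.pi) ^ 2 * (inner ℝ ξ (b i)) ^ 2 : ℝ) : ℂ) * (𝓕⁻ ψ) ξ := by
    intro i
    have ht : (inner ℝ · (b i)).HasTemperateGrowth := by fun_prop
    rw [SchwartzMap.fourierInv_lineDerivOp_eq, SchwartzMap.fourierInv_lineDerivOp_eq]
    simp only [smul_apply, SchwartzMap.smulLeftCLM_apply_apply ht, smul_eq_mul,
      Complex.real_smul]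
    push_cast
    linear_combination ((2 * Real.pi) ^ 2 * ((inner ℝ ξ (b i) : ℝ) : ℂ) ^ 2 * (𝓕⁻ ψ) ξ) * Complex.I_sq
  have h1 : (𝓕⁻ (Δ ψ)) = ∑ i, 𝓕⁻ (∂_{b i} (∂_{b i} ψ)) := by
    rw [SchwartzMap.laplacian_eq_sum b]
    exact map_sum (FourierTransform.fourierInvCLM ℂ 𝓢(Rn n, ℂ)) _ _
  rw [h1, sum_apply, Finset.sum_congr rfl fun i _ => hs i, ← Finset.sum_mul,
    Finset.sum_neg_distrib]
  congr 2
  rw [mul_pow _ ‖ξ‖, ← b.sum_sq_inner_left ξ, Finset.mul_sum, Complex.ofReal_sum]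

theorem HasFourierFunction.laplacian_apply {f : 𝓢'(Rn n, ℂ)} {g : Rn n → ℂ}
    (hf : HasFourierFunction f g) (hg : IsTemperedFn g) (ψ : 𝓢(Rn n, ℂ)) :
    (Δ f) ψ = ∫ ξ, -(((2 * Real.pi * ‖ξ‖) ^ 2 : ℝ) : ℂ) * (𝓕⁻ ψ) ξ * g ξ := by
  rw [TemperedDistribution.laplacian_apply_apply, hf.apply_eq hg]
  simp_rw [fourierInv_laplacian_apply]

/-- Plancherel in both directions. A finite integral puts `g` in `L²`, and its inverse transform
represents `f`; conversely the transform of any `L²` representative of `f` is almost everywhere `g`.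
-/
theorem HasFourierFunction.l2NormSq_eq {f : 𝓢'(Rn n, ℂ)} {g : Rn n → ℂ}
    (hf : HasFourierFunction f g) : l2NormSq f = ∫⁻ ξ, ‖g ξ‖ₑ ^ 2 := by
  refine le_antisymm ?_ (le_iInf₂ fun h hh => ?_)
  · rcases eq_or_ne (∫⁻ ξ, ‖g ξ‖ₑ ^ 2) ∞ with h | h
    · rw [h]; exact le_top (α := ℝ≥0∞)
    have hL := memLp_two_of_lintegral_sq_lt_top hf.1.aestronglyMeasurable (lt_top_iff_ne_top.2 h)
    have ht : IsTemperedFn g :=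
      ⟨hf.1, (setLIntegral_le_lintegral _ _).trans_lt (lt_top_iff_ne_top.2 h)⟩
    have hF : ((hL.toLp g : Lp ℂ 2 (volume : Measure (Rn n))) : 𝓢'(Rn n, ℂ)) = 𝓕 f := by
      ext ψ
      rw [(hf.fourier_apply ht ψ).2, Lp.toTemperedDistribution_apply]
      exact integral_congr_ae
        (by filter_upwards [hL.coeFn_toLp] with x hx; simp only [hx, smul_eq_mul])
    have hF' : ((𝓕⁻ (hL.toLp g) : Lp ℂ 2 (volume : Measure (Rn n))) : 𝓢'(Rn n, ℂ)) = f := by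
      rw [← Lp.fourierInv_toTemperedDistribution_eq, hF, FourierTransform.fourierInv_fourier_eq]
    refine iInf₂_le_of_le _ hF' (le_of_eq ?_)
    rw [← enorm_toLp_sq hL]
    congr 1
    have h3 := Lp.norm_fourier_eq (𝓕⁻ (hL.toLp g))
    rw [FourierTransform.fourier_fourierInv_eq] at h3
    rw [← ofReal_norm, ← ofReal_norm, h3]
  · have h1 : HasFourierFunction f (𝓕 h : Lp ℂ 2 (volume : Measure (Rn n))) := by
      refine ⟨(Lp.memLp _).locallyIntegrable (by norm_num), fun ψ _ => ?_⟩
      rw [← hh, Lp.fourier_toTemperedDistribution_eq, Lp.toTemperedDistribution_apply]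
      rfl
    have h2 : ‖h‖ₑ = ‖(𝓕 h : Lp ℂ 2 (volume : Measure (Rn n)))‖ₑ := by
      rw [← ofReal_norm, ← ofReal_norm, Lp.norm_fourier_eq]
    have h3 := enorm_toLp_sq (Lp.memLp (𝓕 h : Lp ℂ 2 (volume : Measure (Rn n))))
    rw [Lp.toLp_coeFn] at h3
    rw [h2, h3]
    exact (lintegral_congr_ae (by filter_upwards [hf.ae_eq h1] with x hx; rw [hx])).le

theorem HasFourierFunction.lineDeriv {f : 𝓢'(Rn n, ℂ)} {g : Rn n → ℂ}
    (hf : HasFourierFunction f g) (i : Fin n) :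
    HasFourierFunction (∂_{EuclideanSpace.single i (1 : ℝ)} f)
      (fun ξ => (2 * Real.pi * Complex.I) * ((ξ i : ℝ) : ℂ) * g ξ) := by
  have hc : Continuous fun ξ : Rn n => (2 * Real.pi * Complex.I) * ((ξ i : ℝ) : ℂ) := by fun_prop
  have ha : ∀ (a : ℂ) (D : 𝓢'(Rn n, ℂ)) (ψ : 𝓢(Rn n, ℂ)), (a • D) ψ = a * D ψ := fun _ _ _ => rfl
  have hin : ∀ ξ : Rn n, inner ℝ ξ (EuclideanSpace.single i (1 : ℝ)) = ξ i := fun ξ => by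
    rw [EuclideanSpace.inner_single_right]; simp
  refine ⟨by simpa using hf.1.continuous_smul hc, fun ψ hψ => ?_⟩
  have ht : (fun ξ : Rn n => ((inner ℝ ξ (EuclideanSpace.single i (1 : ℝ)) : ℝ) : ℂ)).HasTemperateGrowth := by
    fun_prop
  rw [TemperedDistribution.fourier_lineDerivOp_eq]
  rw [ha, TemperedDistribution.smulLeftCLM_apply_apply, hf.2, ← integral_const_mul]
  · congr 1; ext ξ
    rw [SchwartzMap.smulLeftCLM_apply_apply ht, hin]
    simp only [smul_eq_mul]; ring
  · rw [SchwartzMap.smulLeftCLM_apply ht]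
    exact hψ.mono fun x hx h0 => hx (by simp [h0])

theorem HasFourierFunction.gradNormSq_eq {f : 𝓢'(Rn n, ℂ)} {g : Rn n → ℂ}
    (hf : HasFourierFunction f g) :
    gradNormSq f = ∫⁻ ξ, ENNReal.ofReal ((2 * Real.pi * ‖ξ‖) ^ 2) * ‖g ξ‖ₑ ^ 2 := by
  have hm := hf.1.aestronglyMeasurable.enorm.pow_const 2
  rw [gradNormSq, Finset.sum_congr rfl fun i _ => (hf.lineDeriv i).l2NormSq_eq,
    ← lintegral_finsetSum']
  · congr 1; ext ξ
    have h1 : ∀ i : Fin n, ‖(2 * Real.pi * Complex.I) * ((ξ i : ℝ) : ℂ) * g ξ‖ₑ ^ 2 =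
        ENNReal.ofReal ((2 * Real.pi) ^ 2 * (ξ i) ^ 2) * ‖g ξ‖ₑ ^ 2 := fun i => by
      rw [enorm_mul, mul_pow, ← ofReal_norm (_ * _), ← ENNReal.ofReal_pow (norm_nonneg _)]
      congr 2
      simp [mul_pow, abs_of_pos Real.pi_pos]
    simp_rw [h1]
    rw [← Finset.sum_mul, ← ENNReal.ofReal_sum_of_nonneg fun i _ => by positivity,
      ← Finset.mul_sum, mul_pow _ ‖ξ‖, EuclideanSpace.real_norm_sq_eq]
  · intro i _
    exact (hf.lineDeriv i).1.aestronglyMeasurable.enorm.pow_const 2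

/-! ### The oscillator at one frequency, solved by a power series in the squared frequency. -/

/-- The coefficient functions of the expansion in powers of `-l` of the solution of
`y'' = -l c(t) y`, `y(0) = α`, `y'(0) = β`. -/
def waveTerm (c : ℝ → ℝ) (α β : ℝ) : ℕ → ℝ → ℝ
  | 0 => fun t => α + β * t
  | k + 1 => fun t => ∫ s in (0 : ℝ)..t, ∫ r in (0 : ℝ)..s, c r * waveTerm c α β k r

/-- The derivatives of `waveTerm`. -/
def waveTermDeriv (c : ℝ → ℝ) (α β : ℝ) : ℕ → ℝ → ℝ
  | 0 => fun _ => β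
  | k + 1 => fun t => ∫ r in (0 : ℝ)..t, c r * waveTerm c α β k r

/-- The solution of `y'' = -l c(t) y`, `y(0) = α`, `y'(0) = β`. -/
def waveSol (c : ℝ → ℝ) (α β l t : ℝ) : ℝ := ∑' k, (-l) ^ k * waveTerm c α β k t

/-- The time derivative of `waveSol`. -/
def waveSolDeriv (c : ℝ → ℝ) (α β l t : ℝ) : ℝ := ∑' k, (-l) ^ k * waveTermDeriv c α β k t

theorem waveTerm_zero_right (c : ℝ → ℝ) (α β : ℝ) (k : ℕ) :
    waveTerm c α β (k + 1) 0 = 0 := by simp [waveTerm]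

theorem waveTermDeriv_zero_right (c : ℝ → ℝ) (α β : ℝ) (k : ℕ) :
    waveTermDeriv c α β (k + 1) 0 = 0 := by simp [waveTermDeriv]

theorem waveSol_zero (c : ℝ → ℝ) (α β l : ℝ) : waveSol c α β l 0 = α := by
  rw [waveSol, tsum_eq_single 0]
  · simp [waveTerm]
  · rintro (_ | k) hk
    · exact absurd rfl hk
    · rw [waveTerm_zero_right, mul_zero]

theorem waveSolDeriv_zero (c : ℝ → ℝ) (α β l : ℝ) : waveSolDeriv c α β l 0 = β := by
  rw [waveSolDeriv, tsum_eq_single 0]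
  · simp [waveTermDeriv]
  · rintro (_ | k) hk
    · exact absurd rfl hk
    · rw [waveTermDeriv_zero_right, mul_zero]

theorem waveTerm_congr {c c' : ℝ → ℝ} {T : ℝ} (h : ∀ t ∈ Icc 0 T, c t = c' t) (α β : ℝ) (k : ℕ) :
    ∀ t ∈ Icc 0 T, waveTerm c α β k t = waveTerm c' α β k t := by
  induction k with
  | zero => intro t _; rfl
  | succ k ih =>
    intro t ht
    refine intervalIntegral.integral_congr fun s hs => ?_
    rw [uIcc_of_le ht.1] at hs
    refine intervalIntegral.integral_congr fun r hr => ?_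
    rw [uIcc_of_le hs.1] at hr
    have hr' : r ∈ Icc 0 T := ⟨hr.1, hr.2.trans (hs.2.trans ht.2)⟩
    simp only [h r hr', ih r hr']

theorem waveTermDeriv_congr {c c' : ℝ → ℝ} {T : ℝ} (h : ∀ t ∈ Icc 0 T, c t = c' t) (α β : ℝ)
    (k : ℕ) : ∀ t ∈ Icc 0 T, waveTermDeriv c α β k t = waveTermDeriv c' α β k t := by
  rcases k with _ | k
  · intro t _; rfl
  · intro t ht
    refine intervalIntegral.integral_congr fun r hr => ?_
    rw [uIcc_of_le ht.1] at hr
    have hr' : r ∈ Icc 0 T := ⟨hr.1, hr.2.trans ht.2⟩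
    simp only [h r hr', waveTerm_congr h α β k r hr']

theorem waveSol_congr {c c' : ℝ → ℝ} {T : ℝ} (h : ∀ t ∈ Icc 0 T, c t = c' t) (α β l : ℝ) :
    ∀ t ∈ Icc 0 T, waveSol c α β l t = waveSol c' α β l t := fun t ht => by
  simp only [waveSol, waveTerm_congr h α β _ t ht]

theorem waveSolDeriv_congr {c c' : ℝ → ℝ} {T : ℝ} (h : ∀ t ∈ Icc 0 T, c t = c' t) (α β l : ℝ) :
    ∀ t ∈ Icc 0 T, waveSolDeriv c α β l t = waveSolDeriv c' α β l t := fun t ht => by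
  simp only [waveSolDeriv, waveTermDeriv_congr h α β _ t ht]

section Continuous

variable {c : ℝ → ℝ} {M : ℝ}

theorem continuous_waveTerm (hc : Continuous c) (α β : ℝ) (k : ℕ) :
    Continuous (waveTerm c α β k) := by
  induction k with
  | zero => unfold waveTerm; fun_prop
  | succ k ih =>
    exact intervalIntegral.continuous_primitive (fun a b => (intervalIntegral.continuous_primitive
      (fun a b => (hc.mul ih).intervalIntegrable a b) 0).intervalIntegrable a b) 0

theorem hasDerivAt_waveTermDeriv_succ (hc : Continuous c) (α β : ℝ) (k : ℕ) (t : ℝ) :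
    HasDerivAt (waveTermDeriv c α β (k + 1)) (c t * waveTerm c α β k t) t :=
  ((hc.mul (continuous_waveTerm hc α β k)).integral_hasStrictDerivAt 0 t).hasDerivAt

theorem hasDerivAt_waveTerm (hc : Continuous c) (α β : ℝ) (k : ℕ) (t : ℝ) :
    HasDerivAt (waveTerm c α β k) (waveTermDeriv c α β k t) t := by
  rcases k with _ | k
  · simpa [waveTerm, waveTermDeriv] using ((hasDerivAt_id t).const_mul β).const_add α
  · have : Continuous (waveTermDeriv c α β (k + 1)) :=
      continuous_iff_continuousAt.2 fun t => (hasDerivAt_waveTermDeriv_succ hc α β k t).continuousAt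
    exact (this.integral_hasStrictDerivAt 0 t).hasDerivAt

/-- Integrating a monomial raises the factorial by one. Negative times are reduced to positive ones
by reflection; they are needed because the series is differentiated on a ball around `0`. -/
theorem abs_integral_le_of_pow_bound {f : ℝ → ℝ} {A T : ℝ} {k : ℕ}
    (hf : ∀ s, |s| ≤ T → |f s| ≤ A * |s| ^ k / k.factorial) {t : ℝ} (ht : |t| ≤ T) :
    |∫ s in (0 : ℝ)..t, f s| ≤ A * |t| ^ (k + 1) / (k + 1).factorial := by
  have key : ∀ (g : ℝ → ℝ), (∀ s, |s| ≤ T → |g s| ≤ A * |s| ^ k / k.factorial) → ∀ u, 0 ≤ u → u ≤ T →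
      |∫ s in (0 : ℝ)..u, g s| ≤ A * |u| ^ (k + 1) / (k + 1).factorial := by
    intro g hg u hu huT
    have h1 : |∫ s in (0 : ℝ)..u, g s| ≤ ∫ s in (0 : ℝ)..u, A / k.factorial * s ^ k := by
      rw [← Real.norm_eq_abs]
      refine intervalIntegral.norm_integral_le_of_norm_le hu (ae_of_all _ fun s hs => ?_)
        (Continuous.intervalIntegrable (by fun_prop) _ _)
      have h2 := hg s (by rw [abs_of_pos hs.1]; exact hs.2.trans huT)
      rw [abs_of_pos hs.1] at h2
      rw [Real.norm_eq_abs]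
      exact h2.trans (le_of_eq (by ring))
    refine h1.trans (le_of_eq ?_)
    rw [intervalIntegral.integral_const_mul, integral_pow, abs_of_nonneg hu, Nat.factorial_succ]
    push_cast
    have : ((k : ℝ) + 1) ≠ 0 := by positivity
    have : (k.factorial : ℝ) ≠ 0 := by positivity
    field_simp
    ring
  rcases le_total 0 t with h | h
  · exact key f hf t h ((le_abs_self t).trans ht)
  · have h1 := key (fun s => f (-s)) (fun s hs => by simpa using hf (-s) (by simpa using hs)) (-t)
      (by linarith) ((neg_le_abs t).trans ht)
    rw [intervalIntegral.integral_comp_neg, neg_neg, neg_zero, intervalIntegral.integral_symm,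
      abs_neg, abs_neg] at h1
    exact h1

/-- Each new term is a double integral. One integration gains a factor in the factorial, the other
is bounded crudely by `T`; an exponential series remains, which is enough. The two bounds go
together because the induction passes through the derivative. -/
theorem abs_waveTerm_le (hM : 0 ≤ M) (hcM : ∀ t, |c t| ≤ M) (α β : ℝ) {T : ℝ} (hT : 0 ≤ T) (k : ℕ) :
    (∀ t, |t| ≤ T → |waveTerm c α β k t| ≤ (|α| + |β| * T) * (M * T) ^ k * |t| ^ k / k.factorial) ∧
    (∀ t, |t| ≤ T → |waveTermDeriv c α β (k + 1) t| ≤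
      M * ((|α| + |β| * T) * (M * T) ^ k) * |t| ^ (k + 1) / (k + 1).factorial) := by
  have step : ∀ k, (∀ t, |t| ≤ T → |waveTerm c α β k t| ≤
      (|α| + |β| * T) * (M * T) ^ k * |t| ^ k / k.factorial) →
      (∀ t, |t| ≤ T → |waveTermDeriv c α β (k + 1) t| ≤
      M * ((|α| + |β| * T) * (M * T) ^ k) * |t| ^ (k + 1) / (k + 1).factorial) := by
    intro k hk t ht
    refine abs_integral_le_of_pow_bound (fun s hs => ?_) ht
    rw [abs_mul]
    calc |c s| * |waveTerm c α β k s| ≤ M * _ :=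
          mul_le_mul (hcM s) (hk s hs) (abs_nonneg _) hM
      _ = _ := by ring
  induction k with
  | zero =>
    have h0 : ∀ t, |t| ≤ T → |waveTerm c α β 0 t| ≤
        (|α| + |β| * T) * (M * T) ^ 0 * |t| ^ 0 / (Nat.factorial 0) := by
      intro t ht
      simp only [waveTerm, pow_zero, mul_one, Nat.factorial_zero, Nat.cast_one, div_one]
      calc |α + β * t| ≤ |α| + |β| * |t| := (abs_add_le _ _).trans (by rw [abs_mul])
        _ ≤ _ := by gcongr
    exact ⟨h0, step 0 h0⟩
  | succ k ih =>
    have h0 : ∀ t, |t| ≤ T → |waveTerm c α β (k + 1) t| ≤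
        (|α| + |β| * T) * (M * T) ^ (k + 1) * |t| ^ (k + 1) / (k + 1).factorial := by
      intro t ht
      have h1 := intervalIntegral.norm_integral_le_of_norm_le_const (a := 0) (b := t)
        (f := waveTermDeriv c α β (k + 1))
        (C := M * ((|α| + |β| * T) * (M * T) ^ k) * |t| ^ (k + 1) / (k + 1).factorial) ?_
      · rw [sub_zero, Real.norm_eq_abs] at h1
        calc |waveTerm c α β (k + 1) t| ≤ _ := h1
          _ ≤ M * ((|α| + |β| * T) * (M * T) ^ k) * |t| ^ (k + 1) / (k + 1).factorial * T := by
            gcongr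
          _ = _ := by ring
      · intro s hs
        have hst : |s| ≤ |t| := by
          rcases le_total 0 t with h | h
          · rw [uIoc_of_le h] at hs; rw [abs_of_pos hs.1, abs_of_nonneg h]; exact hs.2
          · rw [uIoc_of_ge h] at hs
            rw [abs_of_nonpos hs.2, abs_of_nonpos h]; linarith [hs.1]
        rw [Real.norm_eq_abs]
        refine (ih.2 s (hst.trans ht)).trans ?_
        gcongr
    exact ⟨h0, step (k + 1) h0⟩

theorem summable_waveTerm_bound (Q a l : ℝ) :
    Summable fun k : ℕ => |l| ^ k * (Q * a ^ k / k.factorial) := by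
  have := (Real.summable_pow_div_factorial (|l| * a)).mul_left Q
  refine this.congr fun k => ?_
  rw [mul_pow]; ring

theorem abs_waveTerm_mul_le (hM : 0 ≤ M) (hcM : ∀ t, |c t| ≤ M) (α β : ℝ) {T : ℝ} (hT : 0 ≤ T)
    (k : ℕ) (l t : ℝ) (ht : |t| ≤ T) : ‖(-l) ^ k * waveTerm c α β k t‖ ≤
      |l| ^ k * ((|α| + |β| * T) * (M * T * T) ^ k / k.factorial) := by
  rw [Real.norm_eq_abs, abs_mul, abs_pow, abs_neg]
  refine mul_le_mul_of_nonneg_left (((abs_waveTerm_le hM hcM α β hT k).1 t ht).trans ?_) (by positivity)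
  rw [mul_pow (M * T) T, ← mul_assoc]
  gcongr

theorem abs_waveTermDeriv_succ_mul_le (hM : 0 ≤ M) (hcM : ∀ t, |c t| ≤ M) (α β : ℝ) {T : ℝ}
    (hT : 0 ≤ T) (k : ℕ) (l t : ℝ) (ht : |t| ≤ T) :
    ‖(-l) ^ (k + 1) * waveTermDeriv c α β (k + 1) t‖ ≤
      |l| ^ k * ((|l| * M * (|α| + |β| * T) * T) * (M * T * T) ^ k / k.factorial) := by
  rw [Real.norm_eq_abs, abs_mul, abs_pow, abs_neg]
  refine (mul_le_mul_of_nonneg_left ((abs_waveTerm_le hM hcM α β hT k).2 t ht)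
    (by positivity)).trans ?_
  have h1 : (k.factorial : ℝ) ≤ ((k + 1).factorial : ℝ) := by
    exact_mod_cast Nat.factorial_le (Nat.le_succ k)
  calc |l| ^ (k + 1) * (M * ((|α| + |β| * T) * (M * T) ^ k) * |t| ^ (k + 1) / (k + 1).factorial)
      ≤ |l| ^ (k + 1) * (M * ((|α| + |β| * T) * (M * T) ^ k) * T ^ (k + 1) / k.factorial) := by
        gcongr
    _ = _ := by rw [mul_pow (M * T) T]; ring

/-- Termwise differentiation with exponential majorants, on a ball that contains both `t` and the
base point `0`. -/
theorem hasDerivAt_waveSol_of_continuous (hc : Continuous c) (hM : 0 ≤ M) (hcM : ∀ t, |c t| ≤ M)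
    (α β l t : ℝ) : HasDerivAt (waveSol c α β l) (waveSolDeriv c α β l t) t ∧
      HasDerivAt (waveSolDeriv c α β l) (-(l * c t) * waveSol c α β l t) t := by
  set T := |t| + 1
  have hT : 0 ≤ T := by positivity
  have hball : ∀ s ∈ Metric.ball (0 : ℝ) T, |s| ≤ T := fun s hs => by
    rw [mem_ball_zero_iff, Real.norm_eq_abs] at hs; exact hs.le
  have ht : t ∈ Metric.ball (0 : ℝ) T := by
    rw [mem_ball_zero_iff, Real.norm_eq_abs]; exact lt_add_one _
  have h0 : (0 : ℝ) ∈ Metric.ball (0 : ℝ) T := Metric.mem_ball_self (by positivity)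
  have s1 := summable_waveTerm_bound (|α| + |β| * T) (M * T * T) l
  have s2 := summable_waveTerm_bound (|l| * M * (|α| + |β| * T) * T) (M * T * T) l
  have conv : IsPreconnected (Metric.ball (0 : ℝ) T) := (convex_ball _ _).isPreconnected
  -- The bound for the derivatives starts at index `k + 1`; the term of index `0` is the constant
  -- `β` and is put in by hand.
  have s3 : Summable (fun k : ℕ => if k = 0 then |β| else
      |l| ^ (k - 1) * ((|l| * M * (|α| + |β| * T) * T) * (M * T * T) ^ (k - 1) / (k - 1).factorial)) := by
    rw [← summable_nat_add_iff 1]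
    simpa using s2
  constructor
  · refine hasDerivAt_tsum_of_isPreconnected s3 Metric.isOpen_ball conv
      (g := fun k t => (-l) ^ k * waveTerm c α β k t)
      (g' := fun k t => (-l) ^ k * waveTermDeriv c α β k t)
      (fun k s _ => (hasDerivAt_waveTerm hc α β k s).const_mul _) (fun k s hs => ?_) h0 ?_ ht
    · rcases k with _ | k
      · simp [waveTermDeriv]
      · simpa using abs_waveTermDeriv_succ_mul_le hM hcM α β hT k l s (hball s hs)
    · exact s1.of_norm_bounded fun k => abs_waveTerm_mul_le hM hcM α β hT k l 0 (hball 0 h0)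
  -- The constant term drops out under differentiation, and the derivative of the term `k + 1` is
  -- `c` times the term `k`. This index shift produces the factor `-l`.
  · have e : waveSolDeriv c α β l = fun s => β + ∑' k, (-l) ^ (k + 1) * waveTermDeriv c α β (k + 1) s := by
      ext s
      have hs : Summable fun k : ℕ => (-l) ^ k * waveTermDeriv c α β k s := by
        rw [← summable_nat_add_iff 1]
        exact (summable_waveTerm_bound _ _ l).of_norm_bounded fun k =>
          abs_waveTermDeriv_succ_mul_le hM hcM α β (abs_nonneg s) k l s le_rfl
      rw [waveSolDeriv, hs.tsum_eq_zero_add]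
      simp [waveTermDeriv]
    rw [e]
    have h1 := hasDerivAt_tsum_of_isPreconnected (s1.mul_left (|l| * M)) Metric.isOpen_ball conv
      (g := fun k t => (-l) ^ (k + 1) * waveTermDeriv c α β (k + 1) t)
      (g' := fun k t => (-l) ^ (k + 1) * (c t * waveTerm c α β k t))
      (fun k s _ => (hasDerivAt_waveTermDeriv_succ hc α β k s).const_mul _) (fun k s hs => ?_) h0
      (by simp [waveTermDeriv_zero_right]) ht
    · have h2 : -(l * c t) * waveSol c α β l t =
          ∑' k, (-l) ^ (k + 1) * (c t * waveTerm c α β k t) := by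
        rw [waveSol, ← tsum_mul_left]
        congr 1; ext k; ring
      rw [h2]
      exact h1.const_add β
    · have h2 := abs_waveTerm_mul_le hM hcM α β hT k l s (hball s hs)
      calc ‖(-l) ^ (k + 1) * (c s * waveTerm c α β k s)‖
          = |l| * |c s| * ‖(-l) ^ k * waveTerm c α β k s‖ := by
            rw [pow_succ]; simp only [norm_mul, Real.norm_eq_abs, abs_neg]; ring
        _ ≤ |l| * M * _ := by gcongr; exact hcM s

end Continuous

/-- Freezing the coefficient at its end values makes it bounded and continuous on the line; the
series on `[0, T]` sees only the values there. -/
theorem exists_continuous_extension {c : ℝ → ℝ} {T : ℝ} (hT : 0 ≤ T) (hc : ContinuousOn c (Icc 0 T)) :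
    ∃ c' : ℝ → ℝ, Continuous c' ∧ (∀ t ∈ Icc 0 T, c t = c' t) ∧ ∃ M, 0 ≤ M ∧ ∀ t, |c' t| ≤ M := by
  refine ⟨fun t => c (projIcc 0 T hT t), (continuousOn_iff_continuous_domRestrict.1 hc).comp
    continuous_projIcc, fun t ht => by simp only [projIcc_of_mem hT ht], ?_⟩
  obtain ⟨M, hM⟩ := isCompact_Icc.exists_bound_of_continuousOn hc
  refine ⟨M, (norm_nonneg _).trans (hM 0 ⟨le_rfl, hT⟩), fun t => ?_⟩
  exact hM _ (projIcc 0 T hT t).2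

theorem hasDerivWithinAt_waveSol {c : ℝ → ℝ} {T : ℝ} (hc : ContinuousOn c (Icc 0 T)) (α β l : ℝ)
    {t : ℝ} (ht : t ∈ Icc 0 T) :
    HasDerivWithinAt (waveSol c α β l) (waveSolDeriv c α β l t) (Icc 0 T) t := by
  obtain ⟨c', hc', he, M, hM, hcM⟩ := exists_continuous_extension (ht.1.trans ht.2) hc
  rw [waveSolDeriv_congr he α β l t ht]
  exact (hasDerivAt_waveSol_of_continuous hc' hM hcM α β l t).1.hasDerivWithinAt.congr
    (waveSol_congr he α β l) (waveSol_congr he α β l t ht)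

theorem hasDerivWithinAt_waveSolDeriv {c : ℝ → ℝ} {T : ℝ} (hc : ContinuousOn c (Icc 0 T))
    (α β l : ℝ) {t : ℝ} (ht : t ∈ Icc 0 T) : HasDerivWithinAt (waveSolDeriv c α β l)
      (-(l * c t) * waveSol c α β l t) (Icc 0 T) t := by
  obtain ⟨c', hc', he, M, hM, hcM⟩ := exists_continuous_extension (ht.1.trans ht.2) hc
  rw [he t ht, waveSol_congr he α β l t ht]
  exact (hasDerivAt_waveSol_of_continuous hc' hM hcM α β l t).2.hasDerivWithinAt.congr
    (waveSolDeriv_congr he α β l) (waveSolDeriv_congr he α β l t ht)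

/-- The benefit of the power series: its partial sums are polynomials in `l`, so the solution
depends measurably on the frequency. -/
theorem measurable_tsum_pow {a : ℕ → ℝ} (ha : ∀ l : ℝ, Summable fun k => (-l) ^ k * a k) :
    Measurable fun l : ℝ => ∑' k, (-l) ^ k * a k := by
  refine measurable_of_tendsto_metrizable (f := fun N l => ∑ k ∈ Finset.range N, (-l) ^ k * a k)
    (fun N => by fun_prop) ?_
  rw [tendsto_pi_nhds]
  exact fun l => (ha l).hasSum.tendsto_sum_nat

theorem measurable_waveSol {c : ℝ → ℝ} {T : ℝ} (hc : ContinuousOn c (Icc 0 T)) (α β : ℝ)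
    {t : ℝ} (ht : t ∈ Icc 0 T) : Measurable fun l => waveSol c α β l t := by
  obtain ⟨c', hc', he, M, hM, hcM⟩ := exists_continuous_extension (ht.1.trans ht.2) hc
  simp_rw [waveSol_congr he α β _ t ht]
  exact measurable_tsum_pow fun l => (summable_waveTerm_bound _ _ l).of_norm_bounded fun k =>
    abs_waveTerm_mul_le hM hcM α β (abs_nonneg t) k l t le_rfl

theorem measurable_waveSolDeriv {c : ℝ → ℝ} {T : ℝ} (hc : ContinuousOn c (Icc 0 T)) (α β : ℝ)
    {t : ℝ} (ht : t ∈ Icc 0 T) : Measurable fun l => waveSolDeriv c α β l t := by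
  obtain ⟨c', hc', he, M, hM, hcM⟩ := exists_continuous_extension (ht.1.trans ht.2) hc
  simp_rw [waveSolDeriv_congr he α β _ t ht]
  refine measurable_tsum_pow fun l => ?_
  rw [← summable_nat_add_iff 1]
  exact (summable_waveTerm_bound _ _ l).of_norm_bounded fun k =>
    abs_waveTermDeriv_succ_mul_le hM hcM α β (abs_nonneg t) k l t le_rfl

/-! ### Energy estimates at one frequency. -/

theorem hasDerivWithinAt_norm_sq_Ioi {y : ℝ → ℂ} {y' : ℂ} {a b x : ℝ} (hx : x ∈ Ico a b)
    (hy : HasDerivWithinAt y y' (Icc a b) x) :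
    HasDerivWithinAt (fun t => ‖y t‖ ^ 2) (2 * inner ℝ (y x) y') (Ioi x) x :=
  (hy.mono_of_mem_nhdsWithin (Icc_mem_nhdsGT_of_mem hx)).norm_sq

/-- Energy inequality for `y'' = -l c y + h` with a coefficient `c` whose slopes are at most `L`. -/
theorem energy_le_gronwallBound {y z h : ℝ → ℂ} {c : ℝ → ℝ} {a b l L ν κ D : ℝ} (hl : 0 ≤ l)
    (hL0 : 0 ≤ L) (hν : 0 < ν) (hc : ContinuousOn c (Icc a b))
    (hL : ∀ s t, a ≤ s → s ≤ t → t ≤ b → c t - c s ≤ L * (t - s))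
    (hcν : ∀ t ∈ Icc a b, ν ≤ c t)
    (hy : ∀ t ∈ Icc a b, HasDerivWithinAt y (z t) (Icc a b) t)
    (hz : ∀ t ∈ Icc a b, HasDerivWithinAt z (((-(l * c t) : ℝ) : ℂ) * y t + h t) (Icc a b) t)
    (hκ : 0 ≤ κ) (hh : ∀ t ∈ Icc a b, 2 * inner ℝ (z t) (h t) ≤ κ * ‖z t‖ ^ 2 + D)
    {t : ℝ} (ht : t ∈ Icc a b) :
    c t * (l * ‖y t‖ ^ 2) + ‖z t‖ ^ 2 ≤
      gronwallBound (c a * (l * ‖y a‖ ^ 2) + ‖z a‖ ^ 2) (L / ν + κ) D (t - a) := by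
  have hyc : ContinuousOn y (Icc a b) := fun t ht => (hy t ht).continuousWithinAt
  have hzc : ContinuousOn z (Icc a b) := fun t ht => (hz t ht).continuousWithinAt
  refine le_gronwallBound_of_liminf_deriv_right_le
    (f := fun t => c t * (l * ‖y t‖ ^ 2) + ‖z t‖ ^ 2)
    (f' := fun t => (L / ν + κ) * (c t * (l * ‖y t‖ ^ 2) + ‖z t‖ ^ 2) + D)
    (by fun_prop) (fun x hx r hr => ?_) le_rfl (fun x _ => le_rfl) t ht
  have hxI : x ∈ Icc a b := ⟨hx.1, hx.2.le⟩
  -- The coefficient need not be differentiable. Replacing `c t` by its upper bound `c x + L * (t -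
  -- x)` gives a function that is differentiable at `x` from the right, equals the energy at `x` and
  -- dominates it afterwards; this bounds the right slopes of the energy. The cross terms in its
  -- derivative cancel.
  set g : ℝ → ℝ := fun t => L * (t - x) * (l * ‖y t‖ ^ 2) + c x * (l * ‖y t‖ ^ 2) + ‖z t‖ ^ 2
    with hg_def
  have hg : HasDerivWithinAt g (L * (l * ‖y x‖ ^ 2) + 2 * inner ℝ (z x) (h x)) (Ioi x) x := by
    have h1 := hasDerivWithinAt_norm_sq_Ioi hx (hy x hxI)
    have h2 := hasDerivWithinAt_norm_sq_Ioi hx (hz x hxI)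
    have h3 : HasDerivWithinAt (fun t => L * (t - x)) L (Ioi x) x := by
      simpa using ((hasDerivWithinAt_id x (Ioi x)).sub_const x).const_mul L
    have h4 := ((h3.mul (h1.const_mul l)).add ((h1.const_mul l).const_mul (c x))).add h2
    refine h4.congr_deriv ?_
    rw [inner_add_right, ← Complex.real_smul, inner_smul_right, real_inner_comm (z x) (y x)]
    ring
  have hlt : L * (l * ‖y x‖ ^ 2) + 2 * inner ℝ (z x) (h x) < r := by
    refine lt_of_le_of_lt ?_ hr
    have h1 := hh x hxI
    have h2 := hcν x hxI
    have h3 : L * (l * ‖y x‖ ^ 2) ≤ L / ν * (c x * (l * ‖y x‖ ^ 2)) := by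
      rw [div_mul_eq_mul_div, le_div_iff₀ hν]
      have : 0 ≤ L * (l * ‖y x‖ ^ 2) := by positivity
      nlinarith
    have h4 : 0 ≤ κ * (c x * (l * ‖y x‖ ^ 2)) := by
      have := hν.le.trans h2; positivity
    have h5 : 0 ≤ L / ν * ‖z x‖ ^ 2 := by positivity
    nlinarith
  have hev : ∀ᶠ u in 𝓝[>] x, slope g x u < r :=
    ((hasDerivWithinAt_iff_tendsto_slope' (by simp)).1 hg).eventually (gt_mem_nhds hlt)
  refine (Eventually.frequently ?_)
  filter_upwards [hev, Ioc_mem_nhdsGT hx.2] with u hu hub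
  refine lt_of_le_of_lt ?_ hu
  have hpos : 0 < u - x := sub_pos.2 hub.1
  rw [slope_def_field, inv_mul_eq_div]
  refine div_le_div_of_nonneg_right ?_ hpos.le
  have h1 := hL x u hx.1 hub.1.le hub.2
  have h2 : 0 ≤ l * ‖y u‖ ^ 2 := by positivity
  have h3 := mul_le_mul_of_nonneg_right h1 h2
  simp only [hg_def, sub_self, mul_zero, zero_mul, zero_add]
  nlinarith

theorem energy_le_mul_exp {y z : ℝ → ℂ} {c : ℝ → ℝ} {a b l L ν : ℝ} (hl : 0 ≤ l)
    (hL0 : 0 ≤ L) (hν : 0 < ν) (hc : ContinuousOn c (Icc a b))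
    (hL : ∀ s t, a ≤ s → s ≤ t → t ≤ b → c t - c s ≤ L * (t - s))
    (hcν : ∀ t ∈ Icc a b, ν ≤ c t)
    (hy : ∀ t ∈ Icc a b, HasDerivWithinAt y (z t) (Icc a b) t)
    (hz : ∀ t ∈ Icc a b, HasDerivWithinAt z (((-(l * c t) : ℝ) : ℂ) * y t) (Icc a b) t)
    {t : ℝ} (ht : t ∈ Icc a b) :
    c t * (l * ‖y t‖ ^ 2) + ‖z t‖ ^ 2 ≤
      (c a * (l * ‖y a‖ ^ 2) + ‖z a‖ ^ 2) * Real.exp (L / ν * (t - a)) := by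
  have := energy_le_gronwallBound (h := fun _ => 0) (κ := 0) (D := 0) hl hL0 hν hc hL hcν hy
    (fun t ht => by simpa using hz t ht) le_rfl (by simp) ht
  rwa [gronwallBound_ε0, add_zero] at this

theorem gronwallBound_zero_le {K D x : ℝ} (hK : 0 < K) (hD : 0 ≤ D) (hx : 0 ≤ x) (hKx : K * x ≤ 1) :
    gronwallBound 0 K D x ≤ 3 * D * x := by
  rw [gronwallBound_of_K_ne_0 hK.ne']
  dsimp only
  rw [zero_mul, zero_add, div_mul_eq_mul_div, div_le_iff₀ hK]
  have h0 : 0 ≤ K * x := by positivity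
  have h1 := Real.abs_exp_sub_one_le (x := K * x) (by rw [abs_of_nonneg h0]; exact hKx)
  rw [abs_of_nonneg h0] at h1
  have h2 := (le_abs_self _).trans h1
  nlinarith [mul_nonneg hD h0]

/-- The difference of two solutions with the same data and coefficients at distance at most `δ`. -/
theorem energy_sub_le {y₁ z₁ y₂ z₂ : ℝ → ℂ} {c₁ c₂ : ℝ → ℝ} {a b l L ν δ Y : ℝ} (hl : 0 ≤ l)
    (hL0 : 0 ≤ L) (hν : 0 < ν) (hc : ContinuousOn c₁ (Icc a b))
    (hL : ∀ s t, a ≤ s → s ≤ t → t ≤ b → c₁ t - c₁ s ≤ L * (t - s))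
    (hcν : ∀ t ∈ Icc a b, ν ≤ c₁ t)
    (hy₁ : ∀ t ∈ Icc a b, HasDerivWithinAt y₁ (z₁ t) (Icc a b) t)
    (hz₁ : ∀ t ∈ Icc a b, HasDerivWithinAt z₁ (((-(l * c₁ t) : ℝ) : ℂ) * y₁ t) (Icc a b) t)
    (hy₂ : ∀ t ∈ Icc a b, HasDerivWithinAt y₂ (z₂ t) (Icc a b) t)
    (hz₂ : ∀ t ∈ Icc a b, HasDerivWithinAt z₂ (((-(l * c₂ t) : ℝ) : ℂ) * y₂ t) (Icc a b) t)
    (hya : y₁ a = y₂ a) (hza : z₁ a = z₂ a) (hδ : ∀ t ∈ Icc a b, |c₁ t - c₂ t| ≤ δ)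
    (hY : ∀ t ∈ Icc a b, l * ‖y₂ t‖ ^ 2 ≤ Y) (hab : (L / ν + 1) * (b - a) ≤ 1)
    {t : ℝ} (ht : t ∈ Icc a b) :
    ν * (l * ‖y₁ t - y₂ t‖ ^ 2) ≤ 3 * (l * δ ^ 2 * Y) * (b - a) := by
  have hY0 : 0 ≤ Y := le_trans (by positivity) (hY t ht)
  have hK : 0 < L / ν + 1 := by positivity
  have hta : 0 ≤ t - a := sub_nonneg.2 ht.1
  have htb : t - a ≤ b - a := by linarith [ht.2]
  -- The difference solves the equation with speed `c₁` and the forcing `-l (c₁ - c₂) y₂`. Young's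
  -- inequality for the forcing gives `κ = 1`, and `D` bounds the square of the forcing.
  have h1 := energy_le_gronwallBound (y := fun t => y₁ t - y₂ t) (z := fun t => z₁ t - z₂ t)
    (h := fun t => ((-(l * (c₁ t - c₂ t)) : ℝ) : ℂ) * y₂ t) (κ := 1) (D := l * δ ^ 2 * Y) hl hL0 hν hc
    hL hcν (fun t ht => (hy₁ t ht).sub (hy₂ t ht))
    (fun t ht => by
      refine ((hz₁ t ht).sub (hz₂ t ht)).congr_deriv ?_
      push_cast; ring) zero_le_one (fun s hs => ?_) ht
  · simp only [hya, hza, sub_self, norm_zero] at h1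
    norm_num at h1
    have h2 := gronwallBound_zero_le (D := l * δ ^ 2 * Y) hK (by positivity) hta
      ((mul_le_mul_of_nonneg_left htb hK.le).trans hab)
    have h3 : ν * (l * ‖y₁ t - y₂ t‖ ^ 2) ≤ c₁ t * (l * ‖y₁ t - y₂ t‖ ^ 2) := by
      have := hcν t ht; gcongr
    have h4 : 3 * (l * δ ^ 2 * Y) * (t - a) ≤ 3 * (l * δ ^ 2 * Y) * (b - a) := by gcongr
    nlinarith [sq_nonneg ‖z₁ t - z₂ t‖]
  · have h2 := real_inner_le_norm (z₁ s - z₂ s) (((-(l * (c₁ s - c₂ s)) : ℝ) : ℂ) * y₂ s)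
    have h3 : ‖((-(l * (c₁ s - c₂ s)) : ℝ) : ℂ) * y₂ s‖ ^ 2 ≤ l * δ ^ 2 * Y := by
      rw [norm_mul, Complex.norm_real, Real.norm_eq_abs, abs_neg, abs_mul, abs_of_nonneg hl]
      have h4 : |c₁ s - c₂ s| ^ 2 ≤ δ ^ 2 := by
        have := hδ s hs; gcongr
      calc (l * |c₁ s - c₂ s| * ‖y₂ s‖) ^ 2 = l * |c₁ s - c₂ s| ^ 2 * (l * ‖y₂ s‖ ^ 2) := by ring
        _ ≤ l * δ ^ 2 * Y := by have := hY s hs; gcongr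
    nlinarith [sq_nonneg (‖z₁ s - z₂ s‖ - ‖((-(l * (c₁ s - c₂ s)) : ℝ) : ℂ) * y₂ s‖)]

/-! ### All frequencies together, for a given wave speed. -/

/-- The increments of `c` on `[a, b]` are at most `L` times those of the variable. -/
def SlopeLE (L : ℝ) (c : ℝ → ℝ) (a b : ℝ) : Prop :=
  ∀ s t, a ≤ s → s ≤ t → t ≤ b → c t - c s ≤ L * (t - s)

theorem SlopeLE.mono {L : ℝ} {c : ℝ → ℝ} {a b a' b' : ℝ} (h : SlopeLE L c a b) (ha : a ≤ a')
    (hb : b' ≤ b) : SlopeLE L c a' b' :=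
  fun s t hs hst ht => h s t (ha.trans hs) hst (ht.trans hb)

/-- Admissible wave speeds on `[0, T]`. -/
structure IsCoeff (ν : ℝ) (c : ℝ → ℝ) (T : ℝ) : Prop where
  pos : 0 < ν
  continuousOn : ContinuousOn c (Icc 0 T)
  lower : ∀ t ∈ Icc 0 T, ν ≤ c t
  slope : ∃ L, 0 ≤ L ∧ SlopeLE L c 0 T

theorem IsCoeff.mono {ν : ℝ} {c : ℝ → ℝ} {T T' : ℝ} (h : IsCoeff ν c T) (hT : T' ≤ T) :
    IsCoeff ν c T' :=
  ⟨h.pos, h.continuousOn.mono (Icc_subset_Icc_right hT),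
    fun t ht => h.lower t ⟨ht.1, ht.2.trans hT⟩,
    let ⟨L, h0, hL⟩ := h.slope; ⟨L, h0, hL.mono le_rfl hT⟩⟩

section Wave

variable {Ω : Type*}

/-- The solution of `y'' = -c(t) m² y` with data `g₀`, `g₁`. -/
def waveY (m : Ω → ℝ) (g₀ g₁ : Ω → ℂ) (c : ℝ → ℝ) (t : ℝ) (ξ : Ω) : ℂ :=
  (waveSol c 1 0 (m ξ ^ 2) t : ℂ) * g₀ ξ + (waveSol c 0 1 (m ξ ^ 2) t : ℂ) * g₁ ξ

/-- The time derivative of `waveY`. -/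
def waveZ (m : Ω → ℝ) (g₀ g₁ : Ω → ℂ) (c : ℝ → ℝ) (t : ℝ) (ξ : Ω) : ℂ :=
  (waveSolDeriv c 1 0 (m ξ ^ 2) t : ℂ) * g₀ ξ + (waveSolDeriv c 0 1 (m ξ ^ 2) t : ℂ) * g₁ ξ

/-- The energy density. -/
def waveE (m : Ω → ℝ) (g₀ g₁ : Ω → ℂ) (c : ℝ → ℝ) (t : ℝ) (ξ : Ω) : ℝ :=
  c t * (m ξ ^ 2 * ‖waveY m g₀ g₁ c t ξ‖ ^ 2) + ‖waveZ m g₀ g₁ c t ξ‖ ^ 2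

/-- The size of the data. -/
def dataSize (m : Ω → ℝ) (g₀ g₁ : Ω → ℂ) (ξ : Ω) : ℝ := m ξ ^ 2 * ‖g₀ ξ‖ ^ 2 + ‖g₁ ξ‖ ^ 2

theorem dataSize_nonneg (m : Ω → ℝ) (g₀ g₁ : Ω → ℂ) (ξ : Ω) : 0 ≤ dataSize m g₀ g₁ ξ := by
  unfold dataSize; positivity

variable {m : Ω → ℝ} {g₀ g₁ : Ω → ℂ} {c : ℝ → ℝ} {T ν : ℝ}

theorem waveY_zero (m : Ω → ℝ) (g₀ g₁ : Ω → ℂ) (c : ℝ → ℝ) (ξ : Ω) :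
    waveY m g₀ g₁ c 0 ξ = g₀ ξ := by
  simp [waveY, waveSol_zero]

theorem waveZ_zero (m : Ω → ℝ) (g₀ g₁ : Ω → ℂ) (c : ℝ → ℝ) (ξ : Ω) :
    waveZ m g₀ g₁ c 0 ξ = g₁ ξ := by
  simp [waveZ, waveSolDeriv_zero]

theorem waveY_congr {c' : ℝ → ℝ} (h : ∀ t ∈ Icc 0 T, c t = c' t) {t : ℝ} (ht : t ∈ Icc 0 T) (ξ : Ω) :
    waveY m g₀ g₁ c t ξ = waveY m g₀ g₁ c' t ξ := by
  simp only [waveY, waveSol_congr h _ _ _ t ht]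

theorem waveZ_congr {c' : ℝ → ℝ} (h : ∀ t ∈ Icc 0 T, c t = c' t) {t : ℝ} (ht : t ∈ Icc 0 T) (ξ : Ω) :
    waveZ m g₀ g₁ c t ξ = waveZ m g₀ g₁ c' t ξ := by
  simp only [waveZ, waveSolDeriv_congr h _ _ _ t ht]

theorem waveE_congr {c' : ℝ → ℝ} (h : ∀ t ∈ Icc 0 T, c t = c' t) {t : ℝ} (ht : t ∈ Icc 0 T) (ξ : Ω) :
    waveE m g₀ g₁ c t ξ = waveE m g₀ g₁ c' t ξ := by
  simp only [waveE, waveY_congr h ht, waveZ_congr h ht, h t ht]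

theorem hasDerivWithinAt_waveY (hc : IsCoeff ν c T) (ξ : Ω) {t : ℝ} (ht : t ∈ Icc 0 T) :
    HasDerivWithinAt (fun t => waveY m g₀ g₁ c t ξ) (waveZ m g₀ g₁ c t ξ) (Icc 0 T) t :=
  ((hasDerivWithinAt_waveSol hc.continuousOn 1 0 _ ht).ofReal_comp.mul_const _).add
    ((hasDerivWithinAt_waveSol hc.continuousOn 0 1 _ ht).ofReal_comp.mul_const _)

theorem hasDerivWithinAt_waveZ (hc : IsCoeff ν c T) (ξ : Ω) {t : ℝ} (ht : t ∈ Icc 0 T) :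
    HasDerivWithinAt (fun t => waveZ m g₀ g₁ c t ξ)
      (((-(m ξ ^ 2 * c t) : ℝ) : ℂ) * waveY m g₀ g₁ c t ξ) (Icc 0 T) t := by
  refine (((hasDerivWithinAt_waveSolDeriv hc.continuousOn 1 0 _ ht).ofReal_comp.mul_const _).add
    ((hasDerivWithinAt_waveSolDeriv hc.continuousOn 0 1 _ ht).ofReal_comp.mul_const _)).congr_deriv ?_
  simp only [waveY]; push_cast; ring

theorem waveE_nonneg (hc : IsCoeff ν c T) {t : ℝ} (ht : t ∈ Icc 0 T) (ξ : Ω) :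
    0 ≤ waveE m g₀ g₁ c t ξ := by
  have := hc.pos.le.trans (hc.lower t ht)
  unfold waveE; positivity

theorem mul_norm_waveY_sq_le (hc : IsCoeff ν c T) {t : ℝ} (ht : t ∈ Icc 0 T) (ξ : Ω) :
    ν * (m ξ ^ 2 * ‖waveY m g₀ g₁ c t ξ‖ ^ 2) + ‖waveZ m g₀ g₁ c t ξ‖ ^ 2 ≤
      waveE m g₀ g₁ c t ξ := by
  have := hc.lower t ht
  unfold waveE; gcongr

theorem waveE_le_mul_exp (hc : IsCoeff ν c T) {a L : ℝ} (ha : 0 ≤ a) (hL0 : 0 ≤ L)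
    (hL : SlopeLE L c a T) {t : ℝ} (hat : a ≤ t) (htT : t ≤ T) (ξ : Ω) :
    waveE m g₀ g₁ c t ξ ≤ waveE m g₀ g₁ c a ξ * Real.exp (L / ν * (t - a)) := by
  have hsub : Icc a T ⊆ Icc 0 T := Icc_subset_Icc_left ha
  exact energy_le_mul_exp (sq_nonneg (m ξ)) hL0 hc.pos (hc.continuousOn.mono hsub) hL
    (fun t ht => hc.lower t (hsub ht))
    (fun t ht => (hasDerivWithinAt_waveY hc ξ (hsub ht)).mono hsub)
    (fun t ht => (hasDerivWithinAt_waveZ hc ξ (hsub ht)).mono hsub) ⟨hat, htT⟩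

/-- The growth factor `exp (L T / ν)` does not see the frequency. A constant independent of `ξ` is
what lets any weight pass from the data to later times. -/
theorem exists_waveE_le (hc : IsCoeff ν c T) (m : Ω → ℝ) (g₀ g₁ : Ω → ℂ) :
    ∃ C, 0 ≤ C ∧ ∀ t ∈ Icc 0 T, ∀ ξ, waveE m g₀ g₁ c t ξ ≤ C * dataSize m g₀ g₁ ξ := by
  obtain ⟨L, hL0, hL⟩ := hc.slope
  refine ⟨max (c 0) 1 * Real.exp (L / ν * T), by positivity, fun t ht ξ => ?_⟩
  have h1 := waveE_le_mul_exp (m := m) (g₀ := g₀) (g₁ := g₁) hc le_rfl hL0 hL ht.1 ht.2 ξ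
  have h2 : waveE m g₀ g₁ c 0 ξ ≤ max (c 0) 1 * dataSize m g₀ g₁ ξ := by
    rw [waveE, waveY_zero, waveZ_zero, dataSize, mul_add]
    refine add_le_add (mul_le_mul_of_nonneg_right (le_max_left _ _) (by positivity)) ?_
    exact le_mul_of_one_le_left (by positivity) (le_max_right _ _)
  have h3 : Real.exp (L / ν * (t - 0)) ≤ Real.exp (L / ν * T) := by
    have := div_nonneg hL0 hc.pos.le
    rw [sub_zero]
    gcongr
    exact ht.2
  have h4 := dataSize_nonneg m g₀ g₁ ξ
  calc waveE m g₀ g₁ c t ξ ≤ _ := h1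
    _ ≤ (max (c 0) 1 * dataSize m g₀ g₁ ξ) * Real.exp (L / ν * T) := by gcongr
    _ = _ := by ring

theorem exists_norm_sq_le (hc : IsCoeff ν c T) (m : Ω → ℝ) (g₀ g₁ : Ω → ℂ) :
    ∃ C, 0 ≤ C ∧ ∀ t ∈ Icc 0 T, ∀ ξ,
      m ξ ^ 2 * ‖waveY m g₀ g₁ c t ξ‖ ^ 2 ≤ C * dataSize m g₀ g₁ ξ ∧
      ‖waveZ m g₀ g₁ c t ξ‖ ^ 2 ≤ C * dataSize m g₀ g₁ ξ := by
  obtain ⟨C, hC0, hC⟩ := exists_waveE_le hc m g₀ g₁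
  have hν := hc.pos
  refine ⟨max (C / ν) C, le_max_of_le_right hC0, fun t ht ξ => ?_⟩
  have h1 := (mul_norm_waveY_sq_le hc ht ξ).trans (hC t ht ξ)
  have h0 := dataSize_nonneg m g₀ g₁ ξ
  constructor
  · refine le_trans ?_ (mul_le_mul_of_nonneg_right (le_max_left _ _) h0)
    rw [div_mul_eq_mul_div, le_div_iff₀ hν]
    nlinarith [sq_nonneg ‖waveZ m g₀ g₁ c t ξ‖]
  · refine le_trans ?_ (mul_le_mul_of_nonneg_right (le_max_right _ _) h0)
    have : 0 ≤ ν * (m ξ ^ 2 * ‖waveY m g₀ g₁ c t ξ‖ ^ 2) := by positivity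
    linarith

/-- The derivative of `m² |y|²` is at most `m · 2 m |y| |z|` in size, and `2 √ν m |y| |z|` is at
most the energy density. The factor `m` left over is the one that turns this density into the energy
of order 3/2. -/
theorem abs_sub_mul_norm_waveY_sq_le (hc : IsCoeff ν c T) {a L : ℝ} (ha : 0 ≤ a) (hL0 : 0 ≤ L)
    (hL : SlopeLE L c a T) {s t : ℝ} (has : a ≤ s) (hst : s ≤ t) (htT : t ≤ T) {ξ : Ω}
    (hm : 0 ≤ m ξ) :
    |m ξ ^ 2 * ‖waveY m g₀ g₁ c t ξ‖ ^ 2 - m ξ ^ 2 * ‖waveY m g₀ g₁ c s ξ‖ ^ 2| ≤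
      Real.exp (L / ν * (T - a)) / √ν * (m ξ * waveE m g₀ g₁ c a ξ) * (t - s) := by
  have hν := hc.pos
  have hsq : 0 < √ν := Real.sqrt_pos.2 hν
  have hsub : Icc s t ⊆ Icc 0 T := Icc_subset_Icc (ha.trans has) htT
  have ha' : a ∈ Icc 0 T := ⟨ha, has.trans (hst.trans htT)⟩
  refine norm_image_sub_le_of_norm_deriv_le_segment' (f := fun t => m ξ ^ 2 * ‖waveY m g₀ g₁ c t ξ‖ ^ 2)
    (f' := fun t => m ξ ^ 2 * (2 * inner ℝ (waveY m g₀ g₁ c t ξ) (waveZ m g₀ g₁ c t ξ)))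
    (fun x hx => ((hasDerivWithinAt_waveY hc ξ (hsub hx)).mono hsub).norm_sq.const_mul _)
    (fun x hx => ?_) t ⟨hst, le_rfl⟩
  have hxI : x ∈ Icc 0 T := hsub ⟨hx.1, hx.2.le⟩
  have h1 := abs_real_inner_le_norm (waveY m g₀ g₁ c x ξ) (waveZ m g₀ g₁ c x ξ)
  have h2 := mul_norm_waveY_sq_le (m := m) (g₀ := g₀) (g₁ := g₁) hc hxI ξ
  have h3 := waveE_le_mul_exp (m := m) (g₀ := g₀) (g₁ := g₁) hc ha hL0 hL (has.trans hx.1) hxI.2 ξ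
  have h4 : Real.exp (L / ν * (x - a)) ≤ Real.exp (L / ν * (T - a)) := by
    have := div_nonneg hL0 hν.le
    gcongr
    exact hxI.2
  have h5 : waveE m g₀ g₁ c x ξ ≤ waveE m g₀ g₁ c a ξ * Real.exp (L / ν * (T - a)) :=
    h3.trans (mul_le_mul_of_nonneg_left h4 (waveE_nonneg hc ha' ξ))
  set Y := ‖waveY m g₀ g₁ c x ξ‖
  set Z := ‖waveZ m g₀ g₁ c x ξ‖
  have h6 : √ν * (2 * (m ξ * Y * Z)) ≤ waveE m g₀ g₁ c x ξ := by
    refine le_trans ?_ h2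
    have h7 : ν * (m ξ ^ 2 * Y ^ 2) = (√ν * (m ξ * Y)) ^ 2 := by
      rw [mul_pow, Real.sq_sqrt hν.le, mul_pow]
    rw [h7]
    nlinarith [sq_nonneg (√ν * (m ξ * Y) - Z)]
  rw [Real.norm_eq_abs, abs_mul, abs_mul, abs_of_nonneg (sq_nonneg (m ξ)), abs_two]
  calc m ξ ^ 2 * (2 * |inner ℝ (waveY m g₀ g₁ c x ξ) (waveZ m g₀ g₁ c x ξ)|)
      ≤ m ξ ^ 2 * (2 * (Y * Z)) := by gcongr
    _ = m ξ * ((√ν * (2 * (m ξ * Y * Z))) / √ν) := by field_simp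
    _ ≤ m ξ * ((waveE m g₀ g₁ c a ξ * Real.exp (L / ν * (T - a))) / √ν) :=
        mul_le_mul_of_nonneg_left (div_le_div_of_nonneg_right (h6.trans h5) hsq.le) hm
    _ = _ := by ring

variable [MeasurableSpace Ω] {μ : Measure Ω}

/-- Data of finite Hamiltonian and finite energy of order `3/2`, on the Fourier side. -/
structure IsWaveData (μ : Measure Ω) (m : Ω → ℝ) (g₀ g₁ : Ω → ℂ) : Prop where
  measurable : Measurable m
  nonneg : ∀ ξ, 0 ≤ m ξ
  meas₀ : AEStronglyMeasurable g₀ μ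
  meas₁ : AEStronglyMeasurable g₁ μ
  int : Integrable (dataSize m g₀ g₁) μ
  int_mul : Integrable (fun ξ => m ξ * dataSize m g₀ g₁ ξ) μ

/-- The squared norm of the gradient. -/
def waveGrad (μ : Measure Ω) (m : Ω → ℝ) (g₀ g₁ : Ω → ℂ) (c : ℝ → ℝ) (t : ℝ) : ℝ :=
  ∫ ξ, m ξ ^ 2 * ‖waveY m g₀ g₁ c t ξ‖ ^ 2 ∂μ

/-- The energy of order `3/2`. -/
def waveEnergy (μ : Measure Ω) (m : Ω → ℝ) (g₀ g₁ : Ω → ℂ) (c : ℝ → ℝ) (t : ℝ) : ℝ :=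
  ∫ ξ, m ξ * waveE m g₀ g₁ c t ξ ∂μ

theorem aestronglyMeasurable_waveY (hd : IsWaveData μ m g₀ g₁) (hc : IsCoeff ν c T) {t : ℝ}
    (ht : t ∈ Icc 0 T) : AEStronglyMeasurable (waveY m g₀ g₁ c t) μ := by
  have h : ∀ α β, AEStronglyMeasurable (fun ξ => (waveSol c α β (m ξ ^ 2) t : ℂ)) μ := fun α β =>
    (Complex.measurable_ofReal.comp ((measurable_waveSol hc.continuousOn α β ht).comp
      (hd.measurable.pow_const 2))).aestronglyMeasurable
  exact ((h 1 0).mul hd.meas₀).add ((h 0 1).mul hd.meas₁)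

theorem aestronglyMeasurable_waveZ (hd : IsWaveData μ m g₀ g₁) (hc : IsCoeff ν c T) {t : ℝ}
    (ht : t ∈ Icc 0 T) : AEStronglyMeasurable (waveZ m g₀ g₁ c t) μ := by
  have h : ∀ α β, AEStronglyMeasurable (fun ξ => (waveSolDeriv c α β (m ξ ^ 2) t : ℂ)) μ := fun α β =>
    (Complex.measurable_ofReal.comp ((measurable_waveSolDeriv hc.continuousOn α β ht).comp
      (hd.measurable.pow_const 2))).aestronglyMeasurable
  exact ((h 1 0).mul hd.meas₀).add ((h 0 1).mul hd.meas₁)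

theorem integrable_waveY_sq (hd : IsWaveData μ m g₀ g₁) (hc : IsCoeff ν c T) {w : Ω → ℝ}
    (hw : Measurable w) (hw0 : ∀ ξ, 0 ≤ w ξ) (hInt : Integrable (fun ξ => w ξ * dataSize m g₀ g₁ ξ) μ)
    {t : ℝ} (ht : t ∈ Icc 0 T) :
    Integrable (fun ξ => w ξ * (m ξ ^ 2 * ‖waveY m g₀ g₁ c t ξ‖ ^ 2)) μ := by
  obtain ⟨C, -, hC⟩ := exists_norm_sq_le hc m g₀ g₁
  refine (hInt.const_mul C).mono' (hw.aestronglyMeasurable.mul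
    ((hd.measurable.pow_const 2).aestronglyMeasurable.mul
      ((aestronglyMeasurable_waveY hd hc ht).norm.pow 2))) (Eventually.of_forall fun ξ => ?_)
  have := hw0 ξ
  rw [Real.norm_eq_abs, abs_of_nonneg (by positivity)]
  calc _ ≤ w ξ * (C * dataSize m g₀ g₁ ξ) := mul_le_mul_of_nonneg_left (hC t ht ξ).1 this
    _ = _ := by ring

theorem integrable_waveZ_sq (hd : IsWaveData μ m g₀ g₁) (hc : IsCoeff ν c T) {w : Ω → ℝ}
    (hw : Measurable w) (hw0 : ∀ ξ, 0 ≤ w ξ) (hInt : Integrable (fun ξ => w ξ * dataSize m g₀ g₁ ξ) μ)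
    {t : ℝ} (ht : t ∈ Icc 0 T) :
    Integrable (fun ξ => w ξ * ‖waveZ m g₀ g₁ c t ξ‖ ^ 2) μ := by
  obtain ⟨C, -, hC⟩ := exists_norm_sq_le hc m g₀ g₁
  refine (hInt.const_mul C).mono' (hw.aestronglyMeasurable.mul
      ((aestronglyMeasurable_waveZ hd hc ht).norm.pow 2)) (Eventually.of_forall fun ξ => ?_)
  have := hw0 ξ
  rw [Real.norm_eq_abs, abs_of_nonneg (by positivity)]
  calc _ ≤ w ξ * (C * dataSize m g₀ g₁ ξ) := mul_le_mul_of_nonneg_left (hC t ht ξ).2 this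
    _ = _ := by ring

theorem integrable_waveGrad (hd : IsWaveData μ m g₀ g₁) (hc : IsCoeff ν c T) {t : ℝ}
    (ht : t ∈ Icc 0 T) : Integrable (fun ξ => m ξ ^ 2 * ‖waveY m g₀ g₁ c t ξ‖ ^ 2) μ := by
  simpa using integrable_waveY_sq hd hc (w := fun _ => 1) measurable_const (fun _ => zero_le_one)
    (by simpa using hd.int) ht

theorem integrable_mul_waveE (hd : IsWaveData μ m g₀ g₁) (hc : IsCoeff ν c T) {t : ℝ}
    (ht : t ∈ Icc 0 T) : Integrable (fun ξ => m ξ * waveE m g₀ g₁ c t ξ) μ := by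
  have h := ((integrable_waveY_sq hd hc hd.measurable hd.nonneg hd.int_mul ht).const_mul (c t)).add
    (integrable_waveZ_sq hd hc hd.measurable hd.nonneg hd.int_mul ht)
  refine h.congr (Eventually.of_forall fun ξ => ?_)
  simp only [waveE, Pi.add_apply]; ring

theorem waveGrad_nonneg (μ : Measure Ω) (m : Ω → ℝ) (g₀ g₁ : Ω → ℂ) (c : ℝ → ℝ) (t : ℝ) :
    0 ≤ waveGrad μ m g₀ g₁ c t := integral_nonneg fun ξ => by positivity

theorem waveEnergy_nonneg (hd : IsWaveData μ m g₀ g₁) (hc : IsCoeff ν c T) {t : ℝ}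
    (ht : t ∈ Icc 0 T) : 0 ≤ waveEnergy μ m g₀ g₁ c t :=
  integral_nonneg fun ξ => mul_nonneg (hd.nonneg ξ) (waveE_nonneg hc ht ξ)

theorem waveGrad_congr {c' : ℝ → ℝ} (h : ∀ t ∈ Icc 0 T, c t = c' t) {t : ℝ} (ht : t ∈ Icc 0 T) :
    waveGrad μ m g₀ g₁ c t = waveGrad μ m g₀ g₁ c' t := by
  simp only [waveGrad, waveY_congr h ht]

theorem waveEnergy_congr {c' : ℝ → ℝ} (h : ∀ t ∈ Icc 0 T, c t = c' t) {t : ℝ} (ht : t ∈ Icc 0 T) :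
    waveEnergy μ m g₀ g₁ c t = waveEnergy μ m g₀ g₁ c' t := by
  simp only [waveEnergy, waveE_congr h ht]

theorem abs_waveGrad_sub_le (hd : IsWaveData μ m g₀ g₁) (hc : IsCoeff ν c T) {a L : ℝ} (ha : 0 ≤ a)
    (hL0 : 0 ≤ L) (hL : SlopeLE L c a T) {s t : ℝ} (has : a ≤ s) (hst : s ≤ t) (htT : t ≤ T) :
    |waveGrad μ m g₀ g₁ c t - waveGrad μ m g₀ g₁ c s| ≤
      Real.exp (L / ν * (T - a)) / √ν * waveEnergy μ m g₀ g₁ c a * (t - s) := by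
  have hs : s ∈ Icc 0 T := ⟨ha.trans has, hst.trans htT⟩
  have ht : t ∈ Icc 0 T := ⟨hs.1.trans hst, htT⟩
  have ha' : a ∈ Icc 0 T := ⟨ha, has.trans hs.2⟩
  rw [waveGrad, waveGrad, ← integral_sub (integrable_waveGrad hd hc ht) (integrable_waveGrad hd hc hs),
    waveEnergy, ← integral_const_mul, ← integral_mul_const, ← Real.norm_eq_abs]
  refine norm_integral_le_of_norm_le (((integrable_mul_waveE hd hc ha').const_mul _).mul_const _)
    (Eventually.of_forall fun ξ => ?_)
  exact abs_sub_mul_norm_waveY_sq_le hc ha hL0 hL has hst htT (hd.nonneg ξ)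

theorem continuousOn_of_lipschitz {f : ℝ → ℝ} {K a b : ℝ}
    (h : ∀ s t, a ≤ s → s ≤ t → t ≤ b → |f t - f s| ≤ K * (t - s)) : ContinuousOn f (Icc a b) := by
  have : LipschitzOnWith (Real.toNNReal K) f (Icc a b) := by
    refine LipschitzOnWith.of_dist_le_mul fun x hx y hy => ?_
    rw [Real.dist_eq, Real.dist_eq]
    have hK : K ≤ Real.toNNReal K := Real.le_coe_toNNReal K
    rcases le_total x y with hxy | hxy
    · rw [abs_sub_comm (f x), abs_sub_comm x, abs_of_nonneg (sub_nonneg.2 hxy)]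
      exact (h x y hx.1 hxy hy.2).trans (mul_le_mul_of_nonneg_right hK (sub_nonneg.2 hxy))
    · rw [abs_of_nonneg (sub_nonneg.2 hxy)]
      exact (h y x hy.1 hxy hx.2).trans (mul_le_mul_of_nonneg_right hK (sub_nonneg.2 hxy))
  exact this.continuousOn

theorem continuousOn_waveGrad (hd : IsWaveData μ m g₀ g₁) (hc : IsCoeff ν c T) :
    ContinuousOn (waveGrad μ m g₀ g₁ c) (Icc 0 T) := by
  obtain ⟨L, hL0, hL⟩ := hc.slope
  exact continuousOn_of_lipschitz fun s t hs hst ht =>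
    abs_waveGrad_sub_le hd hc le_rfl hL0 hL hs hst ht

/-- The gradient grows at most linearly while the energy of order `3/2` is bounded. -/
theorem waveGrad_le_of_waveEnergy_le (hd : IsWaveData μ m g₀ g₁) (hc : IsCoeff ν c T) {a e : ℝ}
    (ha : 0 ≤ a) (haT : a ≤ T) (he : ∀ t ∈ Ico a T, waveEnergy μ m g₀ g₁ c t ≤ e) :
    waveGrad μ m g₀ g₁ c T ≤ waveGrad μ m g₀ g₁ c a + e / √ν * (T - a) := by
  obtain ⟨L, hL0, hL⟩ := hc.slope
  have hsq : 0 < √ν := Real.sqrt_pos.2 hc.pos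
  refine image_le_of_liminf_slope_right_le_deriv_boundary (a := a) (b := T)
    (B := fun t => waveGrad μ m g₀ g₁ c a + e / √ν * (t - a)) (B' := fun _ => e / √ν)
    ((continuousOn_waveGrad hd hc).mono (Icc_subset_Icc_left ha)) (by simp) (by fun_prop)
    (fun x _ => by simpa using ((((hasDerivAt_id x).sub_const a).const_mul (e / √ν)).const_add
      (waveGrad μ m g₀ g₁ c a)).hasDerivWithinAt)
    (fun x hx r hr => ?_) ⟨haT, le_rfl⟩
  have hx0 : 0 ≤ x := ha.trans hx.1
  -- Restarting the Lipschitz estimate at `x` makes the exponential tend to `1`. So the slope bound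
  -- `e / √ν` is free of `L`, over which there is no control near the end of the life span.
  have hlim : Tendsto (fun u => Real.exp (L / ν * (u - x)) / √ν * e) (𝓝[>] x) (𝓝 (e / √ν)) := by
    have : Continuous fun u => Real.exp (L / ν * (u - x)) / √ν * e := by fun_prop
    have h2 := (this.tendsto x).mono_left (nhdsWithin_le_nhds (s := Ioi x))
    have h3 : Real.exp (L / ν * (x - x)) / √ν * e = e / √ν := by
      rw [sub_self, mul_zero, Real.exp_zero]; ring
    rwa [h3] at h2
  refine Eventually.frequently ?_
  filter_upwards [hlim.eventually (gt_mem_nhds hr), Ioc_mem_nhdsGT hx.2] with u hu hxu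
  refine lt_of_le_of_lt ?_ hu
  rw [slope_def_field, div_le_iff₀ (sub_pos.2 hxu.1)]
  have h1 := abs_waveGrad_sub_le hd (hc.mono hxu.2) hx0 hL0 (hL.mono hx0 hxu.2) le_rfl hxu.1.le le_rfl
  refine (le_abs_self _).trans (h1.trans ?_)
  have := sub_pos.2 hxu.1
  gcongr
  exact he x hx

/-- The contraction estimate. With `e` the energy density at time `a`, the difference satisfies `m
|y₁ - y₂| ≲ δ m √e`, losing one power of `m`, while `m (|y₁| + |y₂|) ≲ √e` loses none. The product
is of order `δ m e`, so integration needs only the energy of order 3/2. The small factor is the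
square root of the length of the interval. -/
theorem abs_waveGrad_sub_waveGrad_le (hd : IsWaveData μ m g₀ g₁) {c₁ c₂ : ℝ → ℝ}
    (hc₁ : IsCoeff ν c₁ T) (hc₂ : IsCoeff ν c₂ T) {a L δ κ : ℝ} (ha : 0 ≤ a) (haT : a ≤ T) (hL0 : 0 ≤ L)
    (hL₁ : SlopeLE L c₁ a T) (hL₂ : SlopeLE L c₂ a T) (heq : ∀ t ∈ Icc 0 a, c₁ t = c₂ t)
    (hδ0 : 0 ≤ δ) (hδ : ∀ t ∈ Icc a T, |c₁ t - c₂ t| ≤ δ) (hLT : (L / ν + 1) * (T - a) ≤ 1)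
    (hκ0 : 0 ≤ κ) (hκ : 108 * (T - a) ≤ κ ^ 2 * ν ^ 3) {t : ℝ} (ht : t ∈ Icc a T) :
    |waveGrad μ m g₀ g₁ c₁ t - waveGrad μ m g₀ g₁ c₂ t| ≤ δ * κ * waveEnergy μ m g₀ g₁ c₁ a := by
  have hν := hc₁.pos
  have hsub : Icc a T ⊆ Icc 0 T := Icc_subset_Icc_left ha
  have haI : a ∈ Icc 0 T := ⟨ha, haT⟩
  have haa : a ∈ Icc 0 a := ⟨ha, le_rfl⟩
  have hTa : 0 ≤ T - a := sub_nonneg.2 haT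
  rw [waveGrad, waveGrad, ← integral_sub (integrable_waveGrad hd hc₁ (hsub ht))
    (integrable_waveGrad hd hc₂ (hsub ht)), waveEnergy, ← integral_const_mul, ← Real.norm_eq_abs]
  refine norm_integral_le_of_norm_le ((integrable_mul_waveE hd hc₁ haI).const_mul _)
    (Eventually.of_forall fun ξ => ?_)
  have hm := hd.nonneg ξ
  set e := waveE m g₀ g₁ c₁ a ξ with he_def
  have he0 : 0 ≤ e := waveE_nonneg hc₁ haI ξ
  have hE : ∀ (c : ℝ → ℝ), IsCoeff ν c T → SlopeLE L c a T → waveE m g₀ g₁ c a ξ = e →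
      ∀ s ∈ Icc a T, m ξ ^ 2 * ‖waveY m g₀ g₁ c s ξ‖ ^ 2 ≤ 3 * e / ν := by
    intro c hc hL hce s hs
    have h1 := waveE_le_mul_exp (m := m) (g₀ := g₀) (g₁ := g₁) hc ha hL0 hL hs.1 hs.2 ξ
    have h2 := mul_norm_waveY_sq_le (m := m) (g₀ := g₀) (g₁ := g₁) hc (hsub hs) ξ
    have h3 : Real.exp (L / ν * (s - a)) ≤ 3 := by
      have h4 : L / ν * (s - a) ≤ 1 := by
        refine le_trans ?_ hLT
        have := div_nonneg hL0 hν.le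
        have := sub_nonneg.2 hs.1
        gcongr
        · linarith
        · exact hs.2
      exact (Real.exp_le_exp.2 h4).trans Real.exp_one_lt_three.le
    rw [hce] at h1
    rw [le_div_iff₀ hν]
    nlinarith [sq_nonneg ‖waveZ m g₀ g₁ c s ξ‖]
  have hE₁ := hE c₁ hc₁ hL₁ rfl
  have hE₂ := hE c₂ hc₂ hL₂ (waveE_congr heq haa ξ).symm
  have key := energy_sub_le (y₁ := fun t => waveY m g₀ g₁ c₁ t ξ) (z₁ := fun t => waveZ m g₀ g₁ c₁ t ξ)
    (y₂ := fun t => waveY m g₀ g₁ c₂ t ξ) (z₂ := fun t => waveZ m g₀ g₁ c₂ t ξ)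
    (sq_nonneg (m ξ)) hL0 hν (hc₁.continuousOn.mono hsub) hL₁ (fun t ht => hc₁.lower t (hsub ht))
    (fun t ht => (hasDerivWithinAt_waveY hc₁ ξ (hsub ht)).mono hsub)
    (fun t ht => (hasDerivWithinAt_waveZ hc₁ ξ (hsub ht)).mono hsub)
    (fun t ht => (hasDerivWithinAt_waveY hc₂ ξ (hsub ht)).mono hsub)
    (fun t ht => (hasDerivWithinAt_waveZ hc₂ ξ (hsub ht)).mono hsub)
    (waveY_congr heq haa ξ) (waveZ_congr heq haa ξ) hδ hE₂ hLT ht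
  have k1 := hE₁ t ht
  have k2 := hE₂ t ht
  set y₁ := waveY m g₀ g₁ c₁ t ξ
  set y₂ := waveY m g₀ g₁ c₂ t ξ
  have h1 : m ξ ^ 2 * ‖y₁ - y₂‖ ^ 2 ≤ 9 * (m ξ ^ 2 * δ ^ 2 * e) * (T - a) / ν ^ 2 := by
    rw [le_div_iff₀ (by positivity)]
    have h2 : ν * (3 * (m ξ ^ 2 * δ ^ 2 * (3 * e / ν)) * (T - a)) = 9 * (m ξ ^ 2 * δ ^ 2 * e) * (T - a) := by
      field_simp; ring
    nlinarith
  have h2 : m ξ ^ 2 * (‖y₁‖ + ‖y₂‖) ^ 2 ≤ 12 * e / ν := by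
    have h3 : m ξ ^ 2 * (‖y₁‖ + ‖y₂‖) ^ 2 ≤ 2 * (m ξ ^ 2 * ‖y₁‖ ^ 2) + 2 * (m ξ ^ 2 * ‖y₂‖ ^ 2) := by
      nlinarith [mul_nonneg (sq_nonneg (m ξ)) (sq_nonneg (‖y₁‖ - ‖y₂‖))]
    have h4 : 12 * e / ν = 2 * (3 * e / ν) + 2 * (3 * e / ν) := by ring
    linarith
  -- Squared to avoid roots; the constants `9` and `12` of the two factors multiply to the `108` of
  -- the hypothesis on `κ`.
  have h3 : (m ξ ^ 2 * ‖y₁ - y₂‖ * (‖y₁‖ + ‖y₂‖)) ^ 2 ≤ (δ * κ * (m ξ * e)) ^ 2 := by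
    calc (m ξ ^ 2 * ‖y₁ - y₂‖ * (‖y₁‖ + ‖y₂‖)) ^ 2
        = (m ξ ^ 2 * ‖y₁ - y₂‖ ^ 2) * (m ξ ^ 2 * (‖y₁‖ + ‖y₂‖) ^ 2) := by ring
      _ ≤ (9 * (m ξ ^ 2 * δ ^ 2 * e) * (T - a) / ν ^ 2) * (12 * e / ν) := by gcongr
      _ = (m ξ * δ * e) ^ 2 * (108 * (T - a)) / ν ^ 3 := by field_simp; ring
      _ ≤ (m ξ * δ * e) ^ 2 * (κ ^ 2 * ν ^ 3) / ν ^ 3 := by gcongr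
      _ = _ := by field_simp
  have h4 := abs_le_of_sq_le_sq h3 (by positivity)
  have h5 : |m ξ ^ 2 * ‖y₁‖ ^ 2 - m ξ ^ 2 * ‖y₂‖ ^ 2| ≤ m ξ ^ 2 * ‖y₁ - y₂‖ * (‖y₁‖ + ‖y₂‖) := by
    have h6 := abs_norm_sub_norm_le y₁ y₂
    rw [show m ξ ^ 2 * ‖y₁‖ ^ 2 - m ξ ^ 2 * ‖y₂‖ ^ 2 =
      m ξ ^ 2 * ((‖y₁‖ - ‖y₂‖) * (‖y₁‖ + ‖y₂‖)) by ring, abs_mul, abs_mul,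
      abs_of_nonneg (sq_nonneg (m ξ)), abs_of_nonneg (by positivity : 0 ≤ ‖y₁‖ + ‖y₂‖), mul_assoc]
    gcongr
  exact h5.trans ((le_abs_self _).trans h4)

end Wave

/-! ### The fixed point equation for the squared gradient norm, and its uniqueness. -/

/-- `r` is Lipschitz on `[a, b]` with constant `K`. -/
def LipOn (K : ℝ) (r : ℝ → ℝ) (a b : ℝ) : Prop :=
  ∀ s t, a ≤ s → s ≤ t → t ≤ b → |r t - r s| ≤ K * (t - s)

theorem LipOn.mono {K : ℝ} {r : ℝ → ℝ} {a b a' b' : ℝ} (h : LipOn K r a b) (ha : a ≤ a')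
    (hb : b' ≤ b) : LipOn K r a' b' :=
  fun s t hs hst ht => h s t (ha.trans hs) hst (ht.trans hb)

theorem LipOn.glue {K₁ K₂ : ℝ} {r : ℝ → ℝ} {a b d : ℝ} (h₁ : LipOn K₁ r a b) (h₂ : LipOn K₂ r b d) :
    LipOn (max K₁ K₂) r a d := by
  intro s t hs hst ht
  have hm : ∀ x : ℝ, 0 ≤ x → K₁ * x ≤ max K₁ K₂ * x ∧ K₂ * x ≤ max K₁ K₂ * x := fun x hx =>
    ⟨mul_le_mul_of_nonneg_right (le_max_left _ _) hx, mul_le_mul_of_nonneg_right (le_max_right _ _) hx⟩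
  have hts : 0 ≤ t - s := sub_nonneg.2 hst
  rcases le_total t b with htb | htb
  · exact (h₁ s t hs hst htb).trans (hm _ hts).1
  rcases le_total b s with hbs | hbs
  · exact (h₂ s t hbs hst ht).trans (hm _ hts).2
  have e1 := (h₁ s b hs hbs le_rfl).trans (hm _ (sub_nonneg.2 hbs)).1
  have e2 := (h₂ b t le_rfl htb ht).trans (hm _ (sub_nonneg.2 htb)).2
  have e3 := abs_sub_le (r t) (r b) (r s)
  linarith

theorem exists_lip_on_Icc {φ : ℝ → ℝ} (hφ : LocallyLipschitzOn (Ici 0) φ) (R : ℝ) :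
    ∃ L : ℝ, 0 ≤ L ∧ ∀ x ∈ Icc 0 R, ∀ y ∈ Icc 0 R, |φ x - φ y| ≤ L * |x - y| := by
  obtain ⟨K, hK⟩ := (hφ.mono (Icc_subset_Ici_self : Icc 0 R ⊆ Ici 0)).exists_lipschitzOnWith_of_compact
    isCompact_Icc
  exact ⟨K, K.2, fun x hx y hy => by simpa [Real.dist_eq] using hK.dist_le_mul x hx y hy⟩

theorem slopeLE_comp {φ r : ℝ → ℝ} {L K R a b : ℝ} (hL0 : 0 ≤ L)
    (hL : ∀ x ∈ Icc 0 R, ∀ y ∈ Icc 0 R, |φ x - φ y| ≤ L * |x - y|) (hr : LipOn K r a b)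
    (hrR : ∀ t ∈ Icc a b, r t ∈ Icc 0 R) : SlopeLE (L * K) (fun t => φ (r t)) a b := by
  intro s t hs hst ht
  calc φ (r t) - φ (r s) ≤ |φ (r t) - φ (r s)| := le_abs_self _
    _ ≤ L * |r t - r s| := hL _ (hrR t ⟨hs.trans hst, ht⟩) _ (hrR s ⟨hs, hst.trans ht⟩)
    _ ≤ L * (K * (t - s)) := by gcongr; exact hr s t hs hst ht
    _ = L * K * (t - s) := by ring

theorem isCoeff_comp {φ : ℝ → ℝ} (hφ : LocallyLipschitzOn (Ici 0) φ) {ν : ℝ} (hν : 0 < ν)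
    (hφν : ∀ ρ, 0 ≤ ρ → ν ≤ φ ρ) {r : ℝ → ℝ} {K T : ℝ} (hK : 0 ≤ K) (hr : LipOn K r 0 T)
    (hr0 : ∀ t ∈ Icc 0 T, 0 ≤ r t) : IsCoeff ν (fun t => φ (r t)) T := by
  have hrc : ContinuousOn r (Icc 0 T) := continuousOn_of_lipschitz hr
  obtain ⟨R, hR⟩ : ∃ R, ∀ t ∈ Icc 0 T, r t ∈ Icc 0 R := by
    obtain ⟨R, hR⟩ := isCompact_Icc.exists_bound_of_continuousOn hrc
    exact ⟨R, fun t ht => ⟨hr0 t ht, (le_abs_self _).trans (hR t ht)⟩⟩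
  obtain ⟨L, hL0, hL⟩ := exists_lip_on_Icc hφ R
  exact ⟨hν, hφ.continuousOn.comp hrc hr0, fun t ht => hφν _ (hr0 t ht),
    L * K, mul_nonneg hL0 hK, slopeLE_comp hL0 hL hr hR⟩

section Fix

variable {Ω : Type*} [MeasurableSpace Ω] {μ : Measure Ω} {m : Ω → ℝ} {g₀ g₁ : Ω → ℂ} {φ : ℝ → ℝ}
  {ν T : ℝ} {r : ℝ → ℝ}

/-- `r(t) = ‖∇u(t)‖²` on `[0, T]` for the solution `u` of the Kirchhoff equation. -/
structure IsFix (μ : Measure Ω) (m : Ω → ℝ) (g₀ g₁ : Ω → ℂ) (φ : ℝ → ℝ) (T : ℝ) (r : ℝ → ℝ) :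
    Prop where
  lip : ∃ K, 0 ≤ K ∧ LipOn K r 0 T
  eq : ∀ t ∈ Icc 0 T, r t = waveGrad μ m g₀ g₁ (fun s => φ (r s)) t

theorem IsFix.mono (h : IsFix μ m g₀ g₁ φ T r) {T' : ℝ} (hT : T' ≤ T) : IsFix μ m g₀ g₁ φ T' r :=
  ⟨let ⟨K, h0, hK⟩ := h.lip; ⟨K, h0, hK.mono le_rfl hT⟩, fun t ht => h.eq t ⟨ht.1, ht.2.trans hT⟩⟩

theorem IsFix.congr (h : IsFix μ m g₀ g₁ φ T r) {r' : ℝ → ℝ} (hr : ∀ t ∈ Icc 0 T, r t = r' t) :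
    IsFix μ m g₀ g₁ φ T r' := by
  obtain ⟨K, hK0, hK⟩ := h.lip
  refine ⟨⟨K, hK0, fun s t hs hst ht => ?_⟩, fun t ht => ?_⟩
  · rw [← hr t ⟨hs.trans hst, ht⟩, ← hr s ⟨hs, hst.trans ht⟩]
    exact hK s t hs hst ht
  · rw [← hr t ht, h.eq t ht]
    exact waveGrad_congr (fun s hs => by rw [hr s hs]) ht

theorem IsFix.nonneg (h : IsFix μ m g₀ g₁ φ T r) {t : ℝ} (ht : t ∈ Icc 0 T) : 0 ≤ r t := by
  rw [h.eq t ht]; exact waveGrad_nonneg _ _ _ _ _ _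

theorem IsFix.isCoeff (h : IsFix μ m g₀ g₁ φ T r) (hφ : LocallyLipschitzOn (Ici 0) φ) (hν : 0 < ν)
    (hφν : ∀ ρ, 0 ≤ ρ → ν ≤ φ ρ) : IsCoeff ν (fun t => φ (r t)) T :=
  let ⟨_, h0, hK⟩ := h.lip
  isCoeff_comp hφ hν hφν h0 hK fun _ ht => h.nonneg ht

/-- The degenerate interval serves as starting point, so that local existence is a case of
continuation. -/
theorem isFix_zero (μ : Measure Ω) (m : Ω → ℝ) (g₀ g₁ : Ω → ℂ) (φ : ℝ → ℝ) :
    IsFix μ m g₀ g₁ φ 0 (fun _ => ∫ ξ, m ξ ^ 2 * ‖g₀ ξ‖ ^ 2 ∂μ) := by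
  refine ⟨⟨0, le_rfl, fun s t _ _ _ => by simp⟩, fun t ht => ?_⟩
  have : t = 0 := le_antisymm ht.2 ht.1
  simp only [this, waveGrad, waveY_zero]

theorem exists_pos_small (a κ ν : ℝ) (ha : 0 ≤ a) (hκ : 0 < κ) (hν : 0 < ν) :
    ∃ h : ℝ, 0 < h ∧ a * h ≤ 1 ∧ 108 * h ≤ κ ^ 2 * ν ^ 3 := by
  refine ⟨min (1 / (a + 1)) (κ ^ 2 * ν ^ 3 / 108), by positivity, ?_, ?_⟩
  · calc a * min (1 / (a + 1)) (κ ^ 2 * ν ^ 3 / 108) ≤ a * (1 / (a + 1)) := by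
          gcongr; exact min_le_left _ _
      _ ≤ 1 := by rw [mul_one_div, div_le_one (by positivity)]; linarith
  · calc 108 * min (1 / (a + 1)) (κ ^ 2 * ν ^ 3 / 108) ≤ 108 * (κ ^ 2 * ν ^ 3 / 108) := by
          gcongr; exact min_le_right _ _
      _ = _ := by ring

theorem exists_waveEnergy_le (hd : IsWaveData μ m g₀ g₁) {c : ℝ → ℝ} (hc : IsCoeff ν c T) :
    ∃ M, 0 ≤ M ∧ ∀ t ∈ Icc 0 T, waveEnergy μ m g₀ g₁ c t ≤ M := by
  obtain ⟨C, hC0, hC⟩ := exists_waveE_le hc m g₀ g₁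
  refine ⟨C * ∫ ξ, m ξ * dataSize m g₀ g₁ ξ ∂μ, mul_nonneg hC0 (integral_nonneg fun ξ =>
    mul_nonneg (hd.nonneg ξ) (dataSize_nonneg _ _ _ _)), fun t ht => ?_⟩
  rw [← integral_const_mul]
  refine integral_mono (integrable_mul_waveE hd hc ht) (hd.int_mul.const_mul C) fun ξ => ?_
  calc m ξ * waveE m g₀ g₁ c t ξ ≤ m ξ * (C * dataSize m g₀ g₁ ξ) :=
        mul_le_mul_of_nonneg_left (hC t ht ξ) (hd.nonneg ξ)
    _ = _ := by ring

/-- Slope constants, Lipschitz constant of `φ` and energy are bounded over all of `[0, T]`, so one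
step length `h` serves throughout and agreement propagates from `[0, k h]` to `[0, (k + 1) h]`. -/
theorem IsFix.unique (hd : IsWaveData μ m g₀ g₁) (hφ : LocallyLipschitzOn (Ici 0) φ) (hν : 0 < ν)
    (hφν : ∀ ρ, 0 ≤ ρ → ν ≤ φ ρ) {r₁ r₂ : ℝ → ℝ} (h₁ : IsFix μ m g₀ g₁ φ T r₁)
    (h₂ : IsFix μ m g₀ g₁ φ T r₂) : ∀ t ∈ Icc 0 T, r₁ t = r₂ t := by
  have hc₁ := h₁.isCoeff hφ hν hφν
  have hc₂ := h₂.isCoeff hφ hν hφν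
  obtain ⟨K₁, hK₁0, hK₁⟩ := h₁.lip
  obtain ⟨K₂, hK₂0, hK₂⟩ := h₂.lip
  have hr₁ : ContinuousOn r₁ (Icc 0 T) := continuousOn_of_lipschitz hK₁
  have hr₂ : ContinuousOn r₂ (Icc 0 T) := continuousOn_of_lipschitz hK₂
  obtain ⟨L₁, hL₁0, hL₁⟩ := hc₁.slope
  obtain ⟨L₂, hL₂0, hL₂⟩ := hc₂.slope
  obtain ⟨R₁, hR₁⟩ := isCompact_Icc.exists_bound_of_continuousOn hr₁
  obtain ⟨R₂, hR₂⟩ := isCompact_Icc.exists_bound_of_continuousOn hr₂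
  obtain ⟨P, hP0, hP⟩ := exists_lip_on_Icc hφ (max R₁ R₂)
  obtain ⟨M, hM0, hM⟩ := exists_waveEnergy_le hd hc₁
  have hL0 : 0 ≤ max L₁ L₂ := le_max_of_le_left hL₁0
  -- Chosen so that `P * κ * M ≤ 1 / 2`; the summand `1` covers the case `P * M = 0`.
  have hκ : 0 < 1 / (2 * (P * M + 1)) := by positivity
  obtain ⟨h, h0, hh1, hh2⟩ := exists_pos_small (max L₁ L₂ / ν + 1) _ ν (by positivity) hκ hν
  have hS₁ : SlopeLE (max L₁ L₂) (fun t => φ (r₁ t)) 0 T := fun s t hs hst ht =>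
    (hL₁ s t hs hst ht).trans (mul_le_mul_of_nonneg_right (le_max_left _ _) (sub_nonneg.2 hst))
  have hS₂ : SlopeLE (max L₁ L₂) (fun t => φ (r₂ t)) 0 T := fun s t hs hst ht =>
    (hL₂ s t hs hst ht).trans (mul_le_mul_of_nonneg_right (le_max_right _ _) (sub_nonneg.2 hst))
  have claim : ∀ k : ℕ, ∀ t ∈ Icc 0 T, t ≤ k * h → r₁ t = r₂ t := by
    intro k
    induction k with
    | zero =>
      intro t ht htk
      have : t = 0 := le_antisymm (by simpa using htk) ht.1
      subst this
      rw [h₁.eq 0 ht, h₂.eq 0 ht]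
      simp only [waveGrad, waveY_zero]
    | succ k ih =>
      intro t ht htk
      rcases le_total t (k * h) with htk' | htk'
      · exact ih t ht htk'
      set a : ℝ := k * h
      have ha : 0 ≤ a := by positivity
      set b := min ((k + 1 : ℕ) * h) T with hb_def
      have htb : t ≤ b := le_min htk ht.2
      have hbT : b ≤ T := min_le_right _ _
      have hab : a ≤ b := htk'.trans htb
      have hba : b - a ≤ h := by
        have : b ≤ (k + 1 : ℕ) * h := min_le_left _ _
        push_cast at this
        simp only [a]; linarith
      have hsub : Icc a b ⊆ Icc 0 T := Icc_subset_Icc ha hbT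
      -- At a maximum point the contraction estimate bounds the maximum of `|r₁ - r₂|` by half of
      -- itself.
      obtain ⟨t', ht', hmax⟩ := isCompact_Icc.exists_isMaxOn (nonempty_Icc.2 hab)
        ((hr₁.mono hsub).sub (hr₂.mono hsub)).norm
      have hmax' : ∀ s ∈ Icc a b, |r₁ s - r₂ s| ≤ |r₁ t' - r₂ t'| := fun s hs => hmax hs
      have key := abs_waveGrad_sub_waveGrad_le hd (hc₁.mono hbT) (hc₂.mono hbT) (a := a)
        (δ := P * |r₁ t' - r₂ t'|) (κ := 1 / (2 * (P * M + 1))) ha hab hL0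
        (hS₁.mono ha hbT) (hS₂.mono ha hbT)
        (fun s hs => by rw [ih s ⟨hs.1, hs.2.trans (hab.trans hbT)⟩ hs.2]) (by positivity)
        (fun s hs => by
          have hsT := hsub hs
          refine (hP _ ⟨h₁.nonneg hsT, ?_⟩ _ ⟨h₂.nonneg hsT, ?_⟩).trans
            (mul_le_mul_of_nonneg_left (hmax' s hs) hP0)
          · exact (le_abs_self _).trans ((hR₁ s hsT).trans (le_max_left _ _))
          · exact (le_abs_self _).trans ((hR₂ s hsT).trans (le_max_right _ _)))
        (le_trans (by gcongr) hh1) hκ.le (le_trans (by gcongr) hh2) ht'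
      rw [← h₁.eq t' (hsub ht'), ← h₂.eq t' (hsub ht')] at key
      have hMa := hM a ⟨ha, hab.trans hbT⟩
      have h3 : P * |r₁ t' - r₂ t'| * (1 / (2 * (P * M + 1))) *
          waveEnergy μ m g₀ g₁ (fun s => φ (r₁ s)) a ≤ |r₁ t' - r₂ t'| / 2 := by
        calc _ ≤ P * |r₁ t' - r₂ t'| * (1 / (2 * (P * M + 1))) * M := by gcongr
          _ = |r₁ t' - r₂ t'| / 2 * (P * M / (P * M + 1)) := by field_simp
          _ ≤ |r₁ t' - r₂ t'| / 2 * 1 := by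
            gcongr
            rw [div_le_one (by positivity)]; linarith
          _ = _ := mul_one _
      have h4 : |r₁ t' - r₂ t'| ≤ 0 := by linarith
      have h5 := (hmax' t ⟨htk', htb⟩).trans h4
      exact sub_eq_zero.1 (abs_nonpos_iff.1 h5)
  intro t ht
  obtain ⟨k, hk⟩ := exists_nat_ge (t / h)
  exact claim k t ht ((div_le_iff₀ h0).1 hk)

end Fix

/-! ### Continuation by the contraction principle. -/

section Extend

variable {Ω : Type*} [MeasurableSpace Ω] {μ : Measure Ω} {m : Ω → ℝ} {g₀ g₁ : Ω → ℂ} {φ : ℝ → ℝ}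
  {ν T b K : ℝ} {r : ℝ → ℝ}

/-- The nonnegative extensions of `r` from `[0, T]` to `[0, b]` that have Lipschitz constant `K` on
`[T, b]`. -/
def extensionSet (r : ℝ → ℝ) (T K : ℝ) {b : ℝ} (hb : 0 ≤ b) : Set C(Icc (0 : ℝ) b, ℝ) :=
  {f | (∀ t ∈ Icc 0 T, f (projIcc 0 b hb t) = r t) ∧ (∀ t, 0 ≤ f (projIcc 0 b hb t)) ∧
    LipOn K (fun t => f (projIcc 0 b hb t)) T b}

theorem isClosed_extensionSet (r : ℝ → ℝ) (T K : ℝ) (hb : 0 ≤ b) :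
    IsClosed (extensionSet r T K hb) := by
  have hev : ∀ t, Continuous fun f : C(Icc (0 : ℝ) b, ℝ) => f (projIcc 0 b hb t) :=
    fun t => by fun_prop
  simp only [extensionSet, LipOn, ofPred_and, ofPred_forall]
  refine IsClosed.inter ?_ (IsClosed.inter ?_ ?_)
  · exact isClosed_iInter fun t => isClosed_iInter fun _ => isClosed_eq (hev t) continuous_const
  · exact isClosed_iInter fun t => isClosed_le continuous_const (hev t)
  · exact isClosed_iInter fun s => isClosed_iInter fun t => isClosed_iInter fun _ =>
      isClosed_iInter fun _ => isClosed_iInter fun _ =>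
        isClosed_le ((hev t).sub (hev s)).abs continuous_const

/-- On so short an interval a candidate rises by at most `1`; hence a Lipschitz constant of `φ` on
`[0, ρ + 1]` can be fixed beforehand. -/
theorem extension_mem {f : C(Icc (0 : ℝ) b, ℝ)} {hb : 0 ≤ b} (hf : f ∈ extensionSet r T K hb)
    {t : ℝ} (hT0 : 0 ≤ T) {ρ : ℝ} (hρ : r T ≤ ρ) (hK : 0 ≤ K) (hKb : K * (b - T) ≤ 1)
    (ht : t ∈ Icc T b) : f (projIcc 0 b hb t) ∈ Icc 0 (ρ + 1) := by
  refine ⟨hf.2.1 t, ?_⟩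
  have h1 := hf.2.2 T t le_rfl ht.1 ht.2
  have h2 : f (projIcc 0 b hb T) = r T := hf.1 T ⟨hT0, le_rfl⟩
  simp only [h2] at h1
  have h3 : K * (t - T) ≤ K * (b - T) := by have := ht.2; gcongr
  linarith [le_abs_self (f (projIcc 0 b hb t) - r T)]

/-- The map whose fixed points give extended solutions. -/
def extensionMap (μ : Measure Ω) (m : Ω → ℝ) (g₀ g₁ : Ω → ℂ) (φ : ℝ → ℝ) {b : ℝ} (hb : 0 ≤ b)
    (f : C(Icc (0 : ℝ) b, ℝ)) : C(Icc (0 : ℝ) b, ℝ) := by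
  classical
  -- On the extension sets used below the continuity holds, so the value `0` plays no role.
  exact if h : ContinuousOn (waveGrad μ m g₀ g₁ fun s => φ (f (projIcc 0 b hb s))) (Icc 0 b) then
    ⟨_, h.domRestrict⟩ else 0

theorem extensionMap_apply {hb : 0 ≤ b} {f : C(Icc (0 : ℝ) b, ℝ)}
    (h : ContinuousOn (waveGrad μ m g₀ g₁ fun s => φ (f (projIcc 0 b hb s))) (Icc 0 b))
    (x : Icc (0 : ℝ) b) : extensionMap μ m g₀ g₁ φ hb f x =
      waveGrad μ m g₀ g₁ (fun s => φ (f (projIcc 0 b hb s))) x := by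
  rw [extensionMap, dif_pos h]; rfl

/-- The three smallness conditions on `τ` have separate tasks: `hτ₁` keeps the exponential factor
below `3`, `hτ₂` keeps the candidates in `[0, ρ + 1]`, and `hτ₃` gives the contraction factor `1 /
2`. -/
theorem IsFix.exists_extend (hd : IsWaveData μ m g₀ g₁) (hφ : LocallyLipschitzOn (Ici 0) φ)
    (hν : 0 < ν) (hφν : ∀ ρ, 0 ≤ ρ → ν ≤ φ ρ) {ρ e P τ : ℝ} (he0 : 0 ≤ e) (hP0 : 0 ≤ P)
    (hP : ∀ x ∈ Icc 0 (ρ + 1), ∀ y ∈ Icc 0 (ρ + 1), |φ x - φ y| ≤ P * |x - y|) (hτ : 0 < τ)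
    (hτ₁ : (P * (3 * e / √ν) / ν + 1) * τ ≤ 1) (hτ₂ : 3 * e / √ν * τ ≤ 1)
    (hτ₃ : 108 * τ ≤ (1 / (2 * (P * e + 1))) ^ 2 * ν ^ 3)
    (hT : 0 ≤ T) (h : IsFix μ m g₀ g₁ φ T r) (hρ : r T ≤ ρ)
    (he : waveEnergy μ m g₀ g₁ (fun t => φ (r t)) T ≤ e) :
    ∃ r', IsFix μ m g₀ g₁ φ (T + τ) r' := by
  obtain ⟨K₀, hK₀0, hK₀⟩ := h.lip
  have hsq : 0 < √ν := Real.sqrt_pos.2 hν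
  -- The Lipschitz constant that the map returns when its exponential factor is at most `3`. It does
  -- not involve the candidate's own constant, so the set is mapped into itself.
  set K := 3 * e / √ν with hK_def
  have hK : 0 ≤ K := by positivity
  set b := T + τ with hb_def
  have hTb : T ≤ b := by linarith
  have hb : 0 ≤ b := hT.trans hTb
  have hbT : b - T = τ := by rw [hb_def]; ring
  have hL0 : 0 ≤ P * K := by positivity
  set S := extensionSet r T K hb
  have hTI : T ∈ Icc 0 T := ⟨hT, le_rfl⟩
  -- properties of the members of `S`
  have agree : ∀ f ∈ S, ∀ t ∈ Icc 0 T, φ (f (projIcc 0 b hb t)) = φ (r t) :=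
    fun f hf t ht => by rw [hf.1 t ht]
  have lip : ∀ f ∈ S, LipOn (max K₀ K) (fun t => f (projIcc 0 b hb t)) 0 b := fun f hf =>
    LipOn.glue (fun s t hs hst ht => by
      simp only [hf.1 t ⟨hs.trans hst, ht⟩, hf.1 s ⟨hs, hst.trans ht⟩]
      exact hK₀ s t hs hst ht) hf.2.2
  have coeff : ∀ f ∈ S, IsCoeff ν (fun t => φ (f (projIcc 0 b hb t))) b := fun f hf =>
    isCoeff_comp hφ hν hφν (le_max_of_le_left hK₀0) (lip f hf) fun t _ => hf.2.1 t
  have slope : ∀ f ∈ S, SlopeLE (P * K) (fun t => φ (f (projIcc 0 b hb t))) T b := fun f hf =>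
    slopeLE_comp hP0 hP hf.2.2 fun t ht => extension_mem hf hT hρ hK (by rwa [hbT]) ht
  have energy : ∀ f ∈ S, waveEnergy μ m g₀ g₁ (fun t => φ (f (projIcc 0 b hb t))) T ≤ e :=
    fun f hf => (waveEnergy_congr (agree f hf) hTI).trans_le he
  have cont : ∀ f ∈ S, ContinuousOn (waveGrad μ m g₀ g₁ fun s => φ (f (projIcc 0 b hb s))) (Icc 0 b) :=
    fun f hf => continuousOn_waveGrad hd (coeff f hf)
  have apply : ∀ f ∈ S, ∀ t ∈ Icc 0 b, extensionMap μ m g₀ g₁ φ hb f (projIcc 0 b hb t) =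
      waveGrad μ m g₀ g₁ (fun s => φ (f (projIcc 0 b hb s))) t := fun f hf t ht => by
    rw [extensionMap_apply (cont f hf), projIcc_of_mem hb ht]
  have past : ∀ f ∈ S, ∀ t ∈ Icc 0 T,
      waveGrad μ m g₀ g₁ (fun s => φ (f (projIcc 0 b hb s))) t = r t := fun f hf t ht => by
    rw [waveGrad_congr (agree f hf) ht, ← h.eq t ht]
  have maps : MapsTo (extensionMap μ m g₀ g₁ φ hb) S S := by
    intro f hf
    refine ⟨fun t ht => ?_, fun t => ?_, fun s t hs hst ht => ?_⟩
    · rw [apply f hf t ⟨ht.1, ht.2.trans hTb⟩, past f hf t ht]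
    · rw [extensionMap_apply (cont f hf)]; exact waveGrad_nonneg _ _ _ _ _ _
    · simp only [apply f hf t ⟨hT.trans (hs.trans hst), ht⟩, apply f hf s ⟨hT.trans hs, hst.trans ht⟩]
      refine (abs_waveGrad_sub_le hd (coeff f hf) hT hL0 (slope f hf) hs hst ht).trans ?_
      refine mul_le_mul_of_nonneg_right ?_ (sub_nonneg.2 hst)
      have h1 : Real.exp (P * K / ν * (b - T)) ≤ 3 := by
        refine (Real.exp_le_exp.2 ?_).trans Real.exp_one_lt_three.le
        rw [hbT]; refine le_trans ?_ hτ₁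
        gcongr; linarith
      have h2 := energy f hf
      calc _ ≤ 3 / √ν * e := by
            gcongr
            exact waveEnergy_nonneg hd (coeff f hf) ⟨hT, hTb⟩
        _ = K := by rw [hK_def]; ring
  have contr : ∀ f ∈ S, ∀ g ∈ S, dist (extensionMap μ m g₀ g₁ φ hb f)
      (extensionMap μ m g₀ g₁ φ hb g) ≤ 1 / 2 * dist f g := by
    intro f hf g hg
    refine (ContinuousMap.dist_le (by positivity)).2 fun x => ?_
    have hx : projIcc 0 b hb x = x := projIcc_val hb x
    rw [← hx, apply f hf x x.2, apply g hg x x.2, Real.dist_eq]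
    rcases le_total (x : ℝ) T with hxT | hxT
    · rw [past f hf x ⟨x.2.1, hxT⟩, past g hg x ⟨x.2.1, hxT⟩, sub_self, abs_zero]
      positivity
    · refine (abs_waveGrad_sub_waveGrad_le hd (coeff f hf) (coeff g hg) (δ := P * dist f g)
        (κ := 1 / (2 * (P * e + 1))) hT hTb hL0 (slope f hf) (slope g hg)
        (fun t ht => by rw [agree f hf t ht, agree g hg t ht]) (by positivity) (fun t ht => ?_)
        (by rwa [hbT]) (by positivity) (by rwa [hbT]) ⟨hxT, x.2.2⟩).trans ?_
      · refine (hP _ (extension_mem hf hT hρ hK (by rwa [hbT]) ht) _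
          (extension_mem hg hT hρ hK (by rwa [hbT]) ht)).trans ?_
        gcongr
        exact ContinuousMap.dist_apply_le_dist (f := f) (g := g) _
      · have h2 := energy f hf
        calc _ ≤ P * dist f g * (1 / (2 * (P * e + 1))) * e := by gcongr
          _ = 1 / 2 * dist f g * (P * e / (P * e + 1)) := by field_simp
          _ ≤ 1 / 2 * dist f g * 1 := by
            gcongr
            rw [div_le_one (by positivity)]; linarith
          _ = _ := mul_one _
  have hcw : ContractingWith (1 / 2) (maps.restrict _ S S) := by
    refine ⟨by norm_num, LipschitzWith.of_dist_le_mul fun f g => ?_⟩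
    have h1 := contr f f.2 g g.2
    rw [Subtype.dist_eq, Subtype.dist_eq]
    simpa using h1
  -- The extension frozen after `T` shows that the set is not empty.
  let f₀ : C(Icc (0 : ℝ) b, ℝ) := ⟨fun x => r (min x T), by
    refine (continuousOn_of_lipschitz hK₀).comp_continuous (by fun_prop) fun x => ?_
    exact ⟨le_min x.2.1 hT, min_le_right _ _⟩⟩
  have hf₀ : f₀ ∈ S := by
    refine ⟨fun t ht => ?_, fun t => h.nonneg ⟨le_min (projIcc 0 b hb t).2.1 hT, min_le_right _ _⟩,
      fun s t hs hst ht => ?_⟩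
    · change r (min (projIcc 0 b hb t : ℝ) T) = r t
      rw [projIcc_of_mem hb ⟨ht.1, ht.2.trans hTb⟩]
      simp only [min_eq_left ht.2]
    · change |r (min (projIcc 0 b hb t : ℝ) T) - r (min (projIcc 0 b hb s : ℝ) T)| ≤ _
      rw [projIcc_of_mem hb ⟨hT.trans (hs.trans hst), ht⟩, projIcc_of_mem hb ⟨hT.trans hs, hst.trans ht⟩]
      simp only [min_eq_right hs, min_eq_right (hs.trans hst), sub_self, abs_zero]
      exact mul_nonneg hK (sub_nonneg.2 hst)
  obtain ⟨f, hfS, hfix, -, -⟩ := hcw.exists_fixedPoint' (isClosed_extensionSet r T K hb).isComplete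
    maps hf₀ (edist_ne_top _ _)
  refine ⟨fun t => f (projIcc 0 b hb t), ⟨_, le_max_of_le_left hK₀0, lip f hfS⟩, fun t ht => ?_⟩
  rw [← apply f hfS t ht, hfix]

end Extend

/-- Solutions can be continued for a time bounded below in terms of `‖∇u‖²` and of the energy of
order `3/2`. -/
theorem exists_extension_time {φ : ℝ → ℝ} (hφ : LocallyLipschitzOn (Ici 0) φ) {ν : ℝ} (hν : 0 < ν)
    (hφν : ∀ ρ, 0 ≤ ρ → ν ≤ φ ρ) (ρ e : ℝ) (he : 0 ≤ e) :
    ∃ τ : ℝ, 0 < τ ∧ ∀ (Ω : Type) [MeasurableSpace Ω] (μ : Measure Ω) (m : Ω → ℝ) (g₀ g₁ : Ω → ℂ),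
      IsWaveData μ m g₀ g₁ → ∀ T r, 0 ≤ T → IsFix μ m g₀ g₁ φ T r → r T ≤ ρ →
        waveEnergy μ m g₀ g₁ (fun t => φ (r t)) T ≤ e → ∃ r', IsFix μ m g₀ g₁ φ (T + τ) r' := by
  obtain ⟨P, hP0, hP⟩ := exists_lip_on_Icc hφ (ρ + 1)
  have hsq : 0 < √ν := Real.sqrt_pos.2 hν
  have hK : 0 ≤ 3 * e / √ν := by positivity
  have hL : 0 ≤ P * (3 * e / √ν) / ν + 1 := by positivity
  -- The sum of two nonnegative constants, so that one condition yields both `hτ₁` and `hτ₂`.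
  obtain ⟨τ, hτ, h1, h2⟩ := exists_pos_small (P * (3 * e / √ν) / ν + 1 + 3 * e / √ν)
    (1 / (2 * (P * e + 1))) ν (by positivity) (by positivity) hν
  refine ⟨τ, hτ, fun Ω _ μ m g₀ g₁ hd T r hT h hρ heT => ?_⟩
  refine IsFix.exists_extend hd hφ hν hφν he hP0 hP hτ ?_ ?_ h2 hT h hρ heT
  · exact (mul_le_mul_of_nonneg_right (by linarith) hτ.le).trans h1
  · exact (mul_le_mul_of_nonneg_right (by linarith) hτ.le).trans h1

/-! ### Continuity and differentiability in time, in weighted norms. -/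

section Limits

variable {Ω : Type*} {m : Ω → ℝ} {g₀ g₁ : Ω → ℂ} {c : ℝ → ℝ} {T ν : ℝ}

/-- Mean value inequality with the bound for `z`. Unlike the energy bound for `y` itself, it carries
no factor `m²` on the left, so increments are controlled at low frequencies too. -/
theorem exists_norm_waveY_sub_sq_le (hc : IsCoeff ν c T) (m : Ω → ℝ) (g₀ g₁ : Ω → ℂ) :
    ∃ C, 0 ≤ C ∧ ∀ s ∈ Icc 0 T, ∀ t ∈ Icc 0 T, ∀ ξ,
      ‖waveY m g₀ g₁ c s ξ - waveY m g₀ g₁ c t ξ‖ ^ 2 ≤ C * dataSize m g₀ g₁ ξ * (s - t) ^ 2 := by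
  obtain ⟨C, hC0, hC⟩ := exists_norm_sq_le hc m g₀ g₁
  refine ⟨C, hC0, fun s hs t ht ξ => ?_⟩
  have h := Convex.norm_image_sub_le_of_norm_hasDerivWithin_le
    (fun x hx => hasDerivWithinAt_waveY hc (m := m) (g₀ := g₀) (g₁ := g₁) ξ hx)
    (fun x hx => Real.le_sqrt_of_sq_le (hC x hx ξ).2) (convex_Icc 0 T) ht hs
  have hd : 0 ≤ C * dataSize m g₀ g₁ ξ := mul_nonneg hC0 (dataSize_nonneg m g₀ g₁ ξ)
  calc _ ≤ (√(C * dataSize m g₀ g₁ ξ) * ‖s - t‖) ^ 2 := by gcongr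
    _ = _ := by rw [mul_pow, Real.sq_sqrt hd, Real.norm_eq_abs, sq_abs]

variable [MeasurableSpace Ω] {μ : Measure Ω}

theorem tendsto_lintegral_mul_enorm_sq {ι : Type*} {l : Filter ι} [l.IsCountablyGenerated]
    {F : ι → Ω → ℂ} {v G : Ω → ℝ} (hv : Measurable v) (hv0 : ∀ ξ, 0 ≤ v ξ) (hG : Integrable G μ)
    (hF : ∀ᶠ r in l, AEStronglyMeasurable (F r) μ)
    (hb : ∀ᶠ r in l, ∀ ξ, v ξ * ‖F r ξ‖ ^ 2 ≤ G ξ) (hlim : ∀ ξ, Tendsto (fun r => F r ξ) l (𝓝 0)) :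
    Tendsto (fun r => ∫⁻ ξ, ENNReal.ofReal (v ξ) * ‖F r ξ‖ₑ ^ 2 ∂μ) l (𝓝 0) := by
  have hconv : ∀ r ξ, ENNReal.ofReal (v ξ) * ‖F r ξ‖ₑ ^ 2 = ENNReal.ofReal (v ξ * ‖F r ξ‖ ^ 2) := by
    intro r ξ
    rw [ENNReal.ofReal_mul (hv0 ξ), ENNReal.ofReal_pow (norm_nonneg _), ofReal_norm]
  simp only [hconv]
  have h0 : (0 : ℝ≥0∞) = ∫⁻ _ : Ω, 0 ∂μ := by simp
  rw [h0]
  refine tendsto_lintegral_filter_of_dominated_convergence' (fun ξ => ENNReal.ofReal (G ξ)) ?_ ?_ ?_ ?_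
  · filter_upwards [hF] with r hr
    exact (hv.aemeasurable.mul (hr.norm.aemeasurable.pow_const 2)).ennreal_ofReal
  · filter_upwards [hb] with r hr
    exact Eventually.of_forall fun ξ => ENNReal.ofReal_le_ofReal (hr ξ)
  · exact hG.lintegral_lt_top.ne
  · refine Eventually.of_forall fun ξ => ?_
    have h : Tendsto (fun r => v ξ * ‖F r ξ‖ ^ 2) l (𝓝 0) := by
      simpa using (((hlim ξ).norm).pow 2).const_mul (v ξ)
    simpa using ENNReal.tendsto_ofReal h

theorem norm_sub_sq_le (a b : ℂ) : ‖a - b‖ ^ 2 ≤ 2 * ‖a‖ ^ 2 + 2 * ‖b‖ ^ 2 := by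
  have h := norm_sub_le a b
  nlinarith [norm_nonneg (a - b), norm_nonneg a, norm_nonneg b, sq_nonneg (‖a‖ - ‖b‖)]

theorem tendsto_lintegral_waveY (hd : IsWaveData μ m g₀ g₁) (hc : IsCoeff ν c T) {w : Ω → ℝ}
    (hw : Measurable w) (hw0 : ∀ ξ, 0 ≤ w ξ) (hInt : Integrable (fun ξ => w ξ * dataSize m g₀ g₁ ξ) μ)
    {t : ℝ} (ht : t ∈ Icc 0 T) :
    Tendsto (fun r => ∫⁻ ξ, ENNReal.ofReal (w ξ * m ξ ^ 2) *
      ‖waveY m g₀ g₁ c r ξ - waveY m g₀ g₁ c t ξ‖ₑ ^ 2 ∂μ) (𝓝[Icc 0 T] t) (𝓝 0) := by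
  obtain ⟨C, hC0, hC⟩ := exists_norm_sq_le hc m g₀ g₁
  refine tendsto_lintegral_mul_enorm_sq (hw.mul (hd.measurable.pow_const 2))
    (fun ξ => mul_nonneg (hw0 ξ) (sq_nonneg _)) (hInt.const_mul (4 * C)) ?_ ?_ ?_
  · filter_upwards [self_mem_nhdsWithin] with r hr
    exact (aestronglyMeasurable_waveY hd hc hr).sub (aestronglyMeasurable_waveY hd hc ht)
  · filter_upwards [self_mem_nhdsWithin] with r hr ξ
    have h1 := (hC r hr ξ).1
    have h2 := (hC t ht ξ).1
    have h3 := mul_le_mul_of_nonneg_left (norm_sub_sq_le (waveY m g₀ g₁ c r ξ) (waveY m g₀ g₁ c t ξ))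
      (sq_nonneg (m ξ))
    have h4 : m ξ ^ 2 * ‖waveY m g₀ g₁ c r ξ - waveY m g₀ g₁ c t ξ‖ ^ 2 ≤
      4 * C * dataSize m g₀ g₁ ξ := by linarith
    calc _ = w ξ * (m ξ ^ 2 * ‖waveY m g₀ g₁ c r ξ - waveY m g₀ g₁ c t ξ‖ ^ 2) := by ring
      _ ≤ w ξ * (4 * C * dataSize m g₀ g₁ ξ) := mul_le_mul_of_nonneg_left h4 (hw0 ξ)
      _ = _ := by ring
  · intro ξ
    have h := (hasDerivWithinAt_waveY hc (m := m) (g₀ := g₀) (g₁ := g₁) ξ ht).continuousWithinAt.tendsto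
    simpa using h.sub_const (waveY m g₀ g₁ c t ξ)

theorem tendsto_lintegral_waveZ (hd : IsWaveData μ m g₀ g₁) (hc : IsCoeff ν c T) {w : Ω → ℝ}
    (hw : Measurable w) (hw0 : ∀ ξ, 0 ≤ w ξ) (hInt : Integrable (fun ξ => w ξ * dataSize m g₀ g₁ ξ) μ)
    {t : ℝ} (ht : t ∈ Icc 0 T) :
    Tendsto (fun r => ∫⁻ ξ, ENNReal.ofReal (w ξ) *
      ‖waveZ m g₀ g₁ c r ξ - waveZ m g₀ g₁ c t ξ‖ₑ ^ 2 ∂μ) (𝓝[Icc 0 T] t) (𝓝 0) := by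
  obtain ⟨C, hC0, hC⟩ := exists_norm_sq_le hc m g₀ g₁
  refine tendsto_lintegral_mul_enorm_sq hw hw0 (hInt.const_mul (4 * C)) ?_ ?_ ?_
  · filter_upwards [self_mem_nhdsWithin] with r hr
    exact (aestronglyMeasurable_waveZ hd hc hr).sub (aestronglyMeasurable_waveZ hd hc ht)
  · filter_upwards [self_mem_nhdsWithin] with r hr ξ
    have h1 := (hC r hr ξ).2
    have h2 := (hC t ht ξ).2
    have h3 := norm_sub_sq_le (waveZ m g₀ g₁ c r ξ) (waveZ m g₀ g₁ c t ξ)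
    calc _ ≤ w ξ * (4 * C * dataSize m g₀ g₁ ξ) :=
          mul_le_mul_of_nonneg_left (by linarith) (hw0 ξ)
      _ = _ := by ring
  · intro ξ
    have h := (hasDerivWithinAt_waveZ hc (m := m) (g₀ := g₀) (g₁ := g₁) ξ ht).continuousWithinAt.tendsto
    simpa using h.sub_const (waveZ m g₀ g₁ c t ξ)

theorem tendsto_lintegral_waveY_slope (hd : IsWaveData μ m g₀ g₁) (hc : IsCoeff ν c T) {w : Ω → ℝ}
    (hw : Measurable w) (hw0 : ∀ ξ, 0 ≤ w ξ) (hInt : Integrable (fun ξ => w ξ * dataSize m g₀ g₁ ξ) μ)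
    {t : ℝ} (ht : t ∈ Icc 0 T) :
    Tendsto (fun r => ∫⁻ ξ, ENNReal.ofReal (w ξ) * ‖((r - t : ℝ) : ℂ)⁻¹ *
      (waveY m g₀ g₁ c r ξ - waveY m g₀ g₁ c t ξ) - waveZ m g₀ g₁ c t ξ‖ₑ ^ 2 ∂μ)
      (𝓝[Icc 0 T \ {t}] t) (𝓝 0) := by
  obtain ⟨C, hC0, hC⟩ := exists_norm_sq_le hc m g₀ g₁
  obtain ⟨C', hC'0, hC'⟩ := exists_norm_waveY_sub_sq_le hc m g₀ g₁
  refine tendsto_lintegral_mul_enorm_sq hw hw0 (hInt.const_mul (2 * C' + 2 * C)) ?_ ?_ ?_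
  · filter_upwards [self_mem_nhdsWithin] with r hr
    exact (((aestronglyMeasurable_waveY hd hc hr.1).sub
      (aestronglyMeasurable_waveY hd hc ht)).const_mul _).sub (aestronglyMeasurable_waveZ hd hc ht)
  · filter_upwards [self_mem_nhdsWithin] with r hr ξ
    have hne : (r - t) ^ 2 ≠ 0 := pow_ne_zero 2 (sub_ne_zero.mpr hr.2)
    have h2 := (hC t ht ξ).2
    have h3 := norm_sub_sq_le (((r - t : ℝ) : ℂ)⁻¹ * (waveY m g₀ g₁ c r ξ - waveY m g₀ g₁ c t ξ))
      (waveZ m g₀ g₁ c t ξ)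
    have h4 : ‖((r - t : ℝ) : ℂ)⁻¹ * (waveY m g₀ g₁ c r ξ - waveY m g₀ g₁ c t ξ)‖ ^ 2 ≤
        C' * dataSize m g₀ g₁ ξ := by
      rw [norm_mul, norm_inv, Complex.norm_real, mul_pow, inv_pow, Real.norm_eq_abs, sq_abs]
      calc _ ≤ ((r - t) ^ 2)⁻¹ * (C' * dataSize m g₀ g₁ ξ * (r - t) ^ 2) :=
            mul_le_mul_of_nonneg_left (hC' r hr.1 t ht ξ) (by positivity)
        _ = _ := by rw [mul_comm (C' * _), inv_mul_cancel_left₀ hne]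
    calc _ ≤ w ξ * ((2 * C' + 2 * C) * dataSize m g₀ g₁ ξ) :=
          mul_le_mul_of_nonneg_left (by linarith) (hw0 ξ)
      _ = _ := by ring
  · intro ξ
    have h := (hasDerivWithinAt_waveY hc (m := m) (g₀ := g₀) (g₁ := g₁) ξ ht)
    rw [hasDerivWithinAt_iff_tendsto_slope] at h
    have h' := h.sub_const (waveZ m g₀ g₁ c t ξ)
    rw [sub_self] at h'
    refine h'.congr fun r => ?_
    rw [slope_def_module, Complex.real_smul, Complex.ofReal_inv]

theorem lintegral_waveY_lt_top (hd : IsWaveData μ m g₀ g₁) (hc : IsCoeff ν c T) {w : Ω → ℝ}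
    (hw : Measurable w) (hw0 : ∀ ξ, 0 ≤ w ξ) (hInt : Integrable (fun ξ => w ξ * dataSize m g₀ g₁ ξ) μ)
    {t : ℝ} (ht : t ∈ Icc 0 T) :
    ∫⁻ ξ, ENNReal.ofReal (w ξ * m ξ ^ 2) * ‖waveY m g₀ g₁ c t ξ‖ₑ ^ 2 ∂μ < ∞ := by
  refine lt_of_eq_of_lt (lintegral_congr fun ξ => ?_)
    (integrable_waveY_sq hd hc hw hw0 hInt ht).lintegral_lt_top
  rw [← mul_assoc, ENNReal.ofReal_mul (mul_nonneg (hw0 ξ) (sq_nonneg _)),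
    ENNReal.ofReal_pow (norm_nonneg _), ofReal_norm]

theorem lintegral_waveZ_lt_top (hd : IsWaveData μ m g₀ g₁) (hc : IsCoeff ν c T) {w : Ω → ℝ}
    (hw : Measurable w) (hw0 : ∀ ξ, 0 ≤ w ξ) (hInt : Integrable (fun ξ => w ξ * dataSize m g₀ g₁ ξ) μ)
    {t : ℝ} (ht : t ∈ Icc 0 T) :
    ∫⁻ ξ, ENNReal.ofReal (w ξ) * ‖waveZ m g₀ g₁ c t ξ‖ₑ ^ 2 ∂μ < ∞ := by
  refine lt_of_eq_of_lt (lintegral_congr fun ξ => ?_)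
    (integrable_waveZ_sq hd hc hw hw0 hInt ht).lintegral_lt_top
  rw [ENNReal.ofReal_mul (hw0 ξ), ENNReal.ofReal_pow (norm_nonneg _), ofReal_norm]

theorem lintegral_waveY_sub_lt_top (hc : IsCoeff ν c T) {w : Ω → ℝ}
    (hw0 : ∀ ξ, 0 ≤ w ξ) (hInt : Integrable (fun ξ => w ξ * dataSize m g₀ g₁ ξ) μ)
    {s t : ℝ} (hs : s ∈ Icc 0 T) (ht : t ∈ Icc 0 T) :
    ∫⁻ ξ, ENNReal.ofReal (w ξ) * ‖waveY m g₀ g₁ c s ξ - waveY m g₀ g₁ c t ξ‖ₑ ^ 2 ∂μ < ∞ := by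
  obtain ⟨C, hC0, hC⟩ := exists_norm_waveY_sub_sq_le hc m g₀ g₁
  refine lt_of_le_of_lt (lintegral_mono fun ξ => ?_)
    (hInt.const_mul (C * (s - t) ^ 2)).lintegral_lt_top
  rw [← ofReal_norm, ← ENNReal.ofReal_pow (norm_nonneg _), ← ENNReal.ofReal_mul (hw0 ξ)]
  refine ENNReal.ofReal_le_ofReal ?_
  calc _ ≤ w ξ * (C * dataSize m g₀ g₁ ξ * (s - t) ^ 2) :=
        mul_le_mul_of_nonneg_left (hC s hs t ht ξ) (hw0 ξ)
    _ = _ := by ring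

end Limits

/-! ### The linear flow as a curve of tempered distributions. -/

/-- The angular frequency. -/
def freq (ξ : Rn n) : ℝ := 2 * Real.pi * ‖ξ‖

theorem measurable_freq : Measurable (freq : Rn n → ℝ) := measurable_norm.const_mul _

theorem freq_nonneg (ξ : Rn n) : 0 ≤ freq ξ := by unfold freq; positivity

theorem one_le_freq {ξ : Rn n} (h : 1 < ‖ξ‖) : 1 ≤ freq ξ := by
  unfold freq
  nlinarith [Real.pi_gt_three]

theorem isTemperedFn_of_lintegral_lt_top {g : Rn n → ℂ} (hg : LocallyIntegrable g volume)
    {v : Rn n → ℝ} (hv : ∀ ξ, 1 < ‖ξ‖ → 1 ≤ v ξ)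
    (h : ∫⁻ ξ, ENNReal.ofReal (v ξ) * ‖g ξ‖ₑ ^ 2 < ∞) : IsTemperedFn g := by
  refine ⟨hg, lt_of_le_of_lt (setLIntegral_mono' measurableSet_one_lt_norm
    (g := fun ξ => ENNReal.ofReal (v ξ) * ‖g ξ‖ₑ ^ 2) fun ξ hξ => ?_)
    ((setLIntegral_le_lintegral _ _).trans_lt h)⟩
  calc ‖g ξ‖ₑ ^ 2 = 1 * ‖g ξ‖ₑ ^ 2 := (one_mul _).symm
    _ ≤ _ := by gcongr; exact ENNReal.one_le_ofReal.mpr (hv ξ hξ)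

theorem integrable_pow_mul_norm_sq (Θ : 𝓢(Rn n, ℂ)) (k : ℕ) :
    Integrable (fun ξ => freq ξ ^ k * ‖Θ ξ‖ ^ 2) volume := by
  set B := ‖Θ.toBoundedContinuousFunction‖
  have hB' : ∀ ξ, ‖Θ ξ‖ ≤ B := fun ξ => Θ.toBoundedContinuousFunction.norm_coe_le_norm ξ
  refine (((Θ.integrable_pow_mul volume k).const_mul ((2 * Real.pi) ^ k * B))).mono' ?_ ?_
  · exact ((measurable_freq.pow_const k).aestronglyMeasurable).mul
      (Θ.continuous.norm.pow 2).aestronglyMeasurable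
  · refine Eventually.of_forall fun ξ => ?_
    have hf := freq_nonneg ξ
    rw [Real.norm_of_nonneg (by positivity)]
    calc freq ξ ^ k * ‖Θ ξ‖ ^ 2 = freq ξ ^ k * ‖Θ ξ‖ * ‖Θ ξ‖ := by ring
      _ ≤ freq ξ ^ k * ‖Θ ξ‖ * B := mul_le_mul_of_nonneg_left (hB' ξ) (by positivity)
      _ = _ := by unfold freq; rw [mul_pow]; ring

section Flow

variable {g₀ g₁ : Rn n → ℂ} {c : ℝ → ℝ} {T ν : ℝ}

theorem memLp_of_sq_le {Ω : Type*} [MeasurableSpace Ω] {μ : Measure Ω} {f : Ω → ℂ} {G : Ω → ℝ}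
    (hf : AEStronglyMeasurable f μ) (hG : Integrable G μ) (h : ∀ ξ, ‖f ξ‖ ^ 2 ≤ G ξ) : MemLp f 2 μ := by
  refine memLp_two_of_lintegral_sq_lt_top hf
    (lt_of_le_of_lt (lintegral_mono fun ξ => ?_) hG.lintegral_lt_top)
  rw [← ofReal_norm, ← ENNReal.ofReal_pow (norm_nonneg _)]
  exact ENNReal.ofReal_le_ofReal (h ξ)

theorem isTemperedFn_waveZ (hd : IsWaveData volume freq g₀ g₁) (hc : IsCoeff ν c T) {t : ℝ}
    (ht : t ∈ Icc 0 T) : IsTemperedFn (waveZ freq g₀ g₁ c t) := by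
  obtain ⟨C, hC0, hC⟩ := exists_norm_sq_le hc freq g₀ g₁
  have h := memLp_of_sq_le (aestronglyMeasurable_waveZ hd hc ht) (hd.int.const_mul C)
    fun ξ => (hC t ht ξ).2
  refine isTemperedFn_of_lintegral_lt_top (h.locallyIntegrable (by norm_num)) (v := fun _ => 1)
    (fun _ _ => le_rfl) ?_
  simpa using lintegral_waveZ_lt_top hd hc (w := fun _ => 1) measurable_const (fun _ => zero_le_one)
    (by simpa using hd.int) ht

/-- For `n ≤ 2`, integrability of `m² |y|²` does not make `y` integrable near the origin. Local
integrability comes instead from `y(t) = (y(t) - y(0)) + g₀`, whose first summand is in `L²`. -/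
theorem isTemperedFn_waveY (hd : IsWaveData volume freq g₀ g₁) (hg₀ : LocallyIntegrable g₀ volume)
    (hc : IsCoeff ν c T) {t : ℝ} (ht : t ∈ Icc 0 T) : IsTemperedFn (waveY freq g₀ g₁ c t) := by
  obtain ⟨C, hC0, hC⟩ := exists_norm_waveY_sub_sq_le hc freq g₀ g₁
  have h0 : (0 : ℝ) ∈ Icc 0 T := ⟨le_rfl, ht.1.trans ht.2⟩
  have h := memLp_of_sq_le ((aestronglyMeasurable_waveY hd hc ht).sub
    (aestronglyMeasurable_waveY hd hc h0)) (hd.int.const_mul (C * (t - 0) ^ 2))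
    fun ξ => (hC t ht 0 h0 ξ).trans_eq (by ring)
  have hl := (h.locallyIntegrable (by norm_num)).add hg₀
  refine isTemperedFn_of_lintegral_lt_top (v := fun ξ => 1 * freq ξ ^ 2) (hl.congr ?_)
    (fun ξ hξ => ?_) ?_
  · refine Eventually.of_forall fun ξ => ?_
    simp [waveY_zero]
  · have := one_le_freq hξ
    simp only [one_mul]
    nlinarith
  · exact lintegral_waveY_lt_top hd hc (w := fun _ => 1) measurable_const (fun _ => zero_le_one)
      (by simpa using hd.int) ht

/-- The wave equation in the sense of distributions, on the Fourier side. -/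
theorem hasDerivAt_integral_mul_waveZ (hd : IsWaveData volume freq g₀ g₁) (hc : IsCoeff ν c T)
    (Θ : 𝓢(Rn n, ℂ)) {t : ℝ} (ht : t ∈ Ioo 0 T) :
    HasDerivAt (fun r => ∫ ξ, Θ ξ * waveZ freq g₀ g₁ c r ξ)
      (∫ ξ, Θ ξ * (((-(freq ξ ^ 2 * c t) : ℝ) : ℂ) * waveY freq g₀ g₁ c t ξ)) t := by
  obtain ⟨C, hC0, hC⟩ := exists_norm_sq_le hc freq g₀ g₁
  obtain ⟨M, hM⟩ := isCompact_Icc.exists_bound_of_continuousOn hc.continuousOn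
  have ht' : t ∈ Icc 0 T := Ioo_subset_Icc_self ht
  have hZ : Integrable (fun ξ => Θ ξ * waveZ freq g₀ g₁ c t ξ) volume := by
    obtain ⟨f, hf⟩ := (isTemperedFn_waveZ hd hc ht').exists_hasFourierFunction
    exact (hf.fourier_apply (isTemperedFn_waveZ hd hc ht') Θ).1
  refine (hasDerivAt_integral_of_dominated_loc_of_deriv_le (s := Ioo 0 T)
    (F' := fun r ξ => Θ ξ * (((-(freq ξ ^ 2 * c r) : ℝ) : ℂ) * waveY freq g₀ g₁ c r ξ))
    (bound := fun ξ => M * (freq ξ ^ 2 * ‖Θ ξ‖ ^ 2 + C * dataSize freq g₀ g₁ ξ))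
    (Ioo_mem_nhds ht.1 ht.2) ?_ hZ ?_ ?_ ?_ ?_).2
  · filter_upwards [Ioo_mem_nhds ht.1 ht.2] with r hr
    exact Θ.continuous.aestronglyMeasurable.mul
      (aestronglyMeasurable_waveZ hd hc (Ioo_subset_Icc_self hr))
  · refine Θ.continuous.aestronglyMeasurable.mul (AEStronglyMeasurable.mul ?_
      (aestronglyMeasurable_waveY hd hc ht'))
    exact (Complex.measurable_ofReal.comp
      (((measurable_freq.pow_const 2).mul_const _).neg)).aestronglyMeasurable
  · refine Eventually.of_forall fun ξ r hr => ?_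
    have h1 := (hC r (Ioo_subset_Icc_self hr) ξ).1
    have h2 := hM r (Ioo_subset_Icc_self hr)
    have hf := freq_nonneg ξ
    have hM0 : 0 ≤ M := (norm_nonneg _).trans h2
    rw [norm_mul, norm_mul, Complex.norm_real, norm_neg, norm_mul, Real.norm_of_nonneg (sq_nonneg _)]
    have h3 : freq ξ ^ 2 * (‖Θ ξ‖ * ‖waveY freq g₀ g₁ c r ξ‖) ≤
        freq ξ ^ 2 * ‖Θ ξ‖ ^ 2 + C * dataSize freq g₀ g₁ ξ := by
      refine le_trans ?_ (add_le_add le_rfl h1)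
      rw [← mul_add]
      refine mul_le_mul_of_nonneg_left ?_ (sq_nonneg _)
      nlinarith [sq_nonneg (‖Θ ξ‖ - ‖waveY freq g₀ g₁ c r ξ‖), norm_nonneg (Θ ξ),
        norm_nonneg (waveY freq g₀ g₁ c r ξ), mul_nonneg (norm_nonneg (Θ ξ))
        (norm_nonneg (waveY freq g₀ g₁ c r ξ))]
    calc _ = ‖c r‖ * (freq ξ ^ 2 * (‖Θ ξ‖ * ‖waveY freq g₀ g₁ c r ξ‖)) := by ring
      _ ≤ M * _ := mul_le_mul h2 h3 (by positivity) hM0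
  · exact ((integrable_pow_mul_norm_sq Θ 2).add (hd.int.const_mul C)).const_mul M
  · refine Eventually.of_forall fun ξ r hr => ?_
    exact ((hasDerivWithinAt_waveZ hc ξ (Ioo_subset_Icc_self hr)).hasDerivAt
      (Icc_mem_nhds hr.1 hr.2)).const_mul _

end Flow

/-- The pair `(u, v)` is the solution, with wave speed `c`, of the linear wave equation whose data have
the Fourier transforms `g₀` and `g₁`. -/
def IsFlow (g₀ g₁ : Rn n → ℂ) (c : ℝ → ℝ) (T : EReal) (u v : ℝ → 𝓢'(Rn n, ℂ)) : Prop :=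
  ∀ t ∈ timeInterval T, HasFourierFunction (u t) (waveY freq g₀ g₁ c t) ∧
    HasFourierFunction (v t) (waveZ freq g₀ g₁ c t)

theorem zero_mem_timeInterval {T : EReal} {t : ℝ} (ht : t ∈ timeInterval T) : 0 ∈ timeInterval T :=
  ⟨le_rfl, lt_of_le_of_lt (EReal.coe_le_coe_iff.mpr ht.1) ht.2⟩

theorem Icc_subset_timeInterval {T : EReal} {b : ℝ} (hb : b ∈ timeInterval T) :
    Icc 0 b ⊆ timeInterval T :=
  fun _ hx => ⟨hx.1, lt_of_le_of_lt (EReal.coe_le_coe_iff.mpr hx.2) hb.2⟩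

theorem exists_mem_timeInterval_gt {T : EReal} {t : ℝ} (ht : t ∈ timeInterval T) :
    ∃ b ∈ timeInterval T, t < b := by
  obtain ⟨b, h1, h2⟩ := EReal.lt_iff_exists_real_btwn.mp ht.2
  have h1' : t < b := EReal.coe_lt_coe_iff.mp h1
  exact ⟨b, ⟨ht.1.trans h1'.le, h2⟩, h1'⟩

theorem nhdsWithin_timeInterval_le {T : EReal} {t b : ℝ} (htb : t < b) :
    𝓝[timeInterval T] t ≤ 𝓝[Icc 0 b] t := by
  refine nhdsWithin_le_iff.mpr ?_
  filter_upwards [self_mem_nhdsWithin, nhdsWithin_le_nhds (Iio_mem_nhds htb)] with r hr hr'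
  exact ⟨hr.1, le_of_lt hr'⟩

theorem nhdsWithin_timeInterval_diff_le {T : EReal} {t b : ℝ} (htb : t < b) :
    𝓝[timeInterval T \ {t}] t ≤ 𝓝[Icc 0 b \ {t}] t := by
  refine nhdsWithin_le_iff.mpr ?_
  filter_upwards [self_mem_nhdsWithin, nhdsWithin_le_nhds (Iio_mem_nhds htb)] with r hr hr'
  exact ⟨⟨hr.1.1, le_of_lt hr'⟩, hr.2⟩

section IsFlow

variable {g₀ g₁ : Rn n → ℂ} {c : ℝ → ℝ} {T : EReal} {ν : ℝ} {u v : ℝ → 𝓢'(Rn n, ℂ)}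

theorem exists_isFlow (hd : IsWaveData volume freq g₀ g₁) (hg₀ : LocallyIntegrable g₀ volume)
    (hc : ∀ b ∈ timeInterval T, IsCoeff ν c b) : ∃ u v : ℝ → 𝓢'(Rn n, ℂ), IsFlow g₀ g₁ c T u v := by
  have h : ∀ t : ℝ, ∃ p : 𝓢'(Rn n, ℂ) × 𝓢'(Rn n, ℂ), t ∈ timeInterval T →
      HasFourierFunction p.1 (waveY freq g₀ g₁ c t) ∧ HasFourierFunction p.2 (waveZ freq g₀ g₁ c t) := by
    intro t
    by_cases ht : t ∈ timeInterval T
    · obtain ⟨f, hf⟩ := (isTemperedFn_waveY hd hg₀ (hc t ht) ⟨ht.1, le_rfl⟩).exists_hasFourierFunction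
      obtain ⟨g, hg⟩ := (isTemperedFn_waveZ hd (hc t ht) ⟨ht.1, le_rfl⟩).exists_hasFourierFunction
      exact ⟨(f, g), fun _ => ⟨hf, hg⟩⟩
    · exact ⟨(0, 0), fun h => absurd h ht⟩
  choose p hp using h
  exact ⟨fun t => (p t).1, fun t => (p t).2, fun t ht => hp t ht⟩

theorem IsFlow.init (h : IsFlow g₀ g₁ c T u v) (hT : 0 ∈ timeInterval T) {u₀ u₁ : 𝓢'(Rn n, ℂ)}
    (h₀ : HasFourierFunction u₀ g₀) (h₁ : HasFourierFunction u₁ g₁) : u 0 = u₀ ∧ v 0 = u₁ := by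
  have h2 := h 0 hT
  exact ⟨(h2.1.congr (Eventually.of_forall (waveY_zero _ _ _ _))).ext h₀,
    (h2.2.congr (Eventually.of_forall (waveZ_zero _ _ _ _))).ext h₁⟩

theorem IsFlow.isC0Curve (h : IsFlow g₀ g₁ c T u v) (hd : IsWaveData volume freq g₀ g₁)
    (hc : ∀ b ∈ timeInterval T, IsCoeff ν c b) {w : Rn n → ℝ} (hw : Measurable w)
    (hw0 : ∀ ξ, 0 ≤ w ξ) (hInt : Integrable (fun ξ => w ξ * dataSize freq g₀ g₁ ξ) volume) :
    IsC0Curve (fourierNormSq fun ξ => w ξ * freq ξ ^ 2) T u where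
  mem t ht := by
    rw [(h t ht).1.fourierNormSq_eq]
    exact lintegral_waveY_lt_top hd (hc t ht) hw hw0 hInt ⟨ht.1, le_rfl⟩
  continuous t ht := by
    obtain ⟨b, hb, htb⟩ := exists_mem_timeInterval_gt ht
    refine ((tendsto_lintegral_waveY hd (hc b hb) hw hw0 hInt ⟨ht.1, htb.le⟩).mono_left
      (nhdsWithin_timeInterval_le htb)).congr' ?_
    filter_upwards [self_mem_nhdsWithin] with r hr
    rw [((h r hr).1.sub (h t ht).1).fourierNormSq_eq]

theorem IsFlow.isC1Curve (h : IsFlow g₀ g₁ c T u v) (hd : IsWaveData volume freq g₀ g₁)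
    (hc : ∀ b ∈ timeInterval T, IsCoeff ν c b) {w : Rn n → ℝ} (hw : Measurable w)
    (hw0 : ∀ ξ, 0 ≤ w ξ) (hInt : Integrable (fun ξ => w ξ * dataSize freq g₀ g₁ ξ) volume) :
    IsC1Curve (fourierNormSq w) T (fun t => u t - u 0) v where
  mem t ht := by
    rw [((h t ht).1.sub (h 0 (zero_mem_timeInterval ht)).1).fourierNormSq_eq]
    exact lintegral_waveY_sub_lt_top (hc t ht) hw0 hInt ⟨ht.1, le_rfl⟩ ⟨le_rfl, ht.1⟩
  hasDeriv t ht := by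
    obtain ⟨b, hb, htb⟩ := exists_mem_timeInterval_gt ht
    refine ((tendsto_lintegral_waveY_slope hd (hc b hb) hw hw0 hInt ⟨ht.1, htb.le⟩).mono_left
      (nhdsWithin_timeInterval_diff_le htb)).congr' ?_
    filter_upwards [self_mem_nhdsWithin] with r hr
    rw [sub_sub_sub_cancel_right,
      ((((h r hr.1).1.sub (h t ht).1).const_smul _).sub (h t ht).2).fourierNormSq_eq]
  deriv_isC0 :=
    { mem := fun t ht => by
        rw [(h t ht).2.fourierNormSq_eq]
        exact lintegral_waveZ_lt_top hd (hc t ht) hw hw0 hInt ⟨ht.1, le_rfl⟩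
      continuous := fun t ht => by
        obtain ⟨b, hb, htb⟩ := exists_mem_timeInterval_gt ht
        refine ((tendsto_lintegral_waveZ hd (hc b hb) hw hw0 hInt ⟨ht.1, htb.le⟩).mono_left
          (nhdsWithin_timeInterval_le htb)).congr' ?_
        filter_upwards [self_mem_nhdsWithin] with r hr
        rw [((h r hr).2.sub (h t ht).2).fourierNormSq_eq] }

theorem IsFlow.gradNormSq_eq (h : IsFlow g₀ g₁ c T u v) (hd : IsWaveData volume freq g₀ g₁)
    (hc : ∀ b ∈ timeInterval T, IsCoeff ν c b) {t : ℝ} (ht : t ∈ timeInterval T) :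
    gradNormSq (u t) = ENNReal.ofReal (waveGrad volume freq g₀ g₁ c t) := by
  rw [(h t ht).1.gradNormSq_eq, waveGrad, ofReal_integral_eq_lintegral_ofReal
    (integrable_waveGrad hd (hc t ht) ⟨ht.1, le_rfl⟩) (Eventually.of_forall fun ξ => by positivity)]
  refine lintegral_congr fun ξ => ?_
  rw [ENNReal.ofReal_mul (sq_nonneg _), ENNReal.ofReal_pow (norm_nonneg _), ofReal_norm, freq]

theorem IsFlow.equation (h : IsFlow g₀ g₁ c T u v) (hd : IsWaveData volume freq g₀ g₁)
    (hg₀ : LocallyIntegrable g₀ volume) (hc : ∀ b ∈ timeInterval T, IsCoeff ν c b) {t : ℝ}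
    (ht : t ∈ timeInterval T) (ht0 : 0 < t) (ψ : 𝓢(Rn n, ℂ)) :
    HasDerivAt (fun r => v r ψ) ((c t : ℂ) * (Δ (u t)) ψ) t := by
  obtain ⟨b, hb, htb⟩ := exists_mem_timeInterval_gt ht
  have h1 := hasDerivAt_integral_mul_waveZ hd (hc b hb) (𝓕⁻ ψ) ⟨ht0, htb⟩
  have h2 := h1.congr_of_eventuallyEq (f₁ := fun r => v r ψ) (by
    filter_upwards [Ioo_mem_nhds ht0 htb] with r hr
    have hr' := Icc_subset_timeInterval hb (Ioo_subset_Icc_self hr)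
    exact (h r hr').2.apply_eq (isTemperedFn_waveZ hd (hc b hb) (Ioo_subset_Icc_self hr)) ψ)
  refine h2.congr_deriv ?_
  rw [(h t ht).1.laplacian_apply (isTemperedFn_waveY hd hg₀ (hc t ht) ⟨ht.1, le_rfl⟩),
    ← integral_const_mul]
  refine integral_congr_ae (Eventually.of_forall fun ξ => ?_)
  simp only [freq]
  push_cast
  ring

end IsFlow

/-! ### Uniqueness for a hierarchy of scalar equations. -/

theorem norm_le_of_norm_deriv_le_pow {h h' : ℝ → ℂ} {b K : ℝ} {j : ℕ} (hh : ContinuousOn h (Icc 0 b))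
    (hh' : ContinuousOn h' (Icc 0 b)) (hd : ∀ t ∈ Ioo 0 b, HasDerivAt h (h' t) t) (h0 : h 0 = 0)
    (hK : ∀ t ∈ Icc 0 b, ‖h' t‖ ≤ K * t ^ j) {t : ℝ} (ht : t ∈ Icc 0 b) :
    ‖h t‖ ≤ K * (t ^ (j + 1) / (j + 1)) := by
  have hsub : Icc 0 t ⊆ Icc 0 b := Icc_subset_Icc_right ht.2
  have hInt := intervalIntegral.integral_eq_sub_of_hasDerivAt_of_le ht.1 (hh.mono hsub)
    (fun x hx => hd x ⟨hx.1, hx.2.trans_le ht.2⟩)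
    ((hh'.mono hsub).intervalIntegrable_of_Icc ht.1)
  rw [h0, sub_zero] at hInt
  rw [← hInt]
  refine (intervalIntegral.norm_integral_le_of_norm_le ht.1 (g := fun x => K * x ^ j)
    (Eventually.of_forall fun x hx => hK x (hsub (Ioc_subset_Icc_self hx))) ?_).trans_eq ?_
  · exact (Continuous.intervalIntegrable (by fun_prop) _ _)
  · rw [intervalIntegral.integral_const_mul, integral_pow]
    simp

/-- Uniqueness for the hierarchy of the second order equations `f k'' = c f (k + 1)`. -/
theorem hierarchy_eq_zero {f g : ℕ → ℝ → ℂ} {c : ℝ → ℝ} {b A B : ℝ} (hA : 0 ≤ A) (hB : 0 ≤ B)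
    (hc : ContinuousOn c (Icc 0 b)) (hf : ∀ k, ContinuousOn (f k) (Icc 0 b))
    (hg : ∀ k, ContinuousOn (g k) (Icc 0 b)) (hf0 : ∀ k, f k 0 = 0) (hg0 : ∀ k, g k 0 = 0)
    (hf' : ∀ k, ∀ t ∈ Ioo 0 b, HasDerivAt (f k) (g k t) t)
    (hg' : ∀ k, ∀ t ∈ Ioo 0 b, HasDerivAt (g k) ((c t : ℂ) * f (k + 1) t) t)
    (hbd : ∀ k, ∀ t ∈ Icc 0 b, ‖f k t‖ ≤ A * B ^ k) {t : ℝ} (ht : t ∈ Icc 0 b) (k : ℕ) :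
    f k t = 0 := by
  obtain ⟨M, hM⟩ := isCompact_Icc.exists_bound_of_continuousOn hc
  have hM0 : 0 ≤ M := (norm_nonneg _).trans (hM t ht)
  have hb : 0 ≤ b := ht.1.trans ht.2
  -- Each use of the equation moves from `k` to `k + 1`, costing one factor `B`, and integrates
  -- twice. One integration feeds the factorial, the other is bounded by `b`. The bound tends to
  -- zero as `j → ∞` with `k` fixed.
  have key : ∀ j k : ℕ, ∀ t ∈ Icc 0 b,
      ‖f k t‖ ≤ A * B ^ k * (M * B * b) ^ j * (t ^ j / (j.factorial : ℝ)) := by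
    intro j
    induction j with
    | zero => intro k t ht; simpa using hbd k t ht
    | succ j ih =>
      intro k t ht
      have hg1 : ∀ t ∈ Icc 0 b, ‖g k t‖ ≤
          M * (A * B ^ (k + 1) * (M * B * b) ^ j / (j.factorial : ℝ)) * (t ^ (j + 1) / (j + 1)) := by
        intro t ht
        refine norm_le_of_norm_deriv_le_pow (hg k)
          ((Complex.continuous_ofReal.comp_continuousOn hc).mul (hf (k + 1))) (hg' k) (hg0 k) ?_ ht
        intro s hs
        calc ‖(c s : ℂ) * f (k + 1) s‖ = ‖c s‖ * ‖f (k + 1) s‖ := by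
              rw [norm_mul, Complex.norm_real]
          _ ≤ M * (A * B ^ (k + 1) * (M * B * b) ^ j * (s ^ j / (j.factorial : ℝ))) :=
              mul_le_mul (hM s hs) (ih (k + 1) s hs) (norm_nonneg _) hM0
          _ = _ := by ring_nf
      have hf1 := norm_le_of_norm_deriv_le_pow (j := 0)
        (K := M * (A * B ^ (k + 1) * (M * B * b) ^ j / (j.factorial : ℝ)) * (t ^ (j + 1) / (j + 1)))
        ((hf k).mono (Icc_subset_Icc_right ht.2)) ((hg k).mono (Icc_subset_Icc_right ht.2))
        (fun s hs => hf' k s ⟨hs.1, hs.2.trans_le ht.2⟩) (hf0 k) (fun s hs => by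
          refine (hg1 s ⟨hs.1, hs.2.trans ht.2⟩).trans ?_
          rw [pow_zero, mul_one]
          have := hs.1
          have := hs.2
          gcongr) (right_mem_Icc.mpr ht.1)
      refine hf1.trans ?_
      have ht0 := ht.1
      rw [Nat.factorial_succ]
      push_cast
      simp only [zero_add, pow_one, div_one]
      calc _ ≤ M * (A * B ^ (k + 1) * (M * B * b) ^ j / (j.factorial : ℝ)) * (t ^ (j + 1) / (j + 1)) * b :=
            mul_le_mul_of_nonneg_left ht.2 (by positivity)
        _ = _ := by field_simp; ring
  have hlim : Tendsto (fun j : ℕ => A * B ^ k * ((M * B * b * t) ^ j / (j.factorial : ℝ))) atTop (𝓝 0) := by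
    simpa using (FloorSemiring.tendsto_pow_div_factorial_atTop (M * B * b * t)).const_mul (A * B ^ k)
  refine norm_le_zero_iff.mp (ge_of_tendsto' hlim fun j => (key j k t ht).trans_eq ?_)
  rw [mul_pow (M * B * b) t j]
  ring

/-! ### Weighted norms realised in `L²`. -/

open Classical in
/-- The function `w^(1/2) 𝓕 f` as an element of `L²`. -/
def weightedFourier (w : Rn n → ℝ) (f : 𝓢'(Rn n, ℂ)) : Lp ℂ 2 (volume : Measure (Rn n)) :=
  if h : ∃ g, HasFourierFunction f g ∧ MemLp (fun ξ => ((√(w ξ) : ℝ) : ℂ) * g ξ) 2 volume then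
    h.choose_spec.2.toLp _ else 0

section WeightedFourier

variable {w : Rn n → ℝ} {f f' : 𝓢'(Rn n, ℂ)} {g : Rn n → ℂ}

theorem weightedFourier_eq (hg : HasFourierFunction f g)
    (hm : MemLp (fun ξ => ((√(w ξ) : ℝ) : ℂ) * g ξ) 2 volume) : weightedFourier w f = hm.toLp _ := by
  have h : ∃ g, HasFourierFunction f g ∧ MemLp (fun ξ => ((√(w ξ) : ℝ) : ℂ) * g ξ) 2 volume :=
    ⟨g, hg, hm⟩
  rw [weightedFourier, dif_pos h, MemLp.toLp_eq_toLp_iff]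
  filter_upwards [h.choose_spec.1.ae_eq hg] with ξ hξ
  rw [hξ]

theorem ofReal_mul_enorm_sq (hw0 : ∀ ξ, 0 ≤ w ξ) (g : Rn n → ℂ) (ξ : Rn n) :
    ENNReal.ofReal (w ξ) * ‖g ξ‖ₑ ^ 2 = ‖((√(w ξ) : ℝ) : ℂ) * g ξ‖ₑ ^ 2 := by
  rw [enorm_mul, mul_pow, ← ofReal_norm ((√(w ξ) : ℝ) : ℂ), ← ENNReal.ofReal_pow (norm_nonneg _),
    Complex.norm_real, Real.norm_of_nonneg (Real.sqrt_nonneg _), Real.sq_sqrt (hw0 ξ)]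

theorem HasFourierFunction.memLp_sqrt_mul (hw : Measurable w) (hw0 : ∀ ξ, 0 ≤ w ξ)
    (hg : HasFourierFunction f g) (h : fourierNormSq w f < ∞) :
    MemLp (fun ξ => ((√(w ξ) : ℝ) : ℂ) * g ξ) 2 volume := by
  refine memLp_two_of_lintegral_sq_lt_top ?_ ?_
  · exact (Complex.measurable_ofReal.comp hw.sqrt).aestronglyMeasurable.mul
      hg.1.aestronglyMeasurable
  · rw [hg.fourierNormSq_eq] at h
    simpa only [ofReal_mul_enorm_sq hw0 g] using h

theorem norm_weightedFourier (hw : Measurable w) (hw0 : ∀ ξ, 0 ≤ w ξ) (h : fourierNormSq w f < ∞) :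
    ‖weightedFourier w f‖ = √(fourierNormSq w f).toReal := by
  obtain ⟨g, hg⟩ := exists_hasFourierFunction_of_fourierNormSq_lt_top h
  have hm := hg.memLp_sqrt_mul hw hw0 h
  have h1 := enorm_toLp_sq hm
  simp only [← ofReal_mul_enorm_sq hw0 g] at h1
  rw [← hg.fourierNormSq_eq, ← weightedFourier_eq hg hm] at h1
  rw [← h1, ENNReal.toReal_pow, toReal_enorm, Real.sqrt_sq (norm_nonneg _)]

theorem weightedFourier_sub (hw : Measurable w) (hw0 : ∀ ξ, 0 ≤ w ξ) (h : fourierNormSq w f < ∞)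
    (h' : fourierNormSq w f' < ∞) : fourierNormSq w (f - f') < ∞ ∧
      weightedFourier w (f - f') = weightedFourier w f - weightedFourier w f' := by
  obtain ⟨g, hg⟩ := exists_hasFourierFunction_of_fourierNormSq_lt_top h
  obtain ⟨g', hg'⟩ := exists_hasFourierFunction_of_fourierNormSq_lt_top h'
  have hm := hg.memLp_sqrt_mul hw hw0 h
  have hm' := hg'.memLp_sqrt_mul hw hw0 h'
  have hfun : ((fun ξ => ((√(w ξ) : ℝ) : ℂ) * g ξ) - fun ξ => ((√(w ξ) : ℝ) : ℂ) * g' ξ) =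
      fun ξ => ((√(w ξ) : ℝ) : ℂ) * (g ξ - g' ξ) := by
    ext ξ; simp [mul_sub]
  have hs := hm.sub hm'
  rw [hfun] at hs
  constructor
  · rw [(hg.sub hg').fourierNormSq_eq]
    have h1 := enorm_toLp_sq hs
    simp only [← ofReal_mul_enorm_sq hw0 (fun ξ => g ξ - g' ξ)] at h1
    rw [← h1]
    exact ENNReal.pow_lt_top enorm_lt_top
  · rw [weightedFourier_eq hg hm, weightedFourier_eq hg' hm', weightedFourier_eq (hg.sub hg') hs,
      ← MemLp.toLp_sub, MemLp.toLp_eq_toLp_iff, hfun]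

theorem weightedFourier_smul (hw : Measurable w) (hw0 : ∀ ξ, 0 ≤ w ξ) (h : fourierNormSq w f < ∞)
    (a : ℂ) : fourierNormSq w (a • f) < ∞ ∧
      weightedFourier w (a • f) = a • weightedFourier w f := by
  obtain ⟨g, hg⟩ := exists_hasFourierFunction_of_fourierNormSq_lt_top h
  have hm := hg.memLp_sqrt_mul hw hw0 h
  have hfun : (a • fun ξ => ((√(w ξ) : ℝ) : ℂ) * g ξ) =
      fun ξ => ((√(w ξ) : ℝ) : ℂ) * (a * g ξ) := by
    ext ξ; simp [mul_left_comm]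
  have hs := hm.const_smul a
  rw [hfun] at hs
  constructor
  · rw [(hg.const_smul a).fourierNormSq_eq]
    have h1 := enorm_toLp_sq hs
    simp only [← ofReal_mul_enorm_sq hw0 (fun ξ => a * g ξ)] at h1
    rw [← h1]
    exact ENNReal.pow_lt_top enorm_lt_top
  · rw [weightedFourier_eq hg hm, weightedFourier_eq (hg.const_smul a) hs,
      ← MemLp.toLp_const_smul, MemLp.toLp_eq_toLp_iff, hfun]

variable {T : EReal} {d e : ℝ → 𝓢'(Rn n, ℂ)}

/-- Turns the convergence of square norms into continuity in a Hilbert space, where compactness and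
the mean value inequality are available. -/
theorem IsC0Curve.continuousOn (hw : Measurable w) (hw0 : ∀ ξ, 0 ≤ w ξ)
    (h : IsC0Curve (fourierNormSq w) T d) :
    ContinuousOn (fun t => weightedFourier w (d t)) (timeInterval T) := by
  intro t ht
  rw [ContinuousWithinAt, tendsto_iff_norm_sub_tendsto_zero]
  have h1 := ((ENNReal.tendsto_toReal ENNReal.zero_ne_top).comp (h.continuous t ht)).sqrt
  rw [ENNReal.toReal_zero, Real.sqrt_zero] at h1
  refine h1.congr' ?_
  filter_upwards [self_mem_nhdsWithin] with r hr
  have h2 := weightedFourier_sub hw hw0 (h.mem r hr) (h.mem t ht)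
  rw [← h2.2, norm_weightedFourier hw hw0 h2.1]
  rfl

theorem IsC1Curve.hasDerivWithinAt (hw : Measurable w) (hw0 : ∀ ξ, 0 ≤ w ξ)
    (h : IsC1Curve (fourierNormSq w) T d e) {t : ℝ} (ht : t ∈ timeInterval T) :
    HasDerivWithinAt (fun t => weightedFourier w (d t)) (weightedFourier w (e t)) (timeInterval T) t := by
  rw [hasDerivWithinAt_iff_tendsto_slope, tendsto_iff_norm_sub_tendsto_zero]
  have h1 := ((ENNReal.tendsto_toReal ENNReal.zero_ne_top).comp (h.hasDeriv t ht)).sqrt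
  rw [ENNReal.toReal_zero, Real.sqrt_zero] at h1
  refine h1.congr' ?_
  filter_upwards [self_mem_nhdsWithin] with r hr
  have h2 := weightedFourier_sub hw hw0 (h.mem r hr.1) (h.mem t ht)
  have h3 := weightedFourier_smul hw hw0 h2.1 (((r - t : ℝ) : ℂ)⁻¹)
  have h4 := weightedFourier_sub hw hw0 h3.1 (h.deriv_isC0.mem t ht)
  rw [slope_def_module, RCLike.real_smul_eq_coe_smul (K := ℂ), ← h2.2]
  have h5 : (((r - t)⁻¹ : ℝ) : ℂ) = ((r - t : ℝ) : ℂ)⁻¹ := Complex.ofReal_inv _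
  have h6 := norm_weightedFourier hw hw0 h4.1
  rw [h4.2, h3.2] at h6
  simp only [Function.comp]
  rw [← h6, ← h5]
  rfl

end WeightedFourier

/-! ### Uniqueness for the linear wave equation. -/

theorem sqrt_freq_pow (ξ : Rn n) : ((√(freq ξ) : ℝ) : ℂ) ^ 2 = ((freq ξ : ℝ) : ℂ) := by
  rw [← Complex.ofReal_pow, Real.sq_sqrt (freq_nonneg ξ)]

/-- The function that represents `f ↦ (Δ f) ψ` on the space with the weight `freq`. -/
def laplacianDual (ψ : 𝓢(Rn n, ℂ)) (ξ : Rn n) : ℂ :=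
  -(((√(freq ξ) : ℝ) : ℂ) ^ 3 * (starRingEnd ℂ) ((𝓕⁻ ψ) ξ))

theorem norm_laplacianDual_sq (ψ : 𝓢(Rn n, ℂ)) (ξ : Rn n) :
    ‖laplacianDual ψ ξ‖ ^ 2 = freq ξ ^ 3 * ‖(𝓕⁻ ψ) ξ‖ ^ 2 := by
  rw [laplacianDual, norm_neg, norm_mul, norm_pow, Complex.norm_real, RCLike.norm_conj,
    Real.norm_of_nonneg (Real.sqrt_nonneg _), mul_pow]
  congr 1
  rw [← pow_mul, mul_comm, pow_mul, Real.sq_sqrt (freq_nonneg ξ)]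

theorem memLp_laplacianDual (ψ : 𝓢(Rn n, ℂ)) : MemLp (laplacianDual ψ) 2 volume := by
  refine memLp_of_sq_le ?_ (integrable_pow_mul_norm_sq (𝓕⁻ ψ) 3)
    fun ξ => (norm_laplacianDual_sq ψ ξ).le
  refine (((Complex.measurable_ofReal.comp measurable_freq.sqrt).pow_const 3).aestronglyMeasurable.mul
    ?_).neg
  exact (Complex.continuous_conj.comp (𝓕⁻ ψ).continuous).aestronglyMeasurable

/-- The symbol `m²` is split as `m^{1/2} · m^{3/2}`: the first factor goes to `f`, the second to the
test function. -/
theorem laplacian_apply_eq_inner {f : 𝓢'(Rn n, ℂ)} (hf : fourierNormSq freq f < ∞)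
    (ψ : 𝓢(Rn n, ℂ)) :
    (Δ f) ψ = inner ℂ ((memLp_laplacianDual ψ).toLp _) (weightedFourier freq f) := by
  obtain ⟨g, hg⟩ := exists_hasFourierFunction_of_fourierNormSq_lt_top hf
  have hm := hg.memLp_sqrt_mul measurable_freq freq_nonneg hf
  have ht : IsTemperedFn g := isTemperedFn_of_lintegral_lt_top hg.1 (fun ξ => one_le_freq)
    (by rwa [← hg.fourierNormSq_eq])
  rw [hg.laplacian_apply ht, weightedFourier_eq hg hm, L2.inner_def]
  refine integral_congr_ae ?_
  filter_upwards [(memLp_laplacianDual ψ).coeFn_toLp, hm.coeFn_toLp] with ξ h1 h2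
  rw [h1, h2, RCLike.inner_apply, laplacianDual, map_neg, map_mul, map_pow, Complex.conj_ofReal,
    Complex.conj_conj]
  change -((freq ξ ^ 2 : ℝ) : ℂ) * _ * _ = _
  rw [Complex.ofReal_pow, ← sqrt_freq_pow]
  ring

theorem fourierInv_laplacian_iterate_apply (ψ : 𝓢(Rn n, ℂ)) (k : ℕ) (ξ : Rn n) :
    (𝓕⁻ ((fun χ : 𝓢(Rn n, ℂ) => Δ χ)^[k] ψ)) ξ = (-((freq ξ ^ 2 : ℝ) : ℂ)) ^ k * (𝓕⁻ ψ) ξ := by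
  induction k with
  | zero => simp
  | succ k ih =>
    rw [Function.iterate_succ_apply', fourierInv_laplacian_apply, ih, pow_succ, freq]
    ring_nf

/-- On bounded frequencies each further Laplacian costs only a constant factor. This is the
geometric bound that the hierarchy requires. -/
theorem norm_toLp_laplacianDual_le {ψ : 𝓢(Rn n, ℂ)} {B : ℝ}
    (hB : ∀ ξ, (𝓕⁻ ψ) ξ ≠ 0 → freq ξ ^ 2 ≤ B) (k : ℕ) :
    ‖(memLp_laplacianDual ((fun χ : 𝓢(Rn n, ℂ) => Δ χ)^[k] ψ)).toLp _‖ ≤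
      B ^ k * ‖(memLp_laplacianDual ψ).toLp _‖ := by
  refine Lp.norm_le_mul_norm_of_ae_le_mul ?_
  filter_upwards [(memLp_laplacianDual ((fun χ : 𝓢(Rn n, ℂ) => Δ χ)^[k] ψ)).coeFn_toLp,
    (memLp_laplacianDual ψ).coeFn_toLp] with ξ h1 h2
  rw [h1, h2, laplacianDual, laplacianDual, fourierInv_laplacian_iterate_apply]
  simp only [norm_neg, norm_mul, norm_pow, RCLike.norm_conj, Complex.norm_real]
  by_cases h : (𝓕⁻ ψ) ξ = 0
  · simp [h]
  · have := hB ξ h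
    rw [Real.norm_of_nonneg (freq_nonneg ξ)]
    calc _ = (freq ξ ^ 2) ^ k * (‖√(freq ξ)‖ ^ 3 * ‖(𝓕⁻ ψ) ξ‖) := by ring
      _ ≤ _ := by gcongr

/-- The hypothesis says that `m² g` vanishes almost everywhere, and the zero set of `m` is the
origin, a null set because `n ≥ 1`. -/
theorem eq_zero_of_laplacian_eq_zero (hn : 1 ≤ n) {f : 𝓢'(Rn n, ℂ)} (hf : fourierNormSq freq f < ∞)
    (h : ∀ ψ : 𝓢(Rn n, ℂ), HasCompactSupport (𝓕⁻ ψ : 𝓢(Rn n, ℂ)) → (Δ f) ψ = 0) : f = 0 := by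
  obtain ⟨g, hg⟩ := exists_hasFourierFunction_of_fourierNormSq_lt_top hf
  have ht : IsTemperedFn g := isTemperedFn_of_lintegral_lt_top hg.1 (fun ξ => one_le_freq)
    (by rwa [← hg.fourierNormSq_eq])
  have h0 : HasFourierFunction (0 : 𝓢'(Rn n, ℂ)) (fun _ => 0) :=
    ⟨locallyIntegrable_const 0, fun ψ _ => by
      rw [TemperedDistribution.fourier_apply]; simp⟩
  have h1 : HasFourierFunction (0 : 𝓢'(Rn n, ℂ)) (fun ξ => ((freq ξ ^ 2 : ℝ) : ℂ) * g ξ) := by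
    refine ⟨?_, fun Θ hΘ => ?_⟩
    · refine hg.1.continuous_mul (g := fun ξ => ((freq ξ ^ 2 : ℝ) : ℂ)) ?_
      unfold freq
      fun_prop
    · have h2 := h (𝓕 Θ) (by rwa [FourierTransform.fourierInv_fourier_eq])
      rw [hg.laplacian_apply ht, FourierTransform.fourierInv_fourier_eq] at h2
      rw [h0.2 Θ hΘ]
      simp only [mul_zero, integral_zero]
      rw [← neg_eq_zero, ← integral_neg] at h2
      rw [← h2]
      refine integral_congr_ae (Eventually.of_forall fun ξ => ?_)
      simp only [freq]
      ring
  have : Nontrivial (Rn n) := by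
    have : Nonempty (Fin n) := ⟨⟨0, hn⟩⟩
    infer_instance
  have hz : ∀ᵐ ξ : Rn n, ξ ≠ 0 := by simp [ae_iff]
  have h2 : g =ᵐ[volume] fun _ => 0 := by
    filter_upwards [h1.ae_eq h0, hz] with ξ hξ hξ0
    have : (freq ξ : ℂ) ≠ 0 := by
      rw [Complex.ofReal_ne_zero, freq]
      have := norm_pos_iff.mpr hξ0
      positivity
    simpa [this] using hξ
  exact (hg.congr h2).ext h0

/-- Uniqueness for the linear wave equation in the energy space of order `1/2`. -/
theorem IsC1Curve.eq_zero_of_wave (hn : 1 ≤ n) {T : EReal} {c : ℝ → ℝ} {d e : ℝ → 𝓢'(Rn n, ℂ)}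
    (h : IsC1Curve (fourierNormSq freq) T d e)
    (hc : ∀ b ∈ timeInterval T, ContinuousOn c (Icc 0 b)) (hd : d 0 = 0) (he : e 0 = 0)
    (heq : ∀ t ∈ timeInterval T, 0 < t → ∀ ψ : 𝓢(Rn n, ℂ),
      HasDerivAt (fun r => e r ψ) ((c t : ℂ) * (Δ (d t)) ψ) t) {t : ℝ} (ht : t ∈ timeInterval T) :
    d t = 0 := by
  refine eq_zero_of_laplacian_eq_zero hn (h.mem t ht) fun ψ hψ => ?_
  obtain ⟨B, hB0, hB⟩ : ∃ B : ℝ, 0 ≤ B ∧ ∀ ξ, (𝓕⁻ ψ) ξ ≠ 0 → freq ξ ^ 2 ≤ B := by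
    obtain ⟨R, hR⟩ := hψ.isCompact.isBounded.exists_norm_le
    refine ⟨(2 * Real.pi * R) ^ 2, sq_nonneg _, fun ξ hξ => ?_⟩
    have h1 := hR ξ (subset_tsupport _ hξ)
    unfold freq
    gcongr
  set b := t
  have hsub : Icc 0 b ⊆ timeInterval T := Icc_subset_timeInterval ht
  have hnhds : ∀ s ∈ Ioo 0 b, timeInterval T ∈ 𝓝 s := fun s hs =>
    mem_of_superset (Icc_mem_nhds hs.1 hs.2) hsub
  set D := fun r => weightedFourier freq (d r)
  set E := fun r => weightedFourier freq (e r)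
  set P := fun k => (memLp_laplacianDual ((fun χ : 𝓢(Rn n, ℂ) => Δ χ)^[k] ψ)).toLp _
  have hD : ∀ s ∈ timeInterval T, HasDerivWithinAt D (E s) (timeInterval T) s := fun s hs =>
    h.hasDerivWithinAt measurable_freq freq_nonneg hs
  have hDc : ContinuousOn D (Icc 0 b) := fun s hs => ((hD s (hsub hs)).continuousWithinAt).mono hsub
  have hEc : ContinuousOn E (Icc 0 b) :=
    (h.deriv_isC0.continuousOn measurable_freq freq_nonneg).mono hsub
  have hDv : ∀ k, ∀ s ∈ timeInterval T,
      (Δ (d s)) ((fun χ : 𝓢(Rn n, ℂ) => Δ χ)^[k] ψ) = inner ℂ (P k) (D s) := fun k s hs =>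
    laplacian_apply_eq_inner (h.mem s hs) _
  have hEv : ∀ k, ∀ s ∈ timeInterval T,
      (Δ (e s)) ((fun χ : 𝓢(Rn n, ℂ) => Δ χ)^[k] ψ) = inner ℂ (P k) (E s) := fun k s hs =>
    laplacian_apply_eq_inner (h.deriv_isC0.mem s hs) _
  obtain ⟨A, hA⟩ := isCompact_Icc.exists_bound_of_continuousOn hDc
  have hA0 : 0 ≤ A := (norm_nonneg _).trans (hA 0 ⟨le_rfl, ht.1⟩)
  have h0 := zero_mem_timeInterval ht
  have key := hierarchy_eq_zero (f := fun k s => inner ℂ (P k) (D s))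
    (g := fun k s => inner ℂ (P k) (E s)) (A := ‖P 0‖ * A) (B := B) (by positivity) hB0 (hc b ht)
    (fun k => continuousOn_const.inner (𝕜 := ℂ) hDc) (fun k => continuousOn_const.inner (𝕜 := ℂ) hEc)
    (fun k => by rw [← hDv k 0 h0, hd]; simp [TemperedDistribution.laplacian_apply_apply])
    (fun k => by rw [← hEv k 0 h0, he]; simp [TemperedDistribution.laplacian_apply_apply])
    (fun k s hs => ?_) (fun k s hs => ?_) (fun k s hs => ?_) (right_mem_Icc.mpr ht.1) 0
  · rw [← hDv 0 t ht] at key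
    simpa using key
  · have h1 := ((hD s (hsub (Ioo_subset_Icc_self hs))).hasDerivAt (hnhds s hs))
    have h2 := (hasDerivAt_const s (P k)).inner ℂ h1
    simpa using h2
  · have hs' := hsub (Ioo_subset_Icc_self hs)
    -- Testing the equation with one more Laplacian on `ψ` turns its right side into `c` times the
    -- next member of the hierarchy.
    have h1 := heq s hs' hs.1 (Δ ((fun χ : 𝓢(Rn n, ℂ) => Δ χ)^[k] ψ))
    have h2 := hDv (k + 1) s hs'
    rw [Function.iterate_succ_apply'] at h2
    rw [h2] at h1
    refine h1.congr_of_eventuallyEq ?_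
    filter_upwards [hnhds s hs] with r hr
    rw [← hEv k r hr, TemperedDistribution.laplacian_apply_apply]
  · calc _ ≤ ‖P k‖ * ‖D s‖ := norm_inner_le_norm _ _
      _ ≤ (B ^ k * ‖P 0‖) * A :=
        mul_le_mul (norm_toLp_laplacianDual_le hB k) (hA s hs) (norm_nonneg _) (by positivity)
      _ = _ := by ring

/-! ### Comparison of weights, and differences of curves. -/

theorem fourierNormSq_mono {w w' : Rn n → ℝ} (h : ∀ ξ, w' ξ ≤ w ξ) (f : 𝓢'(Rn n, ℂ)) :
    fourierNormSq w' f ≤ fourierNormSq w f :=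
  iInf₂_mono fun g _ => lintegral_mono fun ξ => by gcongr; exact h ξ

theorem fourierNormSq_sub_le {w : Rn n → ℝ} (hw : Measurable w) (f f' : 𝓢'(Rn n, ℂ)) :
    fourierNormSq w (f - f') ≤ 2 * fourierNormSq w f + 2 * fourierNormSq w f' := by
  by_cases h : fourierNormSq w f < ∞
  swap
  · simp [not_lt_top_iff.mp h]
  by_cases h' : fourierNormSq w f' < ∞
  swap
  · simp [not_lt_top_iff.mp h']
  obtain ⟨g, hg⟩ := exists_hasFourierFunction_of_fourierNormSq_lt_top h
  obtain ⟨g', hg'⟩ := exists_hasFourierFunction_of_fourierNormSq_lt_top h'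
  rw [(hg.sub hg').fourierNormSq_eq, hg.fourierNormSq_eq, hg'.fourierNormSq_eq,
    ← lintegral_const_mul' _ _ (by simp), ← lintegral_const_mul' _ _ (by simp), ← lintegral_add_left']
  · refine lintegral_mono fun ξ => ?_
    have h1 : ‖g ξ - g' ξ‖ₑ ^ 2 ≤ 2 * ‖g ξ‖ₑ ^ 2 + 2 * ‖g' ξ‖ₑ ^ 2 := by
      have h2 := ENNReal.ofReal_le_ofReal (norm_sub_sq_le (g ξ) (g' ξ))
      rw [ENNReal.ofReal_add (by positivity) (by positivity), ENNReal.ofReal_mul zero_le_two,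
        ENNReal.ofReal_mul zero_le_two, ENNReal.ofReal_pow (norm_nonneg _),
        ENNReal.ofReal_pow (norm_nonneg _), ENNReal.ofReal_pow (norm_nonneg _), ofReal_norm,
        ofReal_norm, ofReal_norm] at h2
      simpa using h2
    calc _ ≤ ENNReal.ofReal (w ξ) * (2 * ‖g ξ‖ₑ ^ 2 + 2 * ‖g' ξ‖ₑ ^ 2) := by gcongr
      _ = _ := by ring
  · exact ((hw.ennreal_ofReal.aemeasurable.mul
      (hg.1.aestronglyMeasurable.enorm.pow_const 2)).const_mul 2)

theorem IsC0Curve.mono {N N' : 𝓢'(Rn n, ℂ) → ℝ≥0∞} (hN : ∀ f, N' f ≤ N f) {T : EReal}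
    {u : ℝ → 𝓢'(Rn n, ℂ)} (h : IsC0Curve N T u) : IsC0Curve N' T u where
  mem t ht := (hN _).trans_lt (h.mem t ht)
  continuous t ht := tendsto_of_tendsto_of_tendsto_of_le_of_le tendsto_const_nhds (h.continuous t ht)
    (fun _ => zero_le) (fun _ => hN _)

theorem IsC1Curve.mono {N N' : 𝓢'(Rn n, ℂ) → ℝ≥0∞} (hN : ∀ f, N' f ≤ N f) {T : EReal}
    {u v : ℝ → 𝓢'(Rn n, ℂ)} (h : IsC1Curve N T u v) : IsC1Curve N' T u v where
  mem t ht := (hN _).trans_lt (h.mem t ht)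
  hasDeriv t ht := tendsto_of_tendsto_of_tendsto_of_le_of_le tendsto_const_nhds (h.hasDeriv t ht)
    (fun _ => zero_le) (fun _ => hN _)
  deriv_isC0 := h.deriv_isC0.mono hN

theorem tendsto_two_mul_add {ι : Type*} {l : Filter ι} {p q : ι → ℝ≥0∞} (hp : Tendsto p l (𝓝 0))
    (hq : Tendsto q l (𝓝 0)) : Tendsto (fun r => 2 * p r + 2 * q r) l (𝓝 0) := by
  have h1 := ENNReal.Tendsto.const_mul hp (Or.inr (by simp : (2 : ℝ≥0∞) ≠ ∞))
  have h2 := ENNReal.Tendsto.const_mul hq (Or.inr (by simp : (2 : ℝ≥0∞) ≠ ∞))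
  simpa using h1.add h2

theorem IsC0Curve.sub {w : Rn n → ℝ} (hw : Measurable w) {T : EReal} {u u' : ℝ → 𝓢'(Rn n, ℂ)}
    (h : IsC0Curve (fourierNormSq w) T u) (h' : IsC0Curve (fourierNormSq w) T u') :
    IsC0Curve (fourierNormSq w) T (fun t => u t - u' t) where
  mem t ht := (fourierNormSq_sub_le hw _ _).trans_lt (ENNReal.add_lt_top.mpr
    ⟨ENNReal.mul_lt_top (by simp) (h.mem t ht), ENNReal.mul_lt_top (by simp) (h'.mem t ht)⟩)
  continuous t ht := by
    refine tendsto_of_tendsto_of_tendsto_of_le_of_le tendsto_const_nhds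
      (tendsto_two_mul_add (h.continuous t ht) (h'.continuous t ht)) (fun _ => zero_le) fun r => ?_
    have := fourierNormSq_sub_le hw (u r - u t) (u' r - u' t)
    rwa [sub_sub_sub_comm] at this

theorem smul_sub_temperedDistribution (a : ℂ) (f f' : 𝓢'(Rn n, ℂ)) : a • (f - f') = a • f - a • f' := by
  ext ψ
  change a • (f ψ - f' ψ) = a • f ψ - a • f' ψ
  exact smul_sub a _ _

theorem IsC1Curve.sub {w : Rn n → ℝ} (hw : Measurable w) {T : EReal} {u v u' v' : ℝ → 𝓢'(Rn n, ℂ)}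
    (h : IsC1Curve (fourierNormSq w) T u v) (h' : IsC1Curve (fourierNormSq w) T u' v') :
    IsC1Curve (fourierNormSq w) T (fun t => u t - u' t) (fun t => v t - v' t) where
  mem t ht := (fourierNormSq_sub_le hw _ _).trans_lt (ENNReal.add_lt_top.mpr
    ⟨ENNReal.mul_lt_top (by simp) (h.mem t ht), ENNReal.mul_lt_top (by simp) (h'.mem t ht)⟩)
  hasDeriv t ht := by
    refine tendsto_of_tendsto_of_tendsto_of_le_of_le tendsto_const_nhds
      (tendsto_two_mul_add (h.hasDeriv t ht) (h'.hasDeriv t ht)) (fun _ => zero_le) fun r => ?_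
    have := fourierNormSq_sub_le hw ((((r - t : ℝ) : ℂ)⁻¹) • (u r - u t) - v t)
      ((((r - t : ℝ) : ℂ)⁻¹) • (u' r - u' t) - v' t)
    rwa [sub_sub_sub_comm, ← smul_sub_temperedDistribution, sub_sub_sub_comm (u r)] at this
  deriv_isC0 := h.deriv_isC0.sub hw h'.deriv_isC0

/-! ### Lipschitz continuity of the squared gradient norm along a curve. -/

section Gradient

variable {f f' : 𝓢'(Rn n, ℂ)}

theorem toReal_gradNormSq {g : Rn n → ℂ} (hg : HasFourierFunction f g) (h : gradNormSq f < ∞) :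
    Integrable (fun ξ => freq ξ ^ 2 * ‖g ξ‖ ^ 2) volume ∧
      (gradNormSq f).toReal = ∫ ξ, freq ξ ^ 2 * ‖g ξ‖ ^ 2 := by
  have hm : AEStronglyMeasurable (fun ξ => freq ξ ^ 2 * ‖g ξ‖ ^ 2) volume :=
    (measurable_freq.pow_const 2).aestronglyMeasurable.mul (hg.1.aestronglyMeasurable.norm.pow 2)
  have h0 : ∀ ξ, 0 ≤ freq ξ ^ 2 * ‖g ξ‖ ^ 2 := fun ξ => by positivity
  have he : gradNormSq f = ∫⁻ ξ, ENNReal.ofReal (freq ξ ^ 2 * ‖g ξ‖ ^ 2) := by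
    rw [hg.gradNormSq_eq]
    refine lintegral_congr fun ξ => ?_
    rw [ENNReal.ofReal_mul (sq_nonneg _), ENNReal.ofReal_pow (norm_nonneg _), ofReal_norm, freq]
  constructor
  · refine ⟨hm, ?_⟩
    rw [hasFiniteIntegral_iff_ofReal (Eventually.of_forall h0), ← he]
    exact h
  · rw [he, integral_eq_lintegral_of_nonneg_ae (Eventually.of_forall h0) hm]

theorem measurable_freq_cube : Measurable (fun ξ : Rn n => freq ξ * freq ξ ^ 2) :=
  measurable_freq.mul (measurable_freq.pow_const 2)

theorem freq_cube_nonneg (ξ : Rn n) : 0 ≤ freq ξ * freq ξ ^ 2 :=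
  mul_nonneg (freq_nonneg ξ) (sq_nonneg _)

/-- Polarisation, `|g|² - |g'|² = Re (conj (g - g') (g + g'))`, with `m² = m^{1/2} · m^{3/2}`: the
difference is measured in `Ḣ^{1/2}`, where the curve is differentiable, and the sum in `Ḣ^{3/2}`,
where it is bounded on compact intervals. -/
theorem toReal_gradNormSq_sub (h : gradNormSq f < ∞) (h' : gradNormSq f' < ∞)
    (h₃ : fourierNormSq (fun ξ => freq ξ * freq ξ ^ 2) f < ∞)
    (h₃' : fourierNormSq (fun ξ => freq ξ * freq ξ ^ 2) f' < ∞)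
    (h₁ : fourierNormSq freq (f - f') < ∞) :
    (gradNormSq f).toReal - (gradNormSq f').toReal =
      RCLike.re (inner ℂ (weightedFourier freq (f - f'))
        (weightedFourier (fun ξ => freq ξ * freq ξ ^ 2) f +
          weightedFourier (fun ξ => freq ξ * freq ξ ^ 2) f')) := by
  obtain ⟨g, hg⟩ := exists_hasFourierFunction_of_fourierNormSq_lt_top h₃
  obtain ⟨g', hg'⟩ := exists_hasFourierFunction_of_fourierNormSq_lt_top h₃'
  have hm := hg.memLp_sqrt_mul measurable_freq_cube freq_cube_nonneg h₃
  have hm' := hg'.memLp_sqrt_mul measurable_freq_cube freq_cube_nonneg h₃'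
  have hm₁ := (hg.sub hg').memLp_sqrt_mul measurable_freq freq_nonneg h₁
  have hi := toReal_gradNormSq hg h
  have hi' := toReal_gradNormSq hg' h'
  rw [hi.2, hi'.2, ← integral_sub hi.1 hi'.1, weightedFourier_eq hg hm, weightedFourier_eq hg' hm',
    weightedFourier_eq (hg.sub hg') hm₁, L2.inner_def, ← integral_re (L2.integrable_inner _ _)]
  refine integral_congr_ae ?_
  filter_upwards [hm.coeFn_toLp, hm'.coeFn_toLp, hm₁.coeFn_toLp, Lp.coeFn_add (hm.toLp _) (hm'.toLp _)]
    with ξ e1 e2 e3 e4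
  rw [e4, Pi.add_apply, e1, e2, e3]
  have hs : √(freq ξ * freq ξ ^ 2) = √(freq ξ) * freq ξ := by
    rw [Real.sqrt_mul (freq_nonneg ξ), Real.sqrt_sq (freq_nonneg ξ)]
  have hs2 : √(freq ξ) * √(freq ξ) = freq ξ := Real.mul_self_sqrt (freq_nonneg ξ)
  rw [hs, RCLike.inner_apply]
  have hn : ∀ z : ℂ, ‖z‖ ^ 2 = z.re * z.re + z.im * z.im := fun z => by
    rw [← Complex.normSq_eq_norm_sq, Complex.normSq_apply]
  rw [hn, hn]
  simp only [map_mul, Complex.conj_ofReal, map_sub, RCLike.re_to_complex, Complex.mul_re,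
    Complex.mul_im, Complex.add_re, Complex.add_im, Complex.sub_re, Complex.sub_im, Complex.conj_re,
    Complex.conj_im, Complex.ofReal_re, Complex.ofReal_im, Complex.ofReal_mul]
  linear_combination (-(freq ξ) * ((g ξ).re * (g ξ).re + (g ξ).im * (g ξ).im
    - ((g' ξ).re * (g' ξ).re + (g' ξ).im * (g' ξ).im))) * hs2

/-- `‖∇w(t)‖²` is locally Lipschitz for curves in the energy space. -/
theorem exists_lipOn_gradNormSq {T : EReal} {w z : ℝ → 𝓢'(Rn n, ℂ)}
    (h₀ : IsC0Curve (fourierNormSq fun ξ => freq ξ * freq ξ ^ 2) T w)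
    (h₁ : IsC1Curve (fourierNormSq freq) T (fun t => w t - w 0) z)
    (hfin : ∀ t ∈ timeInterval T, gradNormSq (w t) < ∞) {b : ℝ} (hb : b ∈ timeInterval T) :
    ∃ K, 0 ≤ K ∧ LipOn K (fun t => (gradNormSq (w t)).toReal) 0 b := by
  have hsub : Icc 0 b ⊆ timeInterval T := Icc_subset_timeInterval hb
  obtain ⟨A, hA⟩ := isCompact_Icc.exists_bound_of_continuousOn
    ((h₁.deriv_isC0.continuousOn measurable_freq freq_nonneg).mono hsub)
  obtain ⟨M, hM⟩ := isCompact_Icc.exists_bound_of_continuousOn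
    ((h₀.continuousOn measurable_freq_cube freq_cube_nonneg).mono hsub)
  have h0b : (0 : ℝ) ∈ Icc 0 b := ⟨le_rfl, hb.1⟩
  have hA0 : 0 ≤ A := (norm_nonneg _).trans (hA 0 h0b)
  have hM0 : 0 ≤ M := (norm_nonneg _).trans (hM 0 h0b)
  refine ⟨A * (M + M), by positivity, fun s t hs hst ht => ?_⟩
  have hs' : s ∈ Icc 0 b := ⟨hs, hst.trans ht⟩
  have ht' : t ∈ Icc 0 b := ⟨hs.trans hst, ht⟩
  have hmv := Convex.norm_image_sub_le_of_norm_hasDerivWithin_le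
    (fun x hx => (h₁.hasDerivWithinAt measurable_freq freq_nonneg (hsub hx)).mono hsub) hA
    (convex_Icc 0 b) hs' ht'
  have hw := weightedFourier_sub measurable_freq freq_nonneg (h₁.mem t (hsub ht')) (h₁.mem s (hsub hs'))
  rw [← hw.2, Real.norm_of_nonneg (sub_nonneg.mpr hst)] at hmv
  rw [sub_sub_sub_cancel_right] at hw hmv
  rw [toReal_gradNormSq_sub (hfin t (hsub ht')) (hfin s (hsub hs')) (h₀.mem t (hsub ht'))
    (h₀.mem s (hsub hs')) hw.1]
  refine (RCLike.abs_re_le_norm _).trans ((norm_inner_le_norm _ _).trans ?_)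
  calc _ ≤ (A * (t - s)) * (M + M) := mul_le_mul hmv
        ((norm_add_le _ _).trans (add_le_add (hM t ht') (hM s hs'))) (norm_nonneg _)
        (mul_nonneg hA0 (sub_nonneg.mpr hst))
    _ = _ := by ring

end Gradient

/-! ### From solutions in the Gevrey class to fixed points. -/

/-- The weight of the Gevrey space of order `1/2`. -/
def gevreyWeight (s η : ℝ) (ξ : Rn n) : ℝ := freq ξ * Real.exp (η * freq ξ ^ (1 / s))

theorem measurable_gevreyWeight (s η : ℝ) : Measurable (gevreyWeight s η : Rn n → ℝ) :=
  measurable_freq.mul (Real.measurable_exp.comp ((measurable_freq.pow_const _).const_mul _))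

theorem gevreyWeight_nonneg (s η : ℝ) (ξ : Rn n) : 0 ≤ gevreyWeight s η ξ :=
  mul_nonneg (freq_nonneg ξ) (Real.exp_pos _).le

theorem freq_le_gevreyWeight (s : ℝ) {η : ℝ} (hη : 0 < η) (ξ : Rn n) : freq ξ ≤ gevreyWeight s η ξ :=
  le_mul_of_one_le_right (freq_nonneg ξ) (Real.one_le_exp
    (mul_nonneg hη.le (Real.rpow_nonneg (freq_nonneg ξ) _)))

theorem homGevreyNormSq_half (s η : ℝ) :
    (homGevreyNormSq (1 / 2) s η : 𝓢'(Rn n, ℂ) → ℝ≥0∞) = fourierNormSq (gevreyWeight s η) := by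
  unfold homGevreyNormSq gevreyWeight freq
  norm_num

theorem homGevreyNormSq_three_half (s η : ℝ) : (homGevreyNormSq (3 / 2) s η : 𝓢'(Rn n, ℂ) → ℝ≥0∞) =
    fourierNormSq fun ξ => gevreyWeight s η ξ * freq ξ ^ 2 := by
  have h : (fun ξ : Rn n => (2 * Real.pi * ‖ξ‖) ^ (2 * (3 / 2) : ℝ) *
      Real.exp (η * (2 * Real.pi * ‖ξ‖) ^ (1 / s))) = fun ξ => gevreyWeight s η ξ * freq ξ ^ 2 := by
    ext ξ
    rw [show (2 * (3 / 2) : ℝ) = ((3 : ℕ) : ℝ) by norm_num, Real.rpow_natCast, gevreyWeight, freq]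
    ring
  unfold homGevreyNormSq
  rw [h]

theorem homSobolevNormSq_half :
    (homSobolevNormSq (1 / 2) : 𝓢'(Rn n, ℂ) → ℝ≥0∞) = fourierNormSq freq := by
  unfold homSobolevNormSq freq
  norm_num

theorem homSobolevNormSq_three_half : (homSobolevNormSq (3 / 2) : 𝓢'(Rn n, ℂ) → ℝ≥0∞) =
    fourierNormSq fun ξ => freq ξ * freq ξ ^ 2 := by
  have h : (fun ξ : Rn n => (2 * Real.pi * ‖ξ‖) ^ (2 * (3 / 2) : ℝ)) =
      fun ξ => freq ξ * freq ξ ^ 2 := by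
    ext ξ
    rw [show (2 * (3 / 2) : ℝ) = ((3 : ℕ) : ℝ) by norm_num, Real.rpow_natCast, freq]
    ring
  unfold homSobolevNormSq
  rw [h]

/-- Every solution of the Kirchhoff equation solves the fixed point equation for `‖∇w(t)‖²`. -/
theorem IsSolution.isFix (hn : 1 ≤ n) {φ : ℝ → ℝ} (hφ : LocallyLipschitzOn (Ici 0) φ) {ν : ℝ}
    (hν : 0 < ν) (hφν : ∀ ρ, 0 ≤ ρ → ν ≤ φ ρ) {s η : ℝ} (hη : 0 < η) {u₀ u₁ : 𝓢'(Rn n, ℂ)} {T : EReal}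
    {w z : ℝ → 𝓢'(Rn n, ℂ)} (h : IsSolution φ s η u₀ u₁ T w z) {g₀ g₁ : Rn n → ℂ}
    (hd : IsWaveData volume freq g₀ g₁) (h₀ : HasFourierFunction u₀ g₀) (h₁ : HasFourierFunction u₁ g₁)
    {t : ℝ} (ht : t ∈ timeInterval T) :
    IsFix volume freq g₀ g₁ φ t (fun t => (gradNormSq (w t)).toReal) ∧
      HasFourierFunction (w t) (waveY freq g₀ g₁ (fun t => φ (gradNormSq (w t)).toReal) t) := by
  have hC0 : IsC0Curve (fourierNormSq fun ξ => freq ξ * freq ξ ^ 2) T w := by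
    refine h.isC0.mono fun f => ?_
    rw [homGevreyNormSq_three_half]
    exact fourierNormSq_mono (fun ξ => mul_le_mul_of_nonneg_right (freq_le_gevreyWeight s hη ξ)
      (sq_nonneg _)) f
  have hC1 : IsC1Curve (fourierNormSq freq) T (fun t => w t - w 0) z := by
    refine h.isC1.mono fun f => ?_
    rw [homGevreyNormSq_half]
    exact fourierNormSq_mono (freq_le_gevreyWeight s hη) f
  have hlip : ∀ b ∈ timeInterval T, ∃ K, 0 ≤ K ∧ LipOn K (fun t => (gradNormSq (w t)).toReal) 0 b :=
    fun b hb => exists_lipOn_gradNormSq hC0 hC1 h.grad_finite hb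
  have hc : ∀ b ∈ timeInterval T, IsCoeff ν (fun t => φ (gradNormSq (w t)).toReal) b := by
    intro b hb
    obtain ⟨K, hK0, hK⟩ := hlip b hb
    exact isCoeff_comp hφ hν hφν hK0 hK fun t _ => ENNReal.toReal_nonneg
  -- The linear flow with the speed of `w` itself. It has the same data, so `w - u` solves a
  -- homogeneous linear problem and vanishes.
  obtain ⟨u, v, hflow⟩ := exists_isFlow hd h₀.1 hc
  have hinit := hflow.init (zero_mem_timeInterval ht) h₀ h₁
  have hInt : Integrable (fun ξ => freq ξ * dataSize freq g₀ g₁ ξ) volume := hd.int_mul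
  have hwu : ∀ t ∈ timeInterval T, w t = u t := by
    intro t ht
    have hz := (hC1.sub measurable_freq (hflow.isC1Curve hd hc measurable_freq freq_nonneg
      hInt)).eq_zero_of_wave hn (c := fun t => φ (gradNormSq (w t)).toReal)
      (fun b hb => (hc b hb).continuousOn) (by simp) (by rw [h.init_deriv, hinit.2, sub_self])
      (fun t ht ht0 ψ => ?_) ht
    · rw [hinit.1, h.init, sub_sub_sub_cancel_right] at hz
      exact sub_eq_zero.mp hz
    · have h2 := (h.equation t ht ht0 ψ).sub (hflow.equation hd h₀.1 hc ht ht0 ψ)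
      refine h2.congr_deriv ?_
      rw [hinit.1, h.init, sub_sub_sub_cancel_right, ← mul_sub,
        TemperedDistribution.laplacian_apply_apply, TemperedDistribution.laplacian_apply_apply,
        TemperedDistribution.laplacian_apply_apply]
      rfl
  refine ⟨⟨hlip t ht, fun r hr => ?_⟩, ?_⟩
  · have hr' := Icc_subset_timeInterval ht hr
    change (gradNormSq (w r)).toReal = _
    rw [hwu r hr', hflow.gradNormSq_eq hd hc hr', ENNReal.toReal_ofReal (waveGrad_nonneg _ _ _ _ _ _)]
  · have := (hflow t ht).1
    rwa [← hwu t ht] at this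

/-! ### The life span and the blow-up alternative. -/

section LifeSpan

variable {Ω : Type*} [MeasurableSpace Ω] {μ : Measure Ω} {m : Ω → ℝ} {g₀ g₁ : Ω → ℂ} {φ : ℝ → ℝ}
  {ν : ℝ}

/-- The life span, the supremum of the times up to which there is a solution. -/
def lifeSpan (μ : Measure Ω) (m : Ω → ℝ) (g₀ g₁ : Ω → ℂ) (φ : ℝ → ℝ) : EReal :=
  sSup ((fun T : ℝ => (T : EReal)) '' {T | 0 ≤ T ∧ ∃ r, IsFix μ m g₀ g₁ φ T r})

theorem le_lifeSpan {T : ℝ} {r : ℝ → ℝ} (hT : 0 ≤ T) (h : IsFix μ m g₀ g₁ φ T r) :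
    (T : EReal) ≤ lifeSpan μ m g₀ g₁ φ :=
  le_sSup ⟨T, ⟨hT, r, h⟩, rfl⟩

/-- By uniqueness the fixed points on different intervals agree where both are defined, so the
diagonal choice `t ↦ R t t` glues them. -/
theorem exists_isFix_lifeSpan (hd : IsWaveData μ m g₀ g₁) (hφ : LocallyLipschitzOn (Ici 0) φ)
    (hν : 0 < ν) (hφν : ∀ ρ, 0 ≤ ρ → ν ≤ φ ρ) :
    ∃ r, ∀ b ∈ timeInterval (lifeSpan μ m g₀ g₁ φ), IsFix μ m g₀ g₁ φ b r := by
  have h : ∀ b : ℝ, ∃ r, b ∈ timeInterval (lifeSpan μ m g₀ g₁ φ) → IsFix μ m g₀ g₁ φ b r := by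
    intro b
    by_cases hb : b ∈ timeInterval (lifeSpan μ m g₀ g₁ φ)
    · obtain ⟨_, ⟨T, ⟨_, r, hr⟩, rfl⟩, hbT⟩ := lt_sSup_iff.mp hb.2
      exact ⟨r, fun _ => hr.mono (EReal.coe_lt_coe_iff.mp hbT).le⟩
    · exact ⟨0, fun h => absurd h hb⟩
  choose R hR using h
  refine ⟨fun t => R t t, fun b hb => (hR b hb).congr fun t ht => ?_⟩
  exact ((hR b hb).mono ht.2).unique hd hφ hν hφν
    (hR t (Icc_subset_timeInterval hb ht)) t ⟨ht.1, le_rfl⟩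

/-- The energy of order `3/2` is unbounded at the end of a finite life span. -/
theorem exists_lt_waveEnergy {Ω : Type} [MeasurableSpace Ω] {μ : Measure Ω} {m : Ω → ℝ} {g₀ g₁ : Ω → ℂ}
    (hd : IsWaveData μ m g₀ g₁) (hφ : LocallyLipschitzOn (Ici 0) φ)
    (hν : 0 < ν) (hφν : ∀ ρ, 0 ≤ ρ → ν ≤ φ ρ) {r : ℝ → ℝ} {T : ℝ}
    (hT : lifeSpan μ m g₀ g₁ φ = T)
    (hr : ∀ b ∈ timeInterval (lifeSpan μ m g₀ g₁ φ), IsFix μ m g₀ g₁ φ b r) {a : ℝ} (ha0 : 0 ≤ a)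
    (haT : a < T) (M : ℝ) :
    ∃ t ∈ Ico a T, M < waveEnergy μ m g₀ g₁ (fun t => φ (r t)) t := by
  by_contra! hM
  have hmem : ∀ b, 0 ≤ b → b < T → b ∈ timeInterval (lifeSpan μ m g₀ g₁ φ) := fun b hb hbT =>
    ⟨hb, hT ▸ EReal.coe_lt_coe_iff.mpr hbT⟩
  have hc : ∀ b, 0 ≤ b → b < T → IsCoeff ν (fun t => φ (r t)) b := fun b hb hbT =>
    (hr b (hmem b hb hbT)).isCoeff hφ hν hφν
  have hM0 : 0 ≤ M := (waveEnergy_nonneg hd (hc a ha0 haT) ⟨ha0, le_rfl⟩).trans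
    (hM a ⟨le_rfl, haT⟩)
  obtain ⟨τ, hτ, hext⟩ := exists_extension_time hφ hν hφν
    (waveGrad μ m g₀ g₁ (fun t => φ (r t)) a + M / √ν * (T - a)) M hM0
  -- The time `τ` was fixed by bounds valid on all of `[a, T)`. Continuing from less than `τ` before
  -- the end therefore passes `T`.
  set b := max a (T - τ / 2)
  have hab : a ≤ b := le_max_left _ _
  have hbT : b < T := max_lt haT (by linarith)
  have hb0 : 0 ≤ b := ha0.trans hab
  have hgrad := waveGrad_le_of_waveEnergy_le hd (hc b hb0 hbT) ha0 hab
    fun t ht => hM t ⟨ht.1, ht.2.trans hbT⟩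
  have hfix := hr b (hmem b hb0 hbT)
  obtain ⟨r', hr'⟩ := hext Ω μ m g₀ g₁ hd b r hb0 hfix (by
    rw [hfix.eq b ⟨hb0, le_rfl⟩]
    refine hgrad.trans ?_
    have : M / √ν * (b - a) ≤ M / √ν * (T - a) :=
      mul_le_mul_of_nonneg_left (by linarith) (by positivity)
    linarith) (hM b ⟨hab, hbT⟩)
  have h1 := le_lifeSpan (by positivity) hr'
  rw [hT, EReal.coe_le_coe_iff] at h1
  have h2 : T - τ / 2 ≤ b := le_max_right _ _
  linarith

end LifeSpan

/-! ### Data and energies on the Fourier side. -/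

theorem integrable_mul_dataSize {g₀ g₁ : Rn n → ℂ} {w : Rn n → ℝ} (hw : Measurable w)
    (hw0 : ∀ ξ, 0 ≤ w ξ) (hg₀ : AEStronglyMeasurable g₀ volume) (hg₁ : AEStronglyMeasurable g₁ volume)
    (h₀ : ∫⁻ ξ, ENNReal.ofReal (w ξ * freq ξ ^ 2) * ‖g₀ ξ‖ₑ ^ 2 < ∞)
    (h₁ : ∫⁻ ξ, ENNReal.ofReal (w ξ) * ‖g₁ ξ‖ₑ ^ 2 < ∞) :
    Integrable (fun ξ => w ξ * dataSize freq g₀ g₁ ξ) volume := by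
  have hI : ∀ (v : Rn n → ℝ) (g : Rn n → ℂ), Measurable v → (∀ ξ, 0 ≤ v ξ) →
      AEStronglyMeasurable g volume → ∫⁻ ξ, ENNReal.ofReal (v ξ) * ‖g ξ‖ₑ ^ 2 < ∞ →
      Integrable (fun ξ => v ξ * ‖g ξ‖ ^ 2) volume := by
    intro v g hv hv0 hg h
    refine ⟨hv.aestronglyMeasurable.mul (hg.norm.pow 2), ?_⟩
    rw [hasFiniteIntegral_iff_ofReal (Eventually.of_forall fun ξ => mul_nonneg (hv0 ξ) (sq_nonneg _))]
    refine lt_of_eq_of_lt (lintegral_congr fun ξ => ?_) h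
    rw [ENNReal.ofReal_mul (hv0 ξ), ENNReal.ofReal_pow (norm_nonneg _), ofReal_norm]
  refine ((hI _ g₀ (hw.mul (measurable_freq.pow_const 2))
    (fun ξ => mul_nonneg (hw0 ξ) (sq_nonneg _)) hg₀ h₀).add (hI w g₁ hw hw0 hg₁ h₁)).congr
    (Eventually.of_forall fun ξ => ?_)
  simp only [dataSize, Pi.add_apply, Pi.mul_apply]
  ring

theorem isWaveData_of_hasFourierFunction {u₀ u₁ : 𝓢'(Rn n, ℂ)} {g₀ g₁ : Rn n → ℂ}
    (h₀ : HasFourierFunction u₀ g₀) (h₁ : HasFourierFunction u₁ g₁) {s η : ℝ} (hη : 0 < η)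
    (hu₀ : homGevreyNormSq (3 / 2) s η u₀ < ∞) (hu₁ : homGevreyNormSq (1 / 2) s η u₁ < ∞)
    (hgrad : gradNormSq u₀ < ∞) (hl2 : l2NormSq u₁ < ∞) :
    IsWaveData volume freq g₀ g₁ ∧
      Integrable (fun ξ => gevreyWeight s η ξ * dataSize freq g₀ g₁ ξ) volume := by
  rw [homGevreyNormSq_three_half, h₀.fourierNormSq_eq] at hu₀
  rw [homGevreyNormSq_half, h₁.fourierNormSq_eq] at hu₁
  have hm₀ := h₀.1.aestronglyMeasurable
  have hm₁ := h₁.1.aestronglyMeasurable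
  have hG := integrable_mul_dataSize (measurable_gevreyWeight s η) (gevreyWeight_nonneg s η) hm₀ hm₁
    hu₀ hu₁
  have h1 : Integrable (fun ξ => (1 : ℝ) * dataSize freq g₀ g₁ ξ) volume := by
    refine integrable_mul_dataSize measurable_const (fun _ => zero_le_one) hm₀ hm₁ ?_ ?_
    · rw [h₀.gradNormSq_eq] at hgrad
      simpa [freq] using hgrad
    · rw [h₁.l2NormSq_eq] at hl2
      simpa using hl2
  simp only [one_mul] at h1
  refine ⟨⟨measurable_freq, freq_nonneg, hm₀, hm₁, h1, ?_⟩, hG⟩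
  refine hG.mono' (measurable_freq.aestronglyMeasurable.mul h1.aestronglyMeasurable)
    (Eventually.of_forall fun ξ => ?_)
  rw [Real.norm_of_nonneg (mul_nonneg (freq_nonneg ξ) (dataSize_nonneg _ _ _ _))]
  exact mul_le_mul_of_nonneg_right (freq_le_gevreyWeight s hη ξ) (dataSize_nonneg _ _ _ _)

theorem energy32_eq {f f' : 𝓢'(Rn n, ℂ)} {g₀ g₁ : Rn n → ℂ} {c : ℝ → ℝ} {ν t : ℝ} {φ : ℝ → ℝ}
    (hd : IsWaveData volume freq g₀ g₁) (hc : IsCoeff ν c t) (ht : 0 ≤ t)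
    (hf : HasFourierFunction f (waveY freq g₀ g₁ c t))
    (hf' : HasFourierFunction f' (waveZ freq g₀ g₁ c t)) (hφ : φ (gradNormSq f).toReal = c t) :
    energy32 φ f f' = waveEnergy volume freq g₀ g₁ c t := by
  have htt : t ∈ Icc 0 t := ⟨ht, le_rfl⟩
  have hY := integrable_waveY_sq hd hc measurable_freq freq_nonneg hd.int_mul htt
  have hZ := integrable_waveZ_sq hd hc measurable_freq freq_nonneg hd.int_mul htt
  have h1 : (homSobolevNormSq (3 / 2) f).toReal =
      ∫ ξ, freq ξ * (freq ξ ^ 2 * ‖waveY freq g₀ g₁ c t ξ‖ ^ 2) := by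
    rw [homSobolevNormSq_three_half, hf.fourierNormSq_eq, integral_eq_lintegral_of_nonneg_ae
      (Eventually.of_forall fun ξ => mul_nonneg (freq_nonneg ξ) (by positivity)) hY.1]
    congr 1
    refine lintegral_congr fun ξ => ?_
    rw [← mul_assoc, ENNReal.ofReal_mul (freq_cube_nonneg ξ), ENNReal.ofReal_pow (norm_nonneg _),
      ofReal_norm]
  have h2 : (homSobolevNormSq (1 / 2) f').toReal = ∫ ξ, freq ξ * ‖waveZ freq g₀ g₁ c t ξ‖ ^ 2 := by
    rw [homSobolevNormSq_half, hf'.fourierNormSq_eq, integral_eq_lintegral_of_nonneg_ae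
      (Eventually.of_forall fun ξ => mul_nonneg (freq_nonneg ξ) (by positivity)) hZ.1]
    congr 1
    refine lintegral_congr fun ξ => ?_
    rw [ENNReal.ofReal_mul (freq_nonneg ξ), ENNReal.ofReal_pow (norm_nonneg _), ofReal_norm]
  rw [energy32, h1, h2, hφ, waveEnergy, ← integral_const_mul, ← integral_add (hY.const_mul _) hZ]
  refine integral_congr_ae (Eventually.of_forall fun ξ => ?_)
  simp only [waveE]
  ring

/-- Serves to bound the initial gradient norm by the Hamiltonian. Conservation in time is not
needed. -/
theorem mul_gradNormSq_le_hamiltonian {φ : ℝ → ℝ} (hφ : LocallyLipschitzOn (Ici 0) φ) {ν : ℝ}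
    (hφν : ∀ ρ, 0 ≤ ρ → ν ≤ φ ρ) (f g : 𝓢'(Rn n, ℂ)) :
    ν * (gradNormSq f).toReal ≤ hamiltonian φ f g := by
  have h0 : 0 ≤ (gradNormSq f).toReal := ENNReal.toReal_nonneg
  have h1 : ∫ _ in (0 : ℝ)..(gradNormSq f).toReal, ν ≤ ∫ ρ in (0 : ℝ)..(gradNormSq f).toReal, φ ρ :=
    intervalIntegral.integral_mono_on h0 (by simp)
      ((hφ.continuousOn.mono Icc_subset_Ici_self).intervalIntegrable_of_Icc h0)
      fun ρ hρ => hφν ρ hρ.1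
  rw [intervalIntegral.integral_const, sub_zero, smul_eq_mul, mul_comm] at h1
  exact h1.trans (le_add_of_nonneg_left ENNReal.toReal_nonneg)

open Classical in
/-- A function that represents the Fourier transform, if there is one. -/
def fourierFunction (f : 𝓢'(Rn n, ℂ)) : Rn n → ℂ :=
  if h : ∃ g, HasFourierFunction f g then h.choose else 0

theorem hasFourierFunction_fourierFunction {f : 𝓢'(Rn n, ℂ)} (h : ∃ g, HasFourierFunction f g) :
    HasFourierFunction f (fourierFunction f) := by
  rw [fourierFunction, dif_pos h]
  exact h.choose_spec

end Kirchhoff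

end

/-! ### Assembly. -/

theorem proposition2p3 (φ : ℝ → ℝ) (hφ : LocallyLipschitzOn (Set.Ici 0) φ)
    (ν₀ : ℝ) (hν₀ : 0 < ν₀) (hφν : ∀ ρ : ℝ, 0 ≤ ρ → ν₀ ≤ φ ρ) :
    -- the lower bound for the life span, a function of the Hamiltonian and the energy of order 3/2
    ∃ τ : ℝ → ℝ → ℝ, (∀ h e : ℝ, 0 < τ h e) ∧
    ∀ n : ℕ, 1 ≤ n →
    -- the life span of the data
    ∃ Tm : 𝓢'(Kirchhoff.Rn n, ℂ) → 𝓢'(Kirchhoff.Rn n, ℂ) → EReal,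
    ∀ s η : ℝ, 1 < s → 0 < η →
    ∀ u₀ u₁ : 𝓢'(Kirchhoff.Rn n, ℂ), (u₀ ≠ 0 ∨ u₁ ≠ 0) →
      Kirchhoff.homGevreyNormSq (3 / 2) s η u₀ < ∞ →
      Kirchhoff.homGevreyNormSq (1 / 2) s η u₁ < ∞ →
      -- the initial Hamiltonian is finite
      Kirchhoff.gradNormSq u₀ < ∞ →
      Kirchhoff.l2NormSq u₁ < ∞ →
      0 < Tm u₀ u₁ ∧
      (τ (Kirchhoff.hamiltonian φ u₀ u₁) (Kirchhoff.energy32 φ u₀ u₁) : EReal) ≤ Tm u₀ u₁ ∧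
      ∃ u v : ℝ → 𝓢'(Kirchhoff.Rn n, ℂ),
        Kirchhoff.IsSolution φ s η u₀ u₁ (Tm u₀ u₁) u v ∧
        (∀ T : EReal, 0 < T → T ≤ Tm u₀ u₁ → ∀ w z : ℝ → 𝓢'(Kirchhoff.Rn n, ℂ),
          Kirchhoff.IsSolution φ s η u₀ u₁ T w z →
            ∀ t ∈ Kirchhoff.timeInterval T, w t = u t) ∧
        (Tm u₀ u₁ = ⊤ ∨
          (Tm u₀ u₁ < ⊤ ∧
            Filter.limsup (fun t : ℝ => ((Kirchhoff.energy32 φ (u t) (v t) : ℝ) : EReal))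
              (𝓝[<] (Tm u₀ u₁).toReal) = ⊤)) := by
  -- Absolute values make `τ` a function on all of `ℝ × ℝ`. It is chosen before the dimension and
  -- the data.
  have hτ := fun h e : ℝ => Kirchhoff.exists_extension_time hφ hν₀ hφν (|h| / ν₀) |e| (abs_nonneg e)
  choose τ hτ0 hτ using hτ
  refine ⟨τ, hτ0, fun n hn => ⟨fun u₀ u₁ => Kirchhoff.lifeSpan volume Kirchhoff.freq
    (Kirchhoff.fourierFunction u₀) (Kirchhoff.fourierFunction u₁) φ, ?_⟩⟩
  intro s η _ hη u₀ u₁ _ hu₀ hu₁ hgrad hl2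
  have h₀ := Kirchhoff.hasFourierFunction_fourierFunction
    (Kirchhoff.exists_hasFourierFunction_of_fourierNormSq_lt_top hu₀)
  have h₁ := Kirchhoff.hasFourierFunction_fourierFunction
    (Kirchhoff.exists_hasFourierFunction_of_fourierNormSq_lt_top hu₁)
  beta_reduce
  generalize Kirchhoff.fourierFunction u₀ = g₀ at h₀ ⊢
  generalize Kirchhoff.fourierFunction u₁ = g₁ at h₁ ⊢
  obtain ⟨hd, hG⟩ := Kirchhoff.isWaveData_of_hasFourierFunction h₀ h₁ hη hu₀ hu₁ hgrad hl2
  have hlow : (τ (Kirchhoff.hamiltonian φ u₀ u₁) (Kirchhoff.energy32 φ u₀ u₁) : EReal) ≤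
      Kirchhoff.lifeSpan volume Kirchhoff.freq g₀ g₁ φ := by
    have hfix := Kirchhoff.isFix_zero volume Kirchhoff.freq g₀ g₁ φ
    have hr0 := (Kirchhoff.toReal_gradNormSq h₀ hgrad).2
    have hen := Kirchhoff.energy32_eq (φ := φ) hd (hfix.isCoeff hφ hν₀ hφν) le_rfl
      (h₀.congr (.of_forall fun ξ => (Kirchhoff.waveY_zero _ _ _ _ ξ).symm))
      (h₁.congr (.of_forall fun ξ => (Kirchhoff.waveZ_zero _ _ _ _ ξ).symm)) (by rw [hr0])
    obtain ⟨r', hr'⟩ := hτ (Kirchhoff.hamiltonian φ u₀ u₁) (Kirchhoff.energy32 φ u₀ u₁) _ volume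
      Kirchhoff.freq g₀ g₁ hd 0 _ le_rfl hfix (by
        rw [← hr0, le_div_iff₀ hν₀, mul_comm]
        exact (Kirchhoff.mul_gradNormSq_le_hamiltonian hφ hφν u₀ u₁).trans (le_abs_self _))
      (hen ▸ le_abs_self _)
    rw [zero_add] at hr'
    exact Kirchhoff.le_lifeSpan (hτ0 _ _).le hr'
  have hpos : 0 < Kirchhoff.lifeSpan volume Kirchhoff.freq g₀ g₁ φ :=
    (EReal.coe_pos.mpr (hτ0 _ _)).trans_le hlow
  obtain ⟨r, hr⟩ := Kirchhoff.exists_isFix_lifeSpan hd hφ hν₀ hφν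
  have hc := fun b hb => (hr b hb).isCoeff hφ hν₀ hφν
  obtain ⟨u, v, hflow⟩ := Kirchhoff.exists_isFlow hd h₀.1 hc
  have hinit := hflow.init ⟨le_rfl, hpos⟩ h₀ h₁
  have hgr : ∀ t ∈ Kirchhoff.timeInterval (Kirchhoff.lifeSpan volume Kirchhoff.freq g₀ g₁ φ),
      (Kirchhoff.gradNormSq (u t)).toReal = r t := fun t ht => by
    rw [hflow.gradNormSq_eq hd hc ht, ENNReal.toReal_ofReal (Kirchhoff.waveGrad_nonneg _ _ _ _ _ _),
      ← (hr t ht).eq t ⟨ht.1, le_rfl⟩]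
  refine ⟨hpos, hlow, u, v, ⟨hinit.1, hinit.2, ?_, ?_, fun t ht => ?_, fun t ht ht0 ψ => ?_⟩, ?_, ?_⟩
  · rw [Kirchhoff.homGevreyNormSq_three_half]
    exact hflow.isC0Curve hd hc (Kirchhoff.measurable_gevreyWeight s η)
      (Kirchhoff.gevreyWeight_nonneg s η) hG
  · rw [Kirchhoff.homGevreyNormSq_half]
    exact hflow.isC1Curve hd hc (Kirchhoff.measurable_gevreyWeight s η)
      (Kirchhoff.gevreyWeight_nonneg s η) hG
  · rw [hflow.gradNormSq_eq hd hc ht]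
    exact ENNReal.ofReal_lt_top
  · rw [hgr t ht]
    exact hflow.equation hd h₀.1 hc ht ht0 ψ
  · intro T _ hT w z hw t ht
    have ht' : t ∈ Kirchhoff.timeInterval (Kirchhoff.lifeSpan volume Kirchhoff.freq g₀ g₁ φ) :=
      ⟨ht.1, ht.2.trans_le hT⟩
    obtain ⟨hfix, hwt⟩ := hw.isFix hn hφ hν₀ hφν hη hd h₀ h₁ ht
    have heq := hfix.unique hd hφ hν₀ hφν (hr t ht')
    refine (hwt.congr (.of_forall fun ξ => ?_)).ext (hflow t ht').1
    exact Kirchhoff.waveY_congr (fun x hx => by rw [heq x hx]) ⟨ht.1, le_rfl⟩ ξ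
  · by_cases htop : Kirchhoff.lifeSpan volume Kirchhoff.freq g₀ g₁ φ = ⊤
    · exact Or.inl htop
    refine Or.inr ⟨lt_top_iff_ne_top.mpr htop, ?_⟩
    have hT := (EReal.coe_toReal htop (EReal.bot_lt_zero.trans hpos).ne').symm
    set T := (Kirchhoff.lifeSpan volume Kirchhoff.freq g₀ g₁ φ).toReal
    have hT0 : 0 < T := by rwa [hT, EReal.coe_pos] at hpos
    by_contra hlim
    obtain ⟨M, hM, -⟩ := EReal.lt_iff_exists_real_btwn.mp (lt_top_iff_ne_top.mpr hlim)
    -- A limsup below `⊤` would bound the energy by a real `M` on some interval ending at `T`, which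
    -- `exists_lt_waveEnergy` excludes.
    have hev := eventually_lt_of_limsup_lt hM
    rw [eventually_iff, mem_nhdsLT_iff_exists_Ico_subset] at hev
    obtain ⟨a, ha, hsub⟩ := hev
    obtain ⟨t, ht, hMt⟩ := Kirchhoff.exists_lt_waveEnergy hd hφ hν₀ hφν hT hr
      (le_max_right a 0) (max_lt ha hT0) M
    have ht0 : 0 ≤ t := (le_max_right a 0).trans ht.1
    have htm : t ∈ Kirchhoff.timeInterval (Kirchhoff.lifeSpan volume Kirchhoff.freq g₀ g₁ φ) :=
      ⟨ht0, by rw [hT]; exact EReal.coe_lt_coe_iff.mpr ht.2⟩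
    have h2 := EReal.coe_lt_coe_iff.mp (hsub ⟨(le_max_left a 0).trans ht.1, ht.2⟩)
    rw [Kirchhoff.energy32_eq hd (hc t htm) ht0 (hflow t htm).1 (hflow t htm).2
      (by rw [hgr t htm])] at h2
    exact (hMt.trans h2).false
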